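/- Let $c\in(0,1)$ and $K\ge 1$. For $0<x<y$ and $\tau\in\mathbb R$ put $$\mathcal I(x,y,\tau)=\sum_{x\le\gamma<y}\left(i\left(\tfrac12-\rho\right)\right)^{-i\tau},$$ where $\rho=\beta+i\gamma$ runs over the nontrivial (non-real) zeros of the Riemann zeta-function, counted with multiplicity, and the power is the principal one. Then, uniformly for $2\le x<y\le Kx$ and $0\le\tau\le c\,x\log 2$, $$\mathcal I(x,y,\tau)=\int_x^y\frac{t^{-i\tau}}{2\pi}\log\frac{t}{2\pi}\,dt+O\left((\log x)^2\right),$$ where the implied constant depends only on $c$ and $K$. Moreover, for every $A>0$, uniformly for $2\le x<y\le Kx$ and $c\,x\log 2\le\tau\le A\,x\log x$, $$\mathcal I(x,y,\tau)=-\frac{e^{i(\tau+\pi/4)}\tau^{1/2-i\tau}}{(2\pi)^{1/2}}\sum_{e^{\tau/y}\le n\le e^{\tau/x}}\frac{\Lambda(n)(\log n)^{i\tau}}{n^{1/2}\log n}+\mathcal F,$$ where $\Lambda$ is the von Mangoldt function and $$\mathcal F\ll e^{\tau/(2x)}\left((\log x)^2+\left(\frac{\tau}{x}\right)^2\log x\right)+\tau^{1/2}e^{\tau/(2x)-\tau/y}\,\frac{\tau}{x},$$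 with an implied constant depending only on $c$, $K$ and $A$. -/

import Mathlib

open Complex

noncomputable section

/-- The nontrivial (that is, non-real) zeros `ρ = β + iγ` of the Riemann zeta-function with
`x ≤ γ < y`. -/
def nontrivialZerosBetween (x y : ℝ) : Set ℂ :=
  {ρ : ℂ | riemannZeta ρ = 0 ∧ ρ.im ≠ 0 ∧ x ≤ ρ.im ∧ ρ.im < y}

/-- A non-real zero of `ζ` lies in the critical strip. -/
theorem re_mem_Icc_of_nontrivial_zero {ρ : ℂ} (h : riemannZeta ρ = 0) (him : ρ.im ≠ 0) :
    0 ≤ ρ.re ∧ ρ.re ≤ 1 := by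
  have h1 : ρ.re ≤ 1 := by
    by_contra hlt
    exact riemannZeta_ne_zero_of_one_le_re (le_of_lt (not_le.mp hlt)) h
  refine ⟨?_, h1⟩
  by_contra hlt
  have hre : (1 : ℝ) ≤ (1 - ρ).re := by simp; linarith
  have him' : (1 - ρ).im ≠ 0 := by simpa using him
  have key := riemannZeta_one_sub (s := 1 - ρ)
    (fun n hn => him' (by rw [hn]; simp)) (fun hn => him' (by rw [hn]; simp))
  rw [sub_sub_cancel, h] at key
  have hG : Complex.Gamma (1 - ρ) ≠ 0 :=
    Complex.Gamma_ne_zero_of_re_pos (by linarith)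
  have hz := riemannZeta_ne_zero_of_one_le_re hre
  have hc : Complex.cos ((Real.pi : ℂ) * (1 - ρ) / 2) ≠ 0 := by
    rw [Complex.cos_ne_zero_iff]
    intro k hk
    have h2 := congrArg Complex.im hk
    have e1 : ((Real.pi : ℂ) * (1 - ρ) / 2).im = Real.pi * (1 - ρ).im / 2 := by
      simp
    have e2 : ((2 * (k : ℂ) + 1) * (Real.pi : ℂ) / 2).im = 0 := by
      simp
    rw [e1, e2] at h2
    have : Real.pi * (1 - ρ).im = 0 := by linarith
    rcases mul_eq_zero.mp this with h3 | h3
    · exact Real.pi_ne_zero h3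
    · exact him' h3
  exact (by simp [hG, hz, hc] : (2 : ℂ) * (2 * (Real.pi : ℂ)) ^ (-(1 - ρ)) *
    Complex.Gamma (1 - ρ) * Complex.cos ((Real.pi : ℂ) * (1 - ρ) / 2) *
    riemannZeta (1 - ρ) ≠ 0) key.symm

/-- Only finitely many nontrivial zeros have their ordinate in a bounded interval, so that the
`finsum` below is a genuine finite sum. -/
theorem nontrivialZerosBetween_finite (x y : ℝ) : (nontrivialZerosBetween x y).Finite := by
  have hK : IsCompact (Set.Icc (0 : ℝ) 1 ×ℂ Set.Icc x y) := isCompact_Icc.reProdIm isCompact_Icc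
  refine hK.inter_riemannZetaZeros_finite.subset ?_
  rintro ρ ⟨h0, him, hx, hy⟩
  exact ⟨⟨re_mem_Icc_of_nontrivial_zero h0 him, hx, hy.le⟩, h0⟩

/-- `𝓘(x, y, τ) = ∑_{x ≤ γ < y} (i (1/2 - ρ)) ^ (-iτ)`, the sum over the nontrivial zeros
`ρ = β + iγ` of `ζ` counted with multiplicity, the power being the principal one
(`i (1/2 - ρ)` has real part `γ`). -/
def zeroSum (x y τ : ℝ) : ℂ :=
  ∑ᶠ ρ ∈ nontrivialZerosBetween x y,
    (analyticOrderNatAt riemannZeta ρ : ℂ) * (I * (1 / 2 - ρ)) ^ (-(I * (τ : ℂ)))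

/-- `∫_x^y t^{-iτ} / (2π) · log (t / 2π) dt`. -/
def mainIntegral (x y τ : ℝ) : ℂ :=
  ∫ t in x..y, (t : ℂ) ^ (-(I * (τ : ℂ))) / (2 * (Real.pi : ℂ)) *
    (Real.log (t / (2 * Real.pi)) : ℂ)

/-- `e^{i(τ + π/4)} τ^{1/2 - iτ} / (2π)^{1/2} ·
  ∑_{e^{τ/y} ≤ n ≤ e^{τ/x}} Λ(n) (log n)^{iτ} / (n^{1/2} log n)`. -/
def stationaryTerm (x y τ : ℝ) : ℂ :=
  Complex.exp (I * ((τ : ℂ) + (Real.pi : ℂ) / 4)) * (τ : ℂ) ^ (1 / 2 - I * (τ : ℂ)) /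
      (Real.sqrt (2 * Real.pi) : ℂ) *
    ∑ n ∈ Finset.Icc ⌈Real.exp (τ / y)⌉₊ ⌊Real.exp (τ / x)⌋₊,
      (ArithmeticFunction.vonMangoldt n : ℂ) * (Real.log n : ℂ) ^ (I * (τ : ℂ)) /
        ((Real.sqrt n : ℂ) * (Real.log n : ℂ))

/-- `e^{τ/(2x)} ((log x)² + (τ/x)² log x) + τ^{1/2} e^{τ/(2x) - τ/y} τ/x`. -/
def errorBound (x y τ : ℝ) : ℝ :=
  Real.exp (τ / (2 * x)) * (Real.log x ^ 2 + (τ / x) ^ 2 * Real.log x) +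
    Real.sqrt τ * Real.exp (τ / (2 * x) - τ / y) * (τ / x)

end

/-! ### Splitting off the zeros of an analytic function -/

open Set Filter Topology

/-! The weight `(i(1/2 - s))^{-iτ}` is holomorphic in the upper half-plane, so the argument
principle with weight (`rectIntegral_mul_logDeriv`) writes `2πi` times the sum over zeros as the
integral of weight times `ζ'/ζ` around a rectangle with vertical sides `Re s = 1 - a` and `Re s =
a`, where `a = 1 + 1/(4 log x)`. With this `a` the series `∑ Λ(n) n^{-a}` is `O(log x)`, while the
weight on the left side, of modulus at most `exp(τ(a - 1/2)/x)`, is `O(e^{τ/(2x)})` for `τ ≤ A x log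
x`.

Horizontal sides: Landau's lemma (`logDeriv_sub_sum_zeros`) shows that unit windows contain `O(log
T)` zeros and that `ζ'/ζ` is a sum of simple fractions over nearby zeros up to `O(log T)`. By
pigeonhole every unit interval contains a height staying `1/log T` away from all zeros, up to a
constant, where `ζ'/ζ = O(log² T)` (`exists_good_height`). Moving the ends of the range to such
heights costs only boundedly many unit windows of zeros.

Right side: the phase `-t log n - τ log t` has no stationary point, and the first derivative test
gives `O(log² x)`.

Left side: by the functional equation `ζ'/ζ(s)` is `zetaReflection s` minus `ζ'/ζ(1 - s)`. The
reflection term is moved to the critical line, where it equals `-log(t/2π) + O(1/t)`, a consequence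
of `ψ(s) = log s + O(1/|Im s|)`; this produces the main integral. The second term is expanded into
its Dirichlet series and leaves `∑ Λ(n) ∫ n^{s-1} (i(1/2 - s))^{-iτ} dt`. The result is
`exists_zeroSum_formula`.

For the `n`-th integral the phase is `t log n - τ log t`, stationary at `t = τ / log n`. If `τ ≤ c x
log 2` with `c < 1`, then `log n - τ/t ≥ (1 - c) log 2` for all `n ≥ 2`, no stationary point occurs,
and the sum over `n` is negligible. If `τ ≥ c x log 2`, the main integral is itself `O(log x)`,
terms with `n > 2 e^{τ/x}` are again handled by the first derivative test, and the remaining ones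
are moved to the critical line. There `t = v τ / log n` turns the phase into `τ(v - 1 - log v)` up
to a constant, the same function for every `n`, to which `exists_stationary_phase` applies: it is
half the square of an analytic coordinate, so the integral is a Fresnel integral up to `O(1/τ)`. The
stationary values for `e^{τ/y} ≤ n ≤ e^{τ/x}` make up the arithmetic sum. The errors from the
endpoints are large only for the `n` next to `e^{τ/x}` or `e^{τ/y}`; these few `n` cause the last
term of `errorBound`, all others the first (`exists_sum_error_le`). -/

theorem AnalyticOnNhd.exists_eq_pow_mul {U : Set ℂ} {f : ℂ → ℂ} (hf : AnalyticOnNhd ℂ f U)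
    {ρ : ℂ} (hρ : ρ ∈ U) {m : ℕ} (hm : analyticOrderAt f ρ = m) :
    ∃ g : ℂ → ℂ, AnalyticOnNhd ℂ g U ∧ g ρ ≠ 0 ∧ ∀ z, f z = (z - ρ) ^ m * g z := by
  obtain ⟨g₀, hg₀, hne, heq⟩ := ((hf ρ hρ).analyticOrderAt_eq_natCast).1 hm
  classical
  -- The quotient is taken globally and not just near `ρ`, so the factorisation holds at every `z`,
  -- even outside `U`.
  set g : ℂ → ℂ := fun z => if z = ρ then g₀ ρ else f z / (z - ρ) ^ m with hg
  have hloc : g =ᶠ[𝓝 ρ] g₀ := by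
    filter_upwards [heq] with z hz
    by_cases h : z = ρ
    · simp [hg, h]
    · have h' : z - ρ ≠ 0 := sub_ne_zero.2 h
      simp only [hg, h, if_false, hz, smul_eq_mul]
      field_simp
  refine ⟨g, fun z hz => ?_, by simpa [hg] using hne, fun z => ?_⟩
  · by_cases h : z = ρ
    · subst h
      exact hg₀.congr hloc.symm
    · have hz' : z - ρ ≠ 0 := sub_ne_zero.2 h
      have h1 : AnalyticAt ℂ (fun w => f w / (w - ρ) ^ m) z :=
        (hf z hz).div ((analyticAt_id.sub analyticAt_const).pow m) (pow_ne_zero _ hz')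
      refine h1.congr ?_
      filter_upwards [isOpen_ne.mem_nhds h] with w hw
      simp [hg, show w ≠ ρ from hw]
  · by_cases h : z = ρ
    · subst h
      simpa [hg] using heq.self_of_nhds
    · have h' : z - ρ ≠ 0 := sub_ne_zero.2 h
      simp only [hg, h, if_false]
      field_simp

theorem AnalyticOnNhd.exists_eq_prod_pow_mul {U : Set ℂ} {f : ℂ → ℂ} (hf : AnalyticOnNhd ℂ f U)
    (m : ℂ → ℕ) (S : Finset ℂ) (hS : ∀ ρ ∈ S, ρ ∈ U) (hm : ∀ ρ ∈ S, analyticOrderAt f ρ = m ρ) :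
    ∃ g : ℂ → ℂ, AnalyticOnNhd ℂ g U ∧ (∀ ρ ∈ S, g ρ ≠ 0) ∧
      ∀ z, f z = (∏ ρ ∈ S, (z - ρ) ^ m ρ) * g z := by
  classical
  induction S using Finset.induction_on with
  | empty => exact ⟨f, hf, by simp, by simp⟩
  | insert ρ₀ S hnot ih =>
    obtain ⟨g, hg, hgS, hfg⟩ := ih (fun ρ h => hS ρ (Finset.mem_insert_of_mem h))
      (fun ρ h => hm ρ (Finset.mem_insert_of_mem h))
    have hρ₀ : ρ₀ ∈ U := hS ρ₀ (Finset.mem_insert_self _ _)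
    have hP : AnalyticAt ℂ (fun z => ∏ ρ ∈ S, (z - ρ) ^ m ρ) ρ₀ := by
      fun_prop
    have hP0 : (∏ ρ ∈ S, (ρ₀ - ρ) ^ m ρ) ≠ 0 := by
      refine Finset.prod_ne_zero_iff.2 fun ρ h => pow_ne_zero _ (sub_ne_zero.2 ?_)
      rintro rfl
      exact hnot h
    -- Orders add under multiplication, and the factors already split off do not vanish at `ρ₀`.
    have hord : analyticOrderAt g ρ₀ = m ρ₀ := by
      have h1 : f = (fun z => ∏ ρ ∈ S, (z - ρ) ^ m ρ) * g := funext hfg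
      have h2 := hm ρ₀ (Finset.mem_insert_self _ _)
      rw [h1, analyticOrderAt_mul hP (hg ρ₀ hρ₀), hP.analyticOrderAt_eq_zero.2 hP0, zero_add] at h2
      exact h2
    obtain ⟨g', hg', hne, heq⟩ := hg.exists_eq_pow_mul hρ₀ hord
    refine ⟨g', hg', fun ρ hρ => ?_, fun z => ?_⟩
    · rcases Finset.mem_insert.1 hρ with rfl | h
      · exact hne
      · intro h0
        exact hgS ρ h (by rw [heq, h0, mul_zero])
    · rw [hfg, heq, Finset.prod_insert hnot]
      ring

theorem logDeriv_prod_pow_mul {f g : ℂ → ℂ} {m : ℂ → ℕ} {S : Finset ℂ}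
    (hfg : ∀ z, f z = (∏ ρ ∈ S, (z - ρ) ^ m ρ) * g z) {z : ℂ} (hz : f z ≠ 0)
    (hzS : z ∉ S) (hg : DifferentiableAt ℂ g z) :
    logDeriv f z = ∑ ρ ∈ S, (m ρ : ℂ) / (z - ρ) + logDeriv g z := by
  have hgz : g z ≠ 0 := fun h => hz (by rw [hfg, h, mul_zero])
  have hne : ∀ ρ ∈ S, z - ρ ≠ 0 := fun ρ h => sub_ne_zero.2 (by rintro rfl; exact hzS h)
  have h1 : f = fun z => (fun z => ∏ ρ ∈ S, (z - ρ) ^ m ρ) z * g z := funext hfg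
  rw [h1, logDeriv_mul z (Finset.prod_ne_zero_iff.2 fun ρ h => pow_ne_zero _ (hne ρ h)) hgz
    (by fun_prop) hg]
  congr 1
  rw [logDeriv_prod (f := fun ρ z => (z - ρ) ^ m ρ) (fun ρ h => pow_ne_zero _ (hne ρ h))
    (fun ρ _ => by fun_prop)]
  refine Finset.sum_congr rfl fun ρ h => ?_
  rw [logDeriv_fun_pow (f := fun z => z - ρ) (by fun_prop)]
  simp [logDeriv_apply, div_eq_mul_inv]

/-! ### Rectangle integrals and the argument principle -/

/-- The integral of `F` along the boundary of the rectangle `[a, b] × [c, d]`, counterclockwise. -/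
noncomputable def rectIntegral (F : ℂ → ℂ) (a b c d : ℝ) : ℂ :=
  (∫ x in a..b, F (x + c * I)) - (∫ x in a..b, F (x + d * I)) +
    I * (∫ y in c..d, F (b + y * I)) - I * ∫ y in c..d, F (a + y * I)

/-- The boundary of the rectangle `[a, b] × [c, d]`. -/
def rectBoundary (a b c d : ℝ) : Set ℂ :=
  {z | z.re ∈ Icc a b ∧ (z.im = c ∨ z.im = d) ∨ (z.re = a ∨ z.re = b) ∧ z.im ∈ Icc c d}

theorem rectBoundary_subset {a b c d : ℝ} (hab : a ≤ b) (hcd : c ≤ d) :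
    rectBoundary a b c d ⊆ Icc a b ×ℂ Icc c d := by
  intro z hz
  rw [mem_reProdIm]
  rcases hz with ⟨h1, h2 | h2⟩ | ⟨h1 | h1, h2⟩
  · exact ⟨h1, by rw [h2]; exact left_mem_Icc.2 hcd⟩
  · exact ⟨h1, by rw [h2]; exact right_mem_Icc.2 hcd⟩
  · exact ⟨by rw [h1]; exact left_mem_Icc.2 hab, h2⟩
  · exact ⟨by rw [h1]; exact right_mem_Icc.2 hab, h2⟩

theorem rectIntegral_eq_zero {F : ℂ → ℂ} {a b c d : ℝ} (hab : a ≤ b) (hcd : c ≤ d)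
    (hF : DifferentiableOn ℂ F (Icc a b ×ℂ Icc c d)) : rectIntegral F a b c d = 0 := by
  have h := integral_boundary_rect_eq_zero_of_differentiableOn F (a + c * I) (b + d * I)
    (by simpa [uIcc_of_le hab, uIcc_of_le hcd] using hF)
  simpa [rectIntegral, smul_eq_mul] using h

section linear
variable {F G : ℂ → ℂ} {a b c d : ℝ}

theorem continuousOn_sides (hab : a ≤ b) (hcd : c ≤ d)
    (hF : ContinuousOn F (rectBoundary a b c d)) :
    IntervalIntegrable (fun x : ℝ => F (x + c * I)) MeasureTheory.volume a b ∧
    IntervalIntegrable (fun x : ℝ => F (x + d * I)) MeasureTheory.volume a b ∧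
    IntervalIntegrable (fun y : ℝ => F (b + y * I)) MeasureTheory.volume c d ∧
    IntervalIntegrable (fun y : ℝ => F (a + y * I)) MeasureTheory.volume c d := by
  refine ⟨?_, ?_, ?_, ?_⟩ <;> apply ContinuousOn.intervalIntegrable <;>
    refine hF.comp (by fun_prop) ?_ <;> intro t ht
  · rw [uIcc_of_le hab] at ht; exact Or.inl ⟨by simpa using ht, by simp⟩
  · rw [uIcc_of_le hab] at ht; exact Or.inl ⟨by simpa using ht, by simp⟩
  · rw [uIcc_of_le hcd] at ht; exact Or.inr ⟨by simp, by simpa using ht⟩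
  · rw [uIcc_of_le hcd] at ht; exact Or.inr ⟨by simp, by simpa using ht⟩

theorem rectIntegral_add (hab : a ≤ b) (hcd : c ≤ d)
    (hF : ContinuousOn F (rectBoundary a b c d)) (hG : ContinuousOn G (rectBoundary a b c d)) :
    rectIntegral (fun z => F z + G z) a b c d = rectIntegral F a b c d + rectIntegral G a b c d := by
  obtain ⟨f1, f2, f3, f4⟩ := continuousOn_sides hab hcd hF
  obtain ⟨g1, g2, g3, g4⟩ := continuousOn_sides hab hcd hG
  simp only [rectIntegral]
  rw [intervalIntegral.integral_add f1 g1, intervalIntegral.integral_add f2 g2,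
    intervalIntegral.integral_add f3 g3, intervalIntegral.integral_add f4 g4]
  ring

theorem rectIntegral_const_mul (k : ℂ) :
    rectIntegral (fun z => k * F z) a b c d = k * rectIntegral F a b c d := by
  simp only [rectIntegral, intervalIntegral.integral_const_mul]
  ring

theorem rectIntegral_congr (hab : a ≤ b) (hcd : c ≤ d)
    (h : ∀ z ∈ rectBoundary a b c d, F z = G z) :
    rectIntegral F a b c d = rectIntegral G a b c d := by
  simp only [rectIntegral]
  congr 1
  · congr 1
    · congr 1 <;> refine intervalIntegral.integral_congr fun t ht => h _ ?_ <;>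
        rw [uIcc_of_le hab] at ht <;> exact Or.inl ⟨by simpa using ht, by simp⟩
    · congr 1
      refine intervalIntegral.integral_congr fun t ht => h _ ?_
      rw [uIcc_of_le hcd] at ht; exact Or.inr ⟨by simp, by simpa using ht⟩
  · congr 1
    refine intervalIntegral.integral_congr fun t ht => h _ ?_
    rw [uIcc_of_le hcd] at ht; exact Or.inr ⟨by simp, by simpa using ht⟩

theorem rectIntegral_sum {ι : Type*} (S : Finset ι) {F : ι → ℂ → ℂ} (hab : a ≤ b) (hcd : c ≤ d)
    (hF : ∀ i ∈ S, ContinuousOn (F i) (rectBoundary a b c d)) :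
    rectIntegral (fun z => ∑ i ∈ S, F i z) a b c d = ∑ i ∈ S, rectIntegral (F i) a b c d := by
  classical
  induction S using Finset.induction_on with
  | empty => simp [rectIntegral]
  | insert i S hi ih =>
    simp only [Finset.sum_insert hi]
    rw [rectIntegral_add hab hcd (hF i (Finset.mem_insert_self _ _))
      (continuousOn_finsetSum _ fun j hj => hF j (Finset.mem_insert_of_mem hj)),
      ih fun j hj => hF j (Finset.mem_insert_of_mem hj)]

end linear

/-- Explicit antiderivatives: the principal logarithm of `z - ρ` on three sides and `log(-(z - ρ))`
on the left side, which crosses the branch cut. Changing back at the two left corners costs `-πi`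
and `+πi`, and these two jumps add up to the value of the integral. -/
theorem rectIntegral_inv_sub {a b c d : ℝ} {ρ : ℂ} (ha : a < ρ.re) (hb : ρ.re < b)
    (hc : c < ρ.im) (hd : ρ.im < d) :
    rectIntegral (fun z => (z - ρ)⁻¹) a b c d = 2 * Real.pi * I := by
  have hor : ∀ k : ℝ, k - ρ.im ≠ 0 → ∫ x in a..b, ((x : ℂ) + k * I - ρ)⁻¹ =
      log ((b : ℂ) + k * I - ρ) - log ((a : ℂ) + k * I - ρ) := by
    intro k hk
    rw [intervalIntegral.integral_eq_sub_of_hasDerivAt (f := fun x : ℝ => log ((x : ℂ) + k * I - ρ))]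
    · intro x _
      have hs : (x : ℂ) + k * I - ρ ∈ slitPlane := Or.inr (by simpa using hk)
      have := (((hasDerivAt_id (x : ℂ)).add_const ((k : ℂ) * I)).sub_const ρ).clog hs
      simpa [div_eq_mul_inv] using this.comp_ofReal
    · refine ContinuousOn.intervalIntegrable fun x _ => ContinuousAt.continuousWithinAt ?_
      have : (x : ℂ) + k * I - ρ ≠ 0 := fun h => hk (by simpa using congrArg im h)
      fun_prop (disch := assumption)
  have hright : ∫ y in c..d, ((b : ℂ) + y * I - ρ)⁻¹ =
      -I * log ((b : ℂ) + d * I - ρ) - -I * log ((b : ℂ) + c * I - ρ) := by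
    rw [intervalIntegral.integral_eq_sub_of_hasDerivAt
      (f := fun y : ℝ => -I * log ((b : ℂ) + y * I - ρ))]
    · intro y _
      have hs : (b : ℂ) + y * I - ρ ∈ slitPlane := Or.inl (by simpa using hb)
      have := (((((hasDerivAt_id (y : ℂ)).mul_const I).const_add (b : ℂ)).sub_const ρ).clog
        hs).const_mul (-I)
      have h2 := this.comp_ofReal
      refine h2.congr_deriv ?_
      simp only [id]
      rw [one_mul, div_eq_mul_inv, ← mul_assoc, neg_mul, I_mul_I]
      simp
    · refine ContinuousOn.intervalIntegrable fun y _ => ContinuousAt.continuousWithinAt ?_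
      have : (b : ℂ) + y * I - ρ ≠ 0 := fun h => by
        have := congrArg re h
        simp at this
        linarith
      fun_prop (disch := assumption)
  have hleft : ∫ y in c..d, ((a : ℂ) + y * I - ρ)⁻¹ =
      -I * log (-((a : ℂ) + d * I - ρ)) - -I * log (-((a : ℂ) + c * I - ρ)) := by
    rw [intervalIntegral.integral_eq_sub_of_hasDerivAt
      (f := fun y : ℝ => -I * log (-((a : ℂ) + y * I - ρ)))]
    · intro y _
      have hs : -((a : ℂ) + y * I - ρ) ∈ slitPlane := Or.inl (by simpa using ha)
      have := (((((hasDerivAt_id (y : ℂ)).mul_const I).const_add (a : ℂ)).sub_const ρ).neg.clog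
        hs).const_mul (-I)
      have h2 := this.comp_ofReal
      refine h2.congr_deriv ?_
      simp only [id, Pi.neg_apply]
      rw [one_mul, neg_div_neg_eq, div_eq_mul_inv, ← mul_assoc, neg_mul, I_mul_I]
      simp
    · refine ContinuousOn.intervalIntegrable fun y _ => ContinuousAt.continuousWithinAt ?_
      have : (a : ℂ) + y * I - ρ ≠ 0 := fun h => by
        have := congrArg re h
        simp at this
        linarith
      fun_prop (disch := assumption)
  have hneg1 : log (-((a : ℂ) + d * I - ρ)) = log ((a : ℂ) + d * I - ρ) - Real.pi * I := by
    rw [log, log, norm_neg, arg_neg_eq_arg_sub_pi_of_im_pos (by simpa using hd)]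
    push_cast; ring
  have hneg2 : log (-((a : ℂ) + c * I - ρ)) = log ((a : ℂ) + c * I - ρ) + Real.pi * I := by
    rw [log, log, norm_neg, arg_neg_eq_arg_add_pi_of_im_neg (by simpa using hc)]
    push_cast; ring
  rw [rectIntegral, hor c (by linarith), hor d (by linarith), hright, hleft, hneg1, hneg2]
  linear_combination (-2 * Real.pi * I + log ((b : ℂ) + c * I - ρ) - log ((a : ℂ) + c * I - ρ) -
    log ((b : ℂ) + d * I - ρ) + log ((a : ℂ) + d * I - ρ)) * I_sq

/-- Removing `f ρ / (z - ρ)` leaves the difference quotient `dslope f ρ`, which is holomorphic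
across `ρ` and integrates to zero. -/
theorem rectIntegral_mul_inv_sub {a b c d : ℝ} {ρ : ℂ} {f : ℂ → ℂ} (ha : a < ρ.re) (hb : ρ.re < b)
    (hc : c < ρ.im) (hd : ρ.im < d) {U : Set ℂ} (hU : IsOpen U) (hR : Icc a b ×ℂ Icc c d ⊆ U)
    (hf : DifferentiableOn ℂ f U) :
    rectIntegral (fun z => f z * (z - ρ)⁻¹) a b c d = 2 * Real.pi * I * f ρ := by
  have hρU : ρ ∈ U := hR ⟨⟨ha.le, hb.le⟩, ⟨hc.le, hd.le⟩⟩
  have hsub := rectBoundary_subset (a := a) (b := b) (c := c) (d := d) (by linarith) (by linarith)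
  have hne : ∀ z ∈ rectBoundary a b c d, z - ρ ≠ 0 := by
    intro z hz h
    obtain rfl := sub_eq_zero.1 h
    rcases hz with ⟨_, h2 | h2⟩ | ⟨h1 | h1, _⟩ <;> linarith
  have hds : DifferentiableOn ℂ (dslope f ρ) U :=
    (Complex.differentiableOn_dslope (hU.mem_nhds hρU)).2 hf
  rw [rectIntegral_congr (by linarith) (by linarith)
    (G := fun z => dslope f ρ z + f ρ * (z - ρ)⁻¹), rectIntegral_add (by linarith) (by linarith),
    rectIntegral_const_mul, rectIntegral_inv_sub ha hb hc hd,
    rectIntegral_eq_zero (by linarith) (by linarith) (hds.mono hR)]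
  · ring
  · exact (hds.mono (hsub.trans hR)).continuousOn
  · exact continuousOn_const.mul ((continuousOn_id.sub continuousOn_const).inv₀ hne)
  · intro z hz
    have h := hne z hz
    rw [dslope_of_ne _ (sub_ne_zero.1 h), slope_def_field]
    field_simp
    ring

/-- The argument principle on a rectangle, with a holomorphic weight. -/
theorem rectIntegral_mul_logDeriv {a b c d : ℝ} {f F : ℂ → ℂ} {U : Set ℂ} (hab : a < b)
    (hcd : c < d) (hU : IsOpen U)
    (hR : Icc a b ×ℂ Icc c d ⊆ U) (hf : DifferentiableOn ℂ f U) (hF : AnalyticOnNhd ℂ F U)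
    (S : Finset ℂ) (hS : ∀ z, z ∈ S ↔ z ∈ Icc a b ×ℂ Icc c d ∧ F z = 0)
    (hb : ∀ z ∈ rectBoundary a b c d, F z ≠ 0) (hord : ∀ z ∈ S, analyticOrderAt F z ≠ ⊤) :
    rectIntegral (fun z => f z * logDeriv F z) a b c d =
      2 * Real.pi * I * ∑ ρ ∈ S, (analyticOrderNatAt F ρ : ℂ) * f ρ := by
  obtain ⟨g, hg, hgS, hfg⟩ := hF.exists_eq_prod_pow_mul (analyticOrderNatAt F) S
    (fun ρ h => hR ((hS ρ).1 h).1) (fun ρ h => (Nat.cast_analyticOrderNatAt (hord ρ h)).symm)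
  have hsub := rectBoundary_subset (a := a) (b := b) (c := c) (d := d) (by linarith) (by linarith)
  have hgR : ∀ z ∈ Icc a b ×ℂ Icc c d, g z ≠ 0 := by
    intro z hz h0
    by_cases h : z ∈ S
    · exact hgS z h h0
    · exact h ((hS z).2 ⟨hz, by rw [hfg, h0, mul_zero]⟩)
  have hnot : ∀ z ∈ rectBoundary a b c d, z ∉ S := fun z hz h => hb z hz ((hS z).1 h).2
  have hne : ∀ ρ ∈ S, ∀ z ∈ rectBoundary a b c d, z - ρ ≠ 0 := by
    intro ρ hρ z hz h
    obtain rfl := sub_eq_zero.1 h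
    exact hnot _ hz hρ
  have hlog : DifferentiableOn ℂ (fun z => f z * logDeriv g z) (Icc a b ×ℂ Icc c d) := by
    intro z hz
    refine DifferentiableAt.differentiableWithinAt ?_
    have hgz := hg z (hR hz)
    refine (hf.differentiableAt (hU.mem_nhds (hR hz))).mul ?_
    exact hgz.deriv.differentiableAt.div hgz.differentiableAt (hgR z hz)
  have hcont : ∀ ρ ∈ S, ContinuousOn
      (fun z => (analyticOrderNatAt F ρ : ℂ) * (f z * (z - ρ)⁻¹)) (rectBoundary a b c d) := by
    intro ρ hρ
    exact continuousOn_const.mul ((hf.mono (hsub.trans hR)).continuousOn.mul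
      ((continuousOn_id.sub continuousOn_const).inv₀ (hne ρ hρ)))
  -- On the boundary `F'/F` is a sum of simple fractions plus the logarithmic derivative of the
  -- zero-free cofactor; the latter contributes nothing by Cauchy's theorem.
  rw [rectIntegral_congr hab.le hcd.le (G := fun z =>
      (∑ ρ ∈ S, (analyticOrderNatAt F ρ : ℂ) * (f z * (z - ρ)⁻¹)) + f z * logDeriv g z),
    rectIntegral_add hab.le hcd.le (continuousOn_finsetSum _ hcont)
      (hlog.mono hsub).continuousOn,
    rectIntegral_eq_zero hab.le hcd.le hlog, add_zero,
    rectIntegral_sum _ hab.le hcd.le hcont, Finset.mul_sum]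
  · refine Finset.sum_congr rfl fun ρ hρ => ?_
    obtain ⟨⟨⟨h1, h2⟩, ⟨h3, h4⟩⟩, h5⟩ := (hS ρ).1 hρ
    -- Zeros in the closed rectangle are interior, since `F` does not vanish on the boundary.
    have hnb : ρ ∉ rectBoundary a b c d := fun h => hb ρ h h5
    rw [rectBoundary, mem_ofPred_eq] at hnb
    push Not at hnb
    obtain ⟨n1, n2⟩ := hnb
    have k1 := n1 ⟨h1, h2⟩
    have k2 : ρ.re ≠ a ∧ ρ.re ≠ b := by
      constructor <;> intro h
      · exact n2 (Or.inl h) ⟨h3, h4⟩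
      · exact n2 (Or.inr h) ⟨h3, h4⟩
    rw [rectIntegral_const_mul, rectIntegral_mul_inv_sub (lt_of_le_of_ne h1 k2.1.symm)
      (lt_of_le_of_ne h2 k2.2) (lt_of_le_of_ne h3 k1.1.symm) (lt_of_le_of_ne h4 k1.2) hU hR hf]
    ring
  · intro z hz
    rw [logDeriv_prod_pow_mul hfg (hb z hz) (hnot z hz) (hg z (hR (hsub hz))).differentiableAt,
      mul_add, Finset.mul_sum]
    congr 1
    refine Finset.sum_congr rfl fun ρ _ => ?_
    rw [div_eq_mul_inv]
    ring

/-! ### Landau's lemma on logarithmic derivatives -/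

open Set Filter Topology Metric ComplexConjugate

/-- On the circle `R² = u ū`, so the Blaschke factor `(R² - w̄u)/R` has the same modulus there as `u
- w`. Zeros can thus be exchanged for such factors without changing the modulus on the circle. -/
theorem norm_sq_sub_conj_mul {R : ℝ} (u w : ℂ) (hu : ‖u‖ = R) :
    ‖(R : ℂ) ^ 2 - conj w * u‖ = R * ‖u - w‖ := by
  have h : (R : ℂ) ^ 2 - conj w * u = u * conj (u - w) := by
    rw [map_sub, mul_sub, mul_conj, normSq_eq_norm_sq, hu]
    push_cast; ring
  rw [h, norm_mul, norm_conj, hu]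

/-- A non-vanishing holomorphic function on a disc whose modulus is at most `M` times its value at
the centre has logarithmic derivative `O(log M)` in smaller discs. -/
theorem norm_logDeriv_le_of_ne_zero {G : ℂ → ℂ} {s₀ : ℂ} {r₁ r₂ M : ℝ} (hr₁ : 0 ≤ r₁)
    (hr : r₁ < r₂) (hM : 1 < M) (hG : DifferentiableOn ℂ G (ball s₀ r₂))
    (hne : ∀ z ∈ ball s₀ r₂, G z ≠ 0) (hle : ∀ z ∈ ball s₀ r₂, ‖G z‖ ≤ M * ‖G s₀‖)
    {z : ℂ} (hz : z ∈ closedBall s₀ r₁) :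
    ‖logDeriv G z‖ ≤ 4 * (r₁ + r₂) / (r₂ - r₁) ^ 2 * Real.log M := by
  have hr₂ : 0 < r₂ := by linarith
  have hs₀ : s₀ ∈ ball s₀ r₂ := mem_ball_self hr₂
  have hlogM : 0 < Real.log M := Real.log_pos hM
  have hd : DifferentiableOn ℂ (logDeriv G) (ball s₀ r₂) :=
    (hG.deriv isOpen_ball).div hG hne
  -- A primitive of `G'/G`: then `G = G(s₀) e^h`, and the bound on `|G|` becomes a one-sided bound
  -- on `Re h`.
  obtain ⟨h, h0, hh⟩ := (hd.isExactOn_ball).with_val_at s₀ 0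
  have hexp : ∀ w ∈ ball s₀ r₂, G w = G s₀ * exp (h w) := by
    intro w hw
    have hder : ∀ v ∈ ball s₀ r₂, HasDerivAt (fun v => G v * exp (-h v)) 0 v := by
      intro v hv
      have hGv := (hG.differentiableAt (isOpen_ball.mem_nhds hv)).hasDerivAt
      refine (hGv.mul (hh v hv).neg.cexp).congr_deriv ?_
      rw [logDeriv_apply]
      have := hne v hv
      field_simp
      ring
    have hc := (convex_ball s₀ r₂).is_const_of_fderivWithin_eq_zero (𝕜 := ℂ)
      (f := fun v => G v * exp (-h v))
      (fun v hv => (hder v hv).differentiableAt.differentiableWithinAt)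
      (fun v hv => by
        rw [fderivWithin_of_isOpen isOpen_ball hv, (hder v hv).hasFDerivAt.fderiv]
        simp) hw hs₀
    simp only [h0, neg_zero, exp_zero, mul_one] at hc
    rw [← hc, mul_assoc, ← exp_add]
    simp
  have hre : ∀ w ∈ ball s₀ r₂, (h w).re ≤ Real.log M := by
    intro w hw
    have h1 := hle w hw
    have hG0 : 0 < ‖G s₀‖ := norm_pos_iff.2 (hne s₀ hs₀)
    rw [hexp w hw, norm_mul, norm_exp, mul_comm] at h1
    have h2 : Real.exp (h w).re ≤ M := le_of_mul_le_mul_right h1 hG0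
    exact (Real.le_log_iff_exp_le (by linarith)).2 h2
  have hdiff : DifferentiableOn ℂ h (ball s₀ r₂) :=
    fun w hw => (hh w hw).differentiableAt.differentiableWithinAt
  set r := (r₂ - r₁) / 2 with hrdef
  have hrpos : 0 < r := by rw [hrdef]; linarith
  have hzd : dist z s₀ ≤ r₁ := hz
  have hbd : ∀ w ∈ sphere z r, ‖h w‖ ≤ 2 * Real.log M * ((r₁ + r₂) / 2) / r := by
    intro w hw
    have hws : dist w s₀ ≤ (r₁ + r₂) / 2 := by
      have := dist_triangle w z s₀
      rw [mem_sphere.1 hw] at this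
      linarith
    have hmem : w - s₀ ∈ ball (0 : ℂ) r₂ := by
      rw [mem_ball_zero_iff, ← dist_eq_norm]; linarith
    have hadd : ∀ v ∈ ball (0 : ℂ) r₂, v + s₀ ∈ ball s₀ r₂ := by
      intro v hv
      rw [mem_ball, dist_eq_norm, add_sub_cancel_right]
      exact mem_ball_zero_iff.1 hv
    -- Borel–Carathéodory passes from `Re h` to `|h|`; Cauchy's estimate on a circle of radius `(r₂
    -- - r₁)/2` then bounds `h' = G'/G`.
    have := borelCaratheodory_zero (f := fun v => h (v + s₀)) hlogM
      (hdiff.comp (by fun_prop) hadd) (fun v hv => hre _ (hadd v hv)) hr₂ hmem (by simpa using h0)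
    simp only [sub_add_cancel] at this
    refine this.trans ?_
    rw [← dist_eq_norm]
    have : r ≤ r₂ - dist w s₀ := by rw [hrdef]; linarith
    gcongr
  have hsub : closedBall z r ⊆ ball s₀ r₂ := by
    intro w hw
    have h1 := dist_triangle w z s₀
    have h2 := mem_closedBall.1 hw
    rw [mem_ball]
    linarith
  have hcauchy := norm_deriv_le_of_forall_mem_sphere_norm_le hrpos
    ((hdiff.mono hsub).diffContOnCl_ball subset_rfl) hbd
  rw [(hh z (hsub (mem_closedBall_self hrpos.le))).deriv] at hcauchy
  refine hcauchy.trans (le_of_eq ?_)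
  rw [hrdef]
  have : r₂ - r₁ ≠ 0 := by linarith
  field_simp
  ring

/-- Landau's lemma: the number of zeros of `F` in a disc, and the approximation of `F'/F` by the
contributions of these zeros. -/
theorem logDeriv_sub_sum_zeros {F : ℂ → ℂ} {U : Set ℂ} {s₀ : ℂ} {r₁ r₂ R M : ℝ}
    (hr₁ : 0 ≤ r₁) (hr : r₁ < r₂) (hrR : r₂ < R) (hU : closedBall s₀ R ⊆ U)
    (hF : AnalyticOnNhd ℂ F U) (hM : 1 < M) (h0 : F s₀ ≠ 0)
    (hle : ∀ z ∈ sphere s₀ R, ‖F z‖ ≤ M * ‖F s₀‖) (S : Finset ℂ)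
    (hS : ∀ z, z ∈ S ↔ z ∈ closedBall s₀ r₂ ∧ F z = 0)
    (hord : ∀ z ∈ S, analyticOrderAt F z ≠ ⊤) :
    ((∑ ρ ∈ S, analyticOrderNatAt F ρ : ℕ) : ℝ) * Real.log (R / r₂) ≤ Real.log M ∧
    ∀ z ∈ closedBall s₀ r₁, F z ≠ 0 →
      ‖logDeriv F z - ∑ ρ ∈ S, (analyticOrderNatAt F ρ : ℂ) / (z - ρ)‖ ≤
        ((∑ ρ ∈ S, analyticOrderNatAt F ρ : ℕ) : ℝ) * (r₂ / (R ^ 2 - r₂ * r₁)) +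
          4 * (r₁ + r₂) / (r₂ - r₁) ^ 2 * Real.log M := by
  have hr₂ : 0 < r₂ := by linarith
  have hRpos : 0 < R := by linarith
  set m := analyticOrderNatAt F with hm
  set N := ∑ ρ ∈ S, m ρ with hN
  have hSU : ∀ ρ ∈ S, ρ ∈ U := fun ρ h => hU (closedBall_subset_closedBall hrR.le ((hS ρ).1 h).1)
  obtain ⟨g, hg, hgS, hfg⟩ := hF.exists_eq_prod_pow_mul m S hSU
    (fun ρ h => (Nat.cast_analyticOrderNatAt (hord ρ h)).symm)
  -- Each factor `z - ρ` is replaced by its Blaschke counterpart: `G` has the modulus of `F` on the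
  -- outer circle but no zeros in the disc of radius `r₂`.
  set P : ℂ → ℂ := fun z => ∏ ρ ∈ S, (((R : ℂ) ^ 2 - conj (ρ - s₀) * (z - s₀)) / R) ^ m ρ with hP
  set G : ℂ → ℂ := fun z => P z * g z with hG
  have hPd : Differentiable ℂ P := by
    rw [hP]; fun_prop
  have hGd : ∀ z ∈ U, DifferentiableAt ℂ G z :=
    fun z hz => (hPd z).mul (hg z hz).differentiableAt
  have hwS : ∀ ρ ∈ S, ‖ρ - s₀‖ ≤ r₂ := fun ρ h => by
    rw [← dist_eq_norm]; exact ((hS ρ).1 h).1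
  have hfac : ∀ ρ ∈ S, ∀ z, ‖z - s₀‖ ≤ r₂ → (R : ℂ) ^ 2 - conj (ρ - s₀) * (z - s₀) ≠ 0 := by
    intro ρ hρ z hz h
    have h1 : (R : ℂ) ^ 2 = conj (ρ - s₀) * (z - s₀) := sub_eq_zero.1 h
    have h2 := congrArg norm h1
    rw [norm_mul, norm_conj, norm_pow, norm_real, Real.norm_of_nonneg hRpos.le] at h2
    have h3 : ‖ρ - s₀‖ * ‖z - s₀‖ ≤ r₂ * r₂ :=
      mul_le_mul (hwS ρ hρ) hz (norm_nonneg _) hr₂.le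
    nlinarith
  have hPne : ∀ z, ‖z - s₀‖ ≤ r₂ → P z ≠ 0 := by
    intro z hz
    refine Finset.prod_ne_zero_iff.2 fun ρ hρ => pow_ne_zero _ (div_ne_zero (hfac ρ hρ z hz) ?_)
    exact_mod_cast hRpos.ne'
  have hgne : ∀ z, ‖z - s₀‖ ≤ r₂ → g z ≠ 0 := by
    intro z hz hz0
    by_cases h : z ∈ S
    · exact hgS z h hz0
    · exact h ((hS z).2 ⟨by rwa [mem_closedBall, dist_eq_norm], by rw [hfg, hz0, mul_zero]⟩)
  have hsphere : ∀ z ∈ sphere s₀ R, ‖G z‖ ≤ M * ‖F s₀‖ := by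
    intro z hz
    have hzR : ‖z - s₀‖ = R := by rw [← dist_eq_norm]; exact hz
    refine le_trans (le_of_eq ?_) (hle z hz)
    rw [hfg, hG, norm_mul, norm_mul, hP, norm_prod, norm_prod]
    congr 1
    refine Finset.prod_congr rfl fun ρ _ => ?_
    rw [norm_pow, norm_pow, norm_div, norm_sq_sub_conj_mul _ _ hzR, norm_real,
      Real.norm_of_nonneg hRpos.le, mul_div_cancel_left₀ _ hRpos.ne']
    congr 2
    ring
  have hball : ∀ z ∈ closedBall s₀ R, ‖G z‖ ≤ M * ‖F s₀‖ := by
    intro z hz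
    refine norm_le_of_forall_mem_frontier_norm_le (U := ball s₀ R) isBounded_ball ?_ ?_ ?_
    · exact DifferentiableOn.diffContOnCl_ball (U := closedBall s₀ R)
        (fun w hw => (hGd w (hU hw)).differentiableWithinAt) subset_rfl
    · rw [frontier_ball _ hRpos.ne']; exact hsphere
    · rwa [closure_ball _ hRpos.ne']
  have hs₀mem : s₀ ∈ closedBall s₀ R := mem_closedBall_self hRpos.le
  -- Every exchanged zero enlarges the modulus at the centre by `R/|ρ - s₀| ≥ R/r₂` (read without
  -- the division). Against the maximum principle this yields the count of zeros, as in Jensen's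
  -- formula.
  have hG0 : (R / r₂) ^ N * ‖F s₀‖ ≤ ‖G s₀‖ := by
    have hg0 : 0 ≤ ‖g s₀‖ := norm_nonneg _
    rw [hfg, hG, norm_mul, norm_mul, ← mul_assoc]
    refine mul_le_mul_of_nonneg_right ?_ hg0
    rw [hP, hN, ← Finset.prod_pow_eq_pow_sum, norm_prod, norm_prod, ← Finset.prod_mul_distrib]
    refine Finset.prod_le_prod (fun _ _ => by positivity) fun ρ hρ => ?_
    rw [norm_pow, norm_pow, ← mul_pow]
    refine pow_le_pow_left₀ (by positivity) ?_ _
    rw [sub_self, mul_zero, sub_zero, norm_div, norm_pow, norm_real, Real.norm_of_nonneg hRpos.le,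
      ← norm_neg, neg_sub, sq, mul_div_cancel_left₀ _ hRpos.ne', div_mul_eq_mul_div,
      div_le_iff₀ hr₂]
    exact mul_le_mul_of_nonneg_left (hwS ρ hρ) hRpos.le
  have hF0 : 0 < ‖F s₀‖ := norm_pos_iff.2 h0
  have hpow : (R / r₂) ^ N ≤ M :=
    le_of_mul_le_mul_right (hG0.trans (hball s₀ hs₀mem)) hF0
  have hFG : ‖F s₀‖ ≤ ‖G s₀‖ := by
    refine le_trans ?_ hG0
    exact le_mul_of_one_le_left hF0.le (one_le_pow₀ ((one_le_div hr₂).2 hrR.le))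
  refine ⟨?_, fun z hz hFz => ?_⟩
  · have := Real.log_le_log (by positivity) hpow
    rwa [Real.log_pow] at this
  have hzr : ‖z - s₀‖ ≤ r₁ := by rw [← dist_eq_norm]; exact hz
  have hzU : z ∈ U := hU (closedBall_subset_closedBall (by linarith) hz)
  have hlog := norm_logDeriv_le_of_ne_zero (G := G) hr₁ hr hM
    (fun w hw => (hGd w (hU (ball_subset_closedBall
      (ball_subset_ball hrR.le hw)))).differentiableWithinAt)
    (fun w hw => by
      have hw' : ‖w - s₀‖ ≤ r₂ := by rw [← dist_eq_norm]; exact (mem_ball.1 hw).le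
      exact mul_ne_zero (hPne w hw') (hgne w hw'))
    (fun w hw => (hball w (ball_subset_closedBall (ball_subset_ball hrR.le hw))).trans
      (mul_le_mul_of_nonneg_left hFG (by linarith))) hz
  have hzS : z ∉ S := fun h => hFz ((hS z).1 h).2
  have e1 := logDeriv_prod_pow_mul hfg hFz hzS (hg z hzU).differentiableAt
  have e2 : logDeriv G z = -(∑ ρ ∈ S, (m ρ : ℂ) * (conj (ρ - s₀) /
      ((R : ℂ) ^ 2 - conj (ρ - s₀) * (z - s₀)))) + logDeriv g z := by
    rw [hG, logDeriv_mul z (hPne z (by linarith)) (hgne z (by linarith)) (hPd z)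
      (hg z hzU).differentiableAt]
    congr 1
    have hRc : (R : ℂ) ≠ 0 := by exact_mod_cast hRpos.ne'
    rw [hP, logDeriv_prod (f := fun ρ z => (((R : ℂ) ^ 2 - conj (ρ - s₀) * (z - s₀)) / R) ^ m ρ)
      (fun ρ h => pow_ne_zero _ (div_ne_zero (hfac ρ h z (by linarith)) hRc))
      (fun ρ _ => by fun_prop), ← Finset.sum_neg_distrib]
    refine Finset.sum_congr rfl fun ρ hρ => ?_
    rw [logDeriv_fun_pow (f := fun z => ((R : ℂ) ^ 2 - conj (ρ - s₀) * (z - s₀)) / R)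
      (by fun_prop), logDeriv_apply]
    have hd : deriv (fun z => ((R : ℂ) ^ 2 - conj (ρ - s₀) * (z - s₀)) / R) z =
        -conj (ρ - s₀) / R := by
      have h := ((((hasDerivAt_id z).sub_const s₀).const_mul (conj (ρ - s₀))).const_sub
        ((R : ℂ) ^ 2)).div_const (R : ℂ)
      simp
    rw [hd]
    have := hfac ρ hρ z (by linarith)
    field_simp
  -- What remains of `F'/F` are the fractions with poles reflected in the outer circle, bounded by
  -- `r₂/(R² - r₂r₁)` each, and `G'/G`.
  have e3 : logDeriv F z - ∑ ρ ∈ S, (m ρ : ℂ) / (z - ρ) = ∑ ρ ∈ S, (m ρ : ℂ) *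
      (conj (ρ - s₀) / ((R : ℂ) ^ 2 - conj (ρ - s₀) * (z - s₀))) + logDeriv G z := by
    rw [e1, e2]; ring
  rw [e3]
  refine (norm_add_le _ _).trans (add_le_add ?_ hlog)
  refine (norm_sum_le _ _).trans ?_
  rw [hN, Nat.cast_sum, Finset.sum_mul]
  refine Finset.sum_le_sum fun ρ hρ => ?_
  rw [norm_mul, norm_natCast, norm_div, norm_conj]
  have h1 : r₂ * r₁ < R ^ 2 := by nlinarith
  have h2 : R ^ 2 - r₂ * r₁ ≤ ‖(R : ℂ) ^ 2 - conj (ρ - s₀) * (z - s₀)‖ := by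
    refine le_trans ?_ (norm_sub_norm_le _ _)
    rw [norm_mul, norm_conj, norm_pow, norm_real, Real.norm_of_nonneg hRpos.le]
    have := mul_le_mul (hwS ρ hρ) hzr (norm_nonneg _) hr₂.le
    linarith
  have h3 := hwS ρ hρ
  have h4 : 0 < R ^ 2 - r₂ * r₁ := by linarith
  gcongr

/-! ### Size of `ζ` in the half-plane `Re s > 0` -/

open Set Filter Topology MeasureTheory

/-- `∫_1^∞ {t} t^{-s-1} dt`, as a Mellin transform. -/
noncomputable def fractMellin (s : ℂ) : ℂ :=
  mellin (indicator (Ioi 1) fun t : ℝ => ((Int.fract t : ℝ) : ℂ)) (-s)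

theorem norm_indicator_fract_le (t : ℝ) :
    ‖indicator (Ioi 1) (fun t : ℝ => ((Int.fract t : ℝ) : ℂ)) t‖ ≤ 1 := by
  refine (norm_indicator_le_norm_self _ _).trans ?_
  rw [norm_real, Real.norm_of_nonneg (Int.fract_nonneg t)]
  exact (Int.fract_lt_one t).le

theorem measurable_indicator_fract :
    Measurable (indicator (Ioi 1) fun t : ℝ => ((Int.fract t : ℝ) : ℂ)) :=
  (measurable_ofReal.comp measurable_fract).indicator measurableSet_Ioi

theorem differentiableAt_fractMellin {s : ℂ} (hs : 0 < s.re) :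
    DifferentiableAt ℂ fractMellin s := by
  -- Boundedness at infinity gives the exponent `a = 0`; near `0` the function vanishes, so any `b`
  -- below `Re (-s)` will do.
  refine DifferentiableAt.comp s (g := mellin _)
    (mellin_differentiableAt_of_isBigO_rpow (a := 0) (b := -s.re - 1) ?_ ?_ (by simpa) ?_
      (by simp)) (by fun_prop)
  · refine LocallyIntegrable.locallyIntegrableOn ?_ _
    refine (locallyIntegrable_const (1 : ℝ)).mono measurable_indicator_fract.aestronglyMeasurable
      (Eventually.of_forall fun t => ?_)
    simpa using norm_indicator_fract_le t
  · refine Asymptotics.IsBigO.of_bound 1 (Eventually.of_forall fun t => ?_)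
    simpa using norm_indicator_fract_le t
  · refine Asymptotics.IsBigO.of_bound 1 ?_
    filter_upwards [mem_nhdsWithin_of_mem_nhds (Iio_mem_nhds (zero_lt_one : (0 : ℝ) < 1))] with t ht
    rw [indicator_of_notMem (by simpa using (mem_Iio.1 ht).le)]
    simp only [norm_zero, one_mul]
    positivity

theorem fractMellin_eq (s : ℂ) :
    fractMellin s = ∫ t in Ioi (1 : ℝ), (t : ℂ) ^ (-s - 1) * ((Int.fract t : ℝ) : ℂ) := by
  rw [fractMellin, mellin, ← integral_indicator measurableSet_Ioi,
    ← integral_indicator measurableSet_Ioi]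
  congr 1
  ext t
  by_cases h : 1 < t
  · rw [indicator_of_mem (show t ∈ Ioi (0 : ℝ) from zero_lt_one.trans h),
      indicator_of_mem (show t ∈ Ioi (1 : ℝ) from h), indicator_of_mem (show t ∈ Ioi (1 : ℝ) from h),
      smul_eq_mul]
  · rw [indicator_of_notMem (show t ∉ Ioi (1 : ℝ) from h)]
    by_cases h0 : t ∈ Ioi (0 : ℝ)
    · rw [indicator_of_mem h0, indicator_of_notMem (show t ∉ Ioi (1 : ℝ) from h), smul_zero]
    · rw [indicator_of_notMem h0]

theorem norm_cpow_mul_fract_le {s : ℂ} {t : ℝ} (ht : 1 < t) :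
    ‖(t : ℂ) ^ (-s - 1) * ((Int.fract t : ℝ) : ℂ)‖ ≤ t ^ (-s.re - 1) := by
  rw [norm_mul, norm_cpow_eq_rpow_re_of_pos (by linarith), norm_real,
    Real.norm_of_nonneg (Int.fract_nonneg t)]
  simp only [sub_re, neg_re, one_re]
  exact mul_le_of_le_one_right (by positivity) (Int.fract_lt_one t).le

theorem integrableOn_cpow_mul_fract {s : ℂ} (hs : 0 < s.re) :
    IntegrableOn (fun t : ℝ => (t : ℂ) ^ (-s - 1) * ((Int.fract t : ℝ) : ℂ)) (Ioi 1) := by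
  refine Integrable.mono' (integrableOn_Ioi_rpow_of_lt (a := -s.re - 1) (by linarith)
    zero_lt_one) ?_ ?_
  · refine AEStronglyMeasurable.mul ?_
      (measurable_ofReal.comp measurable_fract).aestronglyMeasurable
    refine ContinuousOn.aestronglyMeasurable (fun t ht => ?_) measurableSet_Ioi
    exact (continuousAt_ofReal_cpow_const _ _
      (Or.inr (zero_lt_one.trans ht).ne')).continuousWithinAt
  · exact (ae_restrict_mem measurableSet_Ioi).mono fun t ht => norm_cpow_mul_fract_le ht

theorem norm_fractMellin_le {s : ℂ} (hs : 0 < s.re) : ‖fractMellin s‖ ≤ 1 / s.re := by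
  rw [fractMellin_eq]
  refine (norm_integral_le_of_norm_le (integrableOn_Ioi_rpow_of_lt (a := -s.re - 1) (by linarith)
    zero_lt_one) ((ae_restrict_mem measurableSet_Ioi).mono
      fun t ht => norm_cpow_mul_fract_le ht)).trans (le_of_eq ?_)
  rw [integral_Ioi_rpow_of_lt (by linarith) zero_lt_one]
  simp

/-- Partial summation expresses `ζ(s)` as `s ∫ ⌊t⌋ t^{-s-1} dt`, and `⌊t⌋ = t - {t}` isolates the
pole. -/
theorem riemannZeta_eq_of_one_lt_re {s : ℂ} (hs : 1 < s.re) :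
    riemannZeta s = s / (s - 1) - s * fractMellin s := by
  have h1 : s - 1 ≠ 0 := fun h => by
    have := congrArg re h
    simp at this
    linarith
  have key := LSeries_eq_mul_integral' 1 zero_le_one (s := s) (r := 1) hs (by
    refine Asymptotics.IsBigO.of_bound 1 (Eventually.of_forall fun n => ?_)
    simp)
  rw [LSeries_one_eq_riemannZeta hs] at key
  have hint : IntegrableOn (fun t : ℝ => (t : ℂ) ^ (-s)) (Ioi 1) :=
    integrableOn_Ioi_cpow_of_lt (by simpa using hs) zero_lt_one
  rw [key, fractMellin_eq]
  have : ∫ t in Ioi (1 : ℝ), (∑ k ∈ Finset.Icc 1 ⌊t⌋₊, (1 : ℕ → ℂ) k) * (t : ℂ) ^ (-(s + 1)) =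
      ∫ t in Ioi (1 : ℝ), ((t : ℂ) ^ (-s) - (t : ℂ) ^ (-s - 1) * ((Int.fract t : ℝ) : ℂ)) := by
    refine setIntegral_congr_fun measurableSet_Ioi fun t ht => ?_
    have ht1 : (1 : ℝ) < t := ht
    have ht0 : (t : ℂ) ≠ 0 := by exact_mod_cast (by linarith : t ≠ 0)
    have hfl : ((⌊t⌋₊ : ℕ) : ℂ) = (t : ℂ) - ((Int.fract t : ℝ) : ℂ) := by
      have h2 : ((⌊t⌋₊ : ℕ) : ℝ) = t - Int.fract t := by
        rw [Int.self_sub_fract, natCast_floor_eq_intCast_floor (by linarith)]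
      exact_mod_cast congrArg (fun x : ℝ => (x : ℂ)) h2
    simp only [Pi.one_apply, Finset.sum_const, Nat.card_Icc, Nat.add_sub_cancel, nsmul_eq_mul,
      mul_one]
    rw [hfl, neg_add, ← sub_eq_add_neg, sub_mul]
    congr 1
    · rw [cpow_sub _ _ ht0, cpow_one]; field_simp
    · ring
  rw [this, integral_sub hint (integrableOn_cpow_mul_fract (by linarith)),
    integral_Ioi_cpow_of_lt (by simpa using hs) zero_lt_one]
  have h2 : -s + 1 ≠ 0 := fun h => h1 (by linear_combination -h)
  simp only [ofReal_one, one_cpow]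
  field_simp
  ring

/-- Analytic continuation from `Re s > 1` within the quadrant of `Re > 0` that contains `s`. The
quadrant is convex and avoids the pole; taking `e = Im s` treats both signs of the imaginary part at
once. -/
theorem riemannZeta_eq_of_re_pos {s : ℂ} (hs : 0 < s.re) (him : s.im ≠ 0) :
    riemannZeta s = s / (s - 1) - s * fractMellin s := by
  obtain ⟨e, he⟩ : ∃ e : ℝ, 0 < e * s.im := ⟨s.im, mul_self_pos.2 him⟩
  set U : Set ℂ := {z | 0 < z.re} ∩ {z | 0 < e * z.im} with hU
  have hUo : IsOpen U := (isOpen_lt continuous_const continuous_re).inter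
    (isOpen_lt continuous_const (continuous_const.mul continuous_im))
  have hconv : Convex ℝ U := by
    refine Convex.inter (convex_halfSpace_re_gt 0) ?_
    exact convex_halfSpace_gt (f := fun z : ℂ => e * z.im)
      ⟨fun x y => by simp [mul_add], fun c x => by simp; ring⟩ 0
  have hne : ∀ z ∈ U, z ≠ 1 := by
    rintro z ⟨_, hz⟩ rfl
    simp at hz
  have h1 : AnalyticOnNhd ℂ riemannZeta U := by
    refine DifferentiableOn.analyticOnNhd (fun z hz => ?_) hUo
    exact (differentiableAt_riemannZeta (hne z hz)).differentiableWithinAt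
  have h2 : AnalyticOnNhd ℂ (fun s => s / (s - 1) - s * fractMellin s) U := by
    refine DifferentiableOn.analyticOnNhd (fun z hz => ?_) hUo
    have := sub_ne_zero.2 (hne z hz)
    have h3 := differentiableAt_fractMellin hz.1
    have h4 : DifferentiableAt ℂ (fun s : ℂ => s / (s - 1)) z := by fun_prop (disch := assumption)
    exact (h4.sub
      (DifferentiableAt.mul (differentiableAt_fun_id (𝕜 := ℂ)) h3)).differentiableWithinAt
  have hz₀ : (2 : ℂ) + s.im * I ∈ U := ⟨by simp, by simpa using he⟩
  refine h1.eqOn_of_preconnected_of_eventuallyEq h2 hconv.isPreconnected hz₀ ?_ ⟨hs, he⟩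
  filter_upwards [(isOpen_lt continuous_const continuous_re).mem_nhds
    (show (1 : ℝ) < ((2 : ℂ) + s.im * I).re by simp)] with z hz
  exact riemannZeta_eq_of_one_lt_re hz

/-- Linear growth suffices, because Landau's lemma only sees the logarithm of the bound. -/
theorem norm_riemannZeta_le {s : ℂ} (hs : 0 < s.re) (him : s.im ≠ 0) :
    ‖riemannZeta s‖ ≤ ‖s‖ / |s.im| + ‖s‖ / s.re := by
  rw [riemannZeta_eq_of_re_pos hs him]
  refine (norm_sub_le _ _).trans (add_le_add ?_ ?_)
  · rw [norm_div]
    have h1 : |s.im| ≤ ‖s - 1‖ := by simpa using abs_im_le_norm (s - 1)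
    have h2 : 0 < |s.im| := abs_pos.2 him
    gcongr
  · rw [norm_mul, div_eq_mul_one_div]
    exact mul_le_mul_of_nonneg_left (norm_fractMellin_le hs) (norm_nonneg _)

/-- The terms `n ≥ 2` contribute at most `π²/6 - 1 ≤ 2/3`. This is the lower bound at the centres of
the discs in Landau's lemma. -/
theorem one_third_le_norm_riemannZeta {s : ℂ} (hs : s.re = 2) : 1 / 3 ≤ ‖riemannZeta s‖ := by
  have hsum : HasSum (fun n : ℕ => 1 / ((n : ℝ) + 1) ^ 2) (Real.pi ^ 2 / 6) := by
    have := (hasSum_nat_add_iff' 1).2 hasSum_zeta_two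
    simpa using this
  have h1 := zeta_eq_tsum_one_div_nat_add_one_cpow (s := s) (by linarith)
  have hnorm : ∀ n : ℕ, ‖1 / ((n : ℂ) + 1) ^ s‖ = 1 / ((n : ℝ) + 1) ^ 2 := by
    intro n
    rw [norm_div, norm_one]
    have : ((n : ℂ) + 1) = (((n : ℝ) + 1 : ℝ) : ℂ) := by push_cast; rfl
    rw [this, norm_cpow_eq_rpow_re_of_pos (by positivity), hs]
    norm_cast
  have hs1 : Summable fun n : ℕ => 1 / ((n : ℂ) + 1) ^ s :=
    Summable.of_norm (by simpa only [hnorm] using hsum.summable)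
  rw [hs1.tsum_eq_zero_add] at h1
  simp only [Nat.cast_zero, zero_add, one_cpow, div_one] at h1
  have hs2 : Summable fun n : ℕ => 1 / (((n + 1 : ℕ) : ℝ) + 1) ^ 2 :=
    (summable_nat_add_iff 1).2 hsum.summable
  have h2 : ‖∑' n : ℕ, 1 / (((n + 1 : ℕ) : ℂ) + 1) ^ s‖ ≤ Real.pi ^ 2 / 6 - 1 := by
    refine (norm_tsum_le_tsum_norm ?_).trans (le_of_eq ?_)
    · simpa only [hnorm] using hs2
    · simp only [hnorm]
      rw [← hsum.tsum_eq, hsum.summable.tsum_eq_zero_add]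
      simp
  have hpi : Real.pi ^ 2 / 6 - 1 ≤ 2 / 3 := by
    have h3 := Real.pi_lt_d2
    have h4 := Real.pi_pos
    nlinarith
  rw [h1]
  have := norm_sub_le_norm_add (1 : ℂ) (∑' n : ℕ, 1 / (((n + 1 : ℕ) : ℂ) + 1) ^ s)
  rw [norm_one] at this
  linarith

/-! ### The digamma function is close to the logarithm -/

theorem norm_Gamma_le_Gamma_re {z : ℂ} (hz : 0 < z.re) : ‖Gamma z‖ ≤ Real.Gamma z.re := by
  rw [Gamma_eq_integral hz, Real.Gamma_eq_integral hz, GammaIntegral]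
  refine (norm_integral_le_integral_norm _).trans (le_of_eq ?_)
  refine setIntegral_congr_fun measurableSet_Ioi fun x hx => ?_
  rw [norm_mul, norm_real, Real.norm_of_nonneg (Real.exp_pos _).le,
    norm_cpow_eq_rpow_re_of_pos hx]
  simp

/-- `log Γ(y) - y log n` is convex, hence on `[n, n + 3]` at most its larger endpoint value; `y = x
+ n + 1` runs through this interval for `-1 ≤ x ≤ 2`. -/
theorem Gamma_div_rpow_le {n : ℕ} (hn : 1 ≤ n) {x : ℝ} (h1 : -1 ≤ x) (h2 : x ≤ 2) :
    Real.Gamma (x + n + 1) / ((n : ℝ) ^ x * n.factorial) ≤ 6 := by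
  have hn' : (1 : ℝ) ≤ n := by exact_mod_cast hn
  have hn0 : (0 : ℝ) < n := by linarith
  set l := Real.log n with hl
  have hconv : ConvexOn ℝ (Ioi (0 : ℝ)) ((Real.log ∘ Real.Gamma) + fun y => (-l) * y) := by
    refine Real.convexOn_log_Gamma.add ?_
    exact ((LinearMap.mul ℝ ℝ (-l)).convexOn convex_univ).subset (subset_univ _) (convex_Ioi 0)
  have key := hconv.le_max_of_mem_Icc (x := (n : ℝ)) (y := (n : ℝ) + 3) (z := x + n + 1) hn0
    (show (0 : ℝ) < (n : ℝ) + 3 by linarith) ⟨by linarith, by linarith⟩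
  simp only [Pi.add_apply, Function.comp_apply] at key
  have g1 : Real.Gamma n * n = n.factorial := by
    rw [← Real.Gamma_nat_eq_factorial, Real.Gamma_add_one hn0.ne', mul_comm]
  have g2 : Real.Gamma ((n : ℝ) + 3) = (n + 2) * (n + 1) * n.factorial := by
    rw [show (n : ℝ) + 3 = (n + 1 + 1) + 1 by ring, Real.Gamma_add_one (by positivity),
      Real.Gamma_add_one (by positivity), Real.Gamma_nat_eq_factorial]
    ring
  have hf : (0 : ℝ) < n.factorial := by exact_mod_cast n.factorial_pos
  have hG1 : 0 < Real.Gamma n := Real.Gamma_pos_of_pos hn0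
  have hG : 0 < Real.Gamma (x + n + 1) := Real.Gamma_pos_of_pos (by linarith)
  have e1 : Real.log (Real.Gamma n) = Real.log n.factorial - l := by
    rw [← g1, Real.log_mul hG1.ne' hn0.ne']; ring
  have e2 : Real.log (Real.Gamma ((n : ℝ) + 3)) ≤ Real.log 6 + 2 * l + Real.log n.factorial := by
    have h1 : Real.log (((n : ℝ) + 2) * (n + 1)) ≤ Real.log (6 * (n : ℝ) ^ 2) :=
      Real.log_le_log (by positivity) (by nlinarith)
    rw [Real.log_mul (x := 6) (by norm_num) (by positivity), Real.log_pow] at h1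
    have h3 : ((n : ℝ) + 2) * (n + 1) ≠ 0 := by positivity
    rw [g2, Real.log_mul h3 hf.ne']
    push_cast at h1
    linarith
  have h6 : 0 ≤ Real.log 6 := Real.log_nonneg (by norm_num)
  have hfin : Real.log (Real.Gamma (x + n + 1)) ≤ Real.log 6 + (x * l + Real.log n.factorial) := by
    rcases le_max_iff.1 key with h | h
    · rw [e1] at h
      nlinarith
    · nlinarith
  rw [div_le_iff₀ (by positivity), ← Real.log_le_log_iff hG (by positivity),
    Real.log_mul (by norm_num) (by positivity), Real.log_mul (by positivity) hf.ne',
    Real.log_rpow hn0]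
  exact hfin

/-- `Γ(z + n + 1) / (n ^ z n!)`, which tends to `1` as `n → ∞`. -/
noncomputable def gammaRatio (n : ℕ) (z : ℂ) : ℂ := Gamma (z + n + 1) / ((n : ℂ) ^ z * n.factorial)

theorem gammaRatio_eq {z : ℂ} (hz : ∀ m : ℕ, z ≠ -m) (n : ℕ) :
    gammaRatio n z = Gamma z / GammaSeq z n := by
  have h : ∀ k : ℕ, Gamma (z + k) = (∏ j ∈ Finset.range k, (z + j)) * Gamma z := by
    intro k
    induction k with
    | zero => simp
    | succ k ih =>
      have h0 : z + k ≠ 0 := fun h0 => hz k (eq_neg_of_add_eq_zero_left h0)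
      rw [Finset.prod_range_succ, Nat.cast_succ, ← add_assoc, Gamma_add_one _ h0, ih]
      ring
  have h1 := h (n + 1)
  rw [Nat.cast_succ, ← add_assoc] at h1
  rw [gammaRatio, GammaSeq, h1, div_div_eq_mul_div, mul_comm]

theorem tendsto_gammaRatio {z : ℂ} (hz : ∀ m : ℕ, z ≠ -m) :
    Tendsto (fun n => gammaRatio n z) atTop (𝓝 1) := by
  have hG := Gamma_ne_zero hz
  simp only [gammaRatio_eq hz]
  have := (tendsto_const_nhds (x := Gamma z)).div (GammaSeq_tendsto_Gamma z) hG
  rwa [div_self hG] at this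

theorem norm_gammaRatio_le {n : ℕ} (hn : 1 ≤ n) {z : ℂ} (h1 : -1 ≤ z.re) (h2 : z.re ≤ 2) :
    ‖gammaRatio n z‖ ≤ 6 := by
  refine le_trans ?_ (Gamma_div_rpow_le hn h1 h2)
  have hn' : (1 : ℝ) ≤ n := by exact_mod_cast hn
  rw [gammaRatio, norm_div, norm_mul, norm_natCast, norm_natCast_cpow_of_pos (by omega)]
  have := norm_Gamma_le_Gamma_re (z := z + n + 1) (by simp; linarith)
  simp only [add_re, natCast_re, one_re] at this
  gcongr

theorem differentiableAt_gammaRatio {n : ℕ} (hn : 1 ≤ n) {z : ℂ} (h1 : -1 ≤ z.re) :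
    DifferentiableAt ℂ (gammaRatio n) z := by
  have hn' : (1 : ℝ) ≤ n := by exact_mod_cast hn
  have hn0 : (n : ℂ) ≠ 0 := by exact_mod_cast (by omega : n ≠ 0)
  have hG : DifferentiableAt ℂ (fun z => Gamma (z + n + 1)) z := by
    refine DifferentiableAt.comp z (g := Gamma) (differentiableAt_Gamma _ fun m h => ?_)
      (by fun_prop)
    have := congrArg re h
    simp at this
    have h3 : (0 : ℝ) ≤ m := m.cast_nonneg
    linarith
  have hp : DifferentiableAt ℂ (fun z : ℂ => (n : ℂ) ^ z * n.factorial) z :=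
    (differentiableAt_fun_id.const_cpow (Or.inl hn0)).mul_const _
  exact hG.div hp (mul_ne_zero (by simp [cpow_eq_zero_iff, hn0])
    (by exact_mod_cast n.factorial_ne_zero))

/-- The ratios are uniformly bounded and tend to `1` on a circle around `s`; Cauchy's integral for
the derivative and dominated convergence do the rest. The condition `|Im s| ≥ 1` keeps the circle of
radius `1/2` away from the poles of `Γ`. -/
theorem tendsto_deriv_gammaRatio {s : ℂ} (h1 : -(1 / 4) ≤ s.re) (h2 : s.re ≤ 1)
    (him : 1 ≤ |s.im|) : Tendsto (fun n => deriv (gammaRatio n) s) atTop (𝓝 0) := by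
  have hmem : ∀ z ∈ Metric.closedBall s (1 / 2), -1 ≤ z.re ∧ z.re ≤ 2 ∧ z.im ≠ 0 := by
    intro z hz
    rw [Metric.mem_closedBall, dist_eq_norm] at hz
    have hr := abs_le.1 ((abs_re_le_norm (z - s)).trans hz)
    have hi := (abs_im_le_norm (z - s)).trans hz
    simp only [sub_re, sub_im] at hr hi
    refine ⟨by linarith, by linarith, fun h0 => ?_⟩
    rw [h0, zero_sub, abs_neg] at hi
    linarith
  have hcircle : ∀ θ : ℝ, circleMap s (1 / 2) θ ∈ Metric.closedBall s (1 / 2) :=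
    fun θ => circleMap_mem_closedBall s (by norm_num) θ
  have hlim : Tendsto (fun n => cderiv (1 / 2) (gammaRatio n) s) atTop
      (𝓝 (cderiv (1 / 2) (fun _ => (1 : ℂ)) s)) := by
    rw [cderiv]
    refine Tendsto.const_smul ?_ _
    -- `12 = 6 · (1/2) / (1/2)²`, from the bound `6` on the ratio and the radius `1/2`.
    refine intervalIntegral.tendsto_integral_filter_of_dominated_convergence (fun _ => 12) ?_ ?_ ?_ ?_
    · filter_upwards [eventually_ge_atTop 1] with n hn
      refine Continuous.aestronglyMeasurable ?_
      have hc : Continuous fun θ => gammaRatio n (circleMap s (1 / 2) θ) :=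
        continuous_iff_continuousAt.2 fun θ => ContinuousAt.comp
          (differentiableAt_gammaRatio hn (hmem _ (hcircle θ)).1).continuousAt
          (continuous_circleMap _ _).continuousAt
      have h3 : Continuous fun θ => ((circleMap s (1 / 2) θ - s) ^ 2)⁻¹ :=
        (((continuous_circleMap _ _).sub continuous_const).pow 2).inv₀ fun θ => by
          refine pow_ne_zero _ (sub_ne_zero.2 ?_)
          exact circleMap_ne_center (by norm_num)
      have h4 : Continuous (deriv (circleMap s (1 / 2))) := by
        simp only [funext (deriv_circleMap s (1 / 2))]
        fun_prop
      exact h4.smul (h3.smul hc)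
    · filter_upwards [eventually_ge_atTop 1] with n hn
      refine Eventually.of_forall fun θ _ => ?_
      have h3 := norm_gammaRatio_le hn (hmem _ (hcircle θ)).1 (hmem _ (hcircle θ)).2.1
      rw [norm_smul, norm_smul, norm_inv, norm_pow, circleMap_sub_center, norm_circleMap_zero,
        deriv_circleMap, norm_mul, norm_circleMap_zero, norm_I]
      norm_num
      linarith
    · simp
    · refine Eventually.of_forall fun θ _ => ?_
      refine Tendsto.const_smul (Tendsto.const_smul (tendsto_gammaRatio fun m hm => ?_) _) _
      exact (hmem _ (hcircle θ)).2.2 (by rw [hm]; simp)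
  have hball : ∀ z ∈ Metric.ball s 1, -1 - 1 / 4 ≤ z.re := by
    intro z hz
    rw [Metric.mem_ball, dist_eq_norm] at hz
    have hr := abs_le.1 ((abs_re_le_norm (z - s)).trans hz.le)
    simp only [sub_re] at hr
    linarith
  have hopen : IsOpen {z : ℂ | -1 < z.re} := isOpen_lt continuous_const continuous_re
  have hsub : Metric.closedBall s (1 / 2) ⊆ {z : ℂ | -1 < z.re} := by
    intro z hz
    rw [Metric.mem_closedBall, dist_eq_norm] at hz
    have hr := abs_le.1 ((abs_re_le_norm (z - s)).trans hz)
    simp only [sub_re] at hr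
    show -1 < z.re
    linarith
  rw [cderiv_eq_deriv hopen (differentiableOn_const _) (by norm_num) hsub, deriv_const] at hlim
  refine hlim.congr' ?_
  filter_upwards [eventually_ge_atTop 1] with n hn
  exact cderiv_eq_deriv hopen (fun z hz =>
    (differentiableAt_gammaRatio hn (le_of_lt hz)).differentiableWithinAt) (by norm_num) hsub

/-- The logarithmic derivative of `gammaRatio n` at `s` is exactly `ψ(s + n + 1) - log n`. -/
theorem tendsto_digamma_add_nat_sub_log {s : ℂ} (h1 : -(1 / 4) ≤ s.re) (h2 : s.re ≤ 1)
    (him : 1 ≤ |s.im|) :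
    Tendsto (fun n : ℕ => digamma (s + n + 1) - log n) atTop (𝓝 0) := by
  have hs : ∀ m : ℕ, s ≠ -m := fun m hm => by
    rw [hm] at him
    simp at him
    linarith
  have h := (tendsto_deriv_gammaRatio h1 h2 him).div (tendsto_gammaRatio hs) one_ne_zero
  rw [zero_div] at h
  refine h.congr' ?_
  filter_upwards [eventually_ge_atTop 1] with n hn
  have hn' : (1 : ℝ) ≤ n := by exact_mod_cast hn
  have hn0 : (n : ℂ) ≠ 0 := by exact_mod_cast (by omega : n ≠ 0)
  have hre : 0 < (s + n + 1).re := by simp; linarith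
  have hf : (n.factorial : ℂ) ≠ 0 := by exact_mod_cast n.factorial_ne_zero
  have hpow : (n : ℂ) ^ s ≠ 0 := by simp [cpow_eq_zero_iff, hn0]
  have hG : HasDerivAt (fun z => Gamma (z + n + 1)) (deriv Gamma (s + n + 1)) s := by
    have hd : DifferentiableAt ℂ Gamma (s + n + 1) := differentiableAt_Gamma _ fun m hm => by
      rw [hm] at hre
      simp at hre
      linarith [(Nat.cast_nonneg m : (0 : ℝ) ≤ m)]
    exact (hd.hasDerivAt.comp s (((hasDerivAt_id s).add_const (n : ℂ)).add_const 1)).congr_deriv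
      (mul_one _)
  have hp : HasDerivAt (fun z : ℂ => (n : ℂ) ^ z * n.factorial)
      ((n : ℂ) ^ s * log n * n.factorial) s := by
    have := ((hasDerivAt_id s).const_cpow (Or.inl hn0)).mul_const (n.factorial : ℂ)
    simpa using this
  have hne : Gamma (s + n + 1) ≠ 0 := Gamma_ne_zero_of_re_pos hre
  have hd := (hG.fun_div hp (mul_ne_zero hpow hf)).deriv
  rw [Pi.div_apply, show deriv (gammaRatio n) s = _ from hd, gammaRatio, digamma_def, logDeriv_apply]
  field_simp

theorem norm_add_nat_ge {s : ℂ} (h1 : -(1 / 4) ≤ s.re) (him : 1 ≤ |s.im|) (k : ℕ) {t : ℝ}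
    (ht : 0 ≤ t) : (|s.im| + k) / 2 ≤ ‖s + k + t‖ := by
  have h0 : 0 ≤ (|s.im| + k) / 2 := by positivity
  rw [← sq_le_sq₀ h0 (norm_nonneg _), ← normSq_eq_norm_sq, normSq_apply]
  simp only [add_re, natCast_re, ofReal_re, add_im, natCast_im, ofReal_im, add_zero]
  rw [← abs_mul_abs_self s.im]
  rcases Nat.eq_zero_or_pos k with rfl | hk
  · simp only [Nat.cast_zero, add_zero]
    nlinarith [mul_self_nonneg (s.re + t)]
  · have hk' : (1 : ℝ) ≤ k := by exact_mod_cast hk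
    have h3 : (k : ℝ) - 1 / 4 ≤ s.re + k + t := by linarith
    nlinarith [mul_self_le_mul_self (by linarith) h3, mul_self_nonneg (|s.im| - k)]

/-- The mean value inequality for `log(w + t) - t/w` on `[0, 1]` gives `4/(v + k)²` with `v = |Im
s|`. It is stated as a difference of reciprocals so that the sum over `k` telescopes; their product
of denominators is `(v + k)² - 1/4`. -/
theorem norm_log_add_one_sub_le {s : ℂ} (h1 : -(1 / 4) ≤ s.re) (him : 1 ≤ |s.im|) (k : ℕ) :
    ‖log (s + k + 1) - log (s + k) - (s + k)⁻¹‖ ≤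
      4 * (1 / (|s.im| + k - 1 / 2) - 1 / (|s.im| + (k + 1 : ℕ) - 1 / 2)) := by
  set w := s + k with hw
  set v := |s.im| with hv
  have hk0 : (0 : ℝ) ≤ k := k.cast_nonneg
  have hslit : ∀ t : ℝ, w + t ∈ slitPlane := fun t => Or.inr (by
    rw [hw]; simp; intro h; rw [hv, h] at him; simp at him; linarith)
  have hbound : ∀ t ∈ Ico (0 : ℝ) 1, ‖(w + t)⁻¹ - w⁻¹‖ ≤ 4 / (v + k) ^ 2 := by
    intro t ht
    have ha := norm_add_nat_ge h1 him k ht.1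
    have hb := norm_add_nat_ge h1 him k le_rfl
    rw [ofReal_zero, add_zero] at hb
    have hpos : 0 < (v + k) / 2 := by positivity
    have hw0 : w ≠ 0 := norm_pos_iff.1 (hpos.trans_le hb)
    have hwt : w + t ≠ 0 := norm_pos_iff.1 (hpos.trans_le ha)
    have : (w + t)⁻¹ - w⁻¹ = -t / (w * (w + t)) := by field_simp; ring
    rw [this, norm_div, norm_neg, norm_mul, norm_real, Real.norm_of_nonneg ht.1]
    calc t / (‖w‖ * ‖w + t‖) ≤ 1 / ((v + k) / 2 * ((v + k) / 2)) := by
          have := ht.2.le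
          gcongr
      _ = 4 / (v + k) ^ 2 := by field_simp; norm_num
  have hder : ∀ t ∈ Icc (0 : ℝ) 1, HasDerivWithinAt (fun t : ℝ => log (w + t) - t * w⁻¹)
      ((w + t)⁻¹ - w⁻¹) (Icc 0 1) t := by
    intro t _
    have h3 := ((hasDerivAt_id (t : ℂ)).const_add w).clog (hslit t)
    have h4 := (h3.sub ((hasDerivAt_id (t : ℂ)).mul_const w⁻¹)).comp_ofReal
    refine (h4.congr_deriv ?_).hasDerivWithinAt
    simp
  have hmv := norm_image_sub_le_of_norm_deriv_le_segment_01' hder hbound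
  have e : log (w + 1) - log w - w⁻¹ =
      (fun t : ℝ => log (w + t) - t * w⁻¹) 1 - (fun t : ℝ => log (w + t) - t * w⁻¹) 0 := by
    simp; ring
  rw [e]
  refine hmv.trans ?_
  have hvk : 0 < v + k - 1 / 2 := by linarith
  push_cast
  rw [div_sub_div _ _ hvk.ne' (by linarith), mul_div_assoc', div_le_div_iff₀ (by positivity)
    (by nlinarith)]
  nlinarith

/-- `ψ(s + 1) = ψ(s) + 1/s` makes the increments of `ψ - log` along `s + n` summable, with
telescoping bounds, and `ψ - log` tends to `0` along that sequence. Thus `ψ(s) - log s` is bounded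
by the total of the increments. -/
theorem norm_digamma_sub_log_le {s : ℂ} (h1 : -(1 / 4) ≤ s.re) (h2 : s.re ≤ 1)
    (him : 1 ≤ |s.im|) : ‖digamma s - log s‖ ≤ 8 / |s.im| := by
  set v := |s.im| with hv
  have hs : ∀ m : ℕ, s ≠ -m := fun m hm => by
    rw [hv, hm] at him
    simp at him
    linarith
  have hbd : ∀ n : ℕ, ‖(digamma (s + n) - log (s + n)) - (digamma s - log s)‖ ≤
      4 * (1 / (v - 1 / 2) - 1 / (v + n - 1 / 2)) := by
    intro n
    induction n with
    | zero => simp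
    | succ n ih =>
      have hn : ∀ m : ℕ, s + n ≠ -m := fun m hm => hs (n + m) (by
        push_cast; linear_combination hm)
      have h3 := norm_log_add_one_sub_le h1 him n
      have h4 := digamma_apply_add_one (s + n) hn
      push_cast at h3 ⊢
      rw [← add_assoc, h4]
      have e : digamma (s + n) + (s + n)⁻¹ - log (s + n + 1) - (digamma s - log s) =
        (digamma (s + n) - log (s + n)) - (digamma s - log s) -
          (log (s + n + 1) - log (s + n) - (s + n)⁻¹) := by ring
      rw [e]
      refine (norm_sub_le _ _).trans ?_
      linarith
  have hlim : Tendsto (fun n : ℕ => digamma (s + n + 1) - log (s + n + 1)) atTop (𝓝 0) := by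
    have h3 : Tendsto (fun n : ℕ => log (1 + (s + 1) / n)) atTop (𝓝 0) := by
      have h4 : Tendsto (fun n : ℕ => 1 + (s + 1) / (n : ℂ)) atTop (𝓝 (1 + 0)) := by
        refine tendsto_const_nhds.add ?_
        exact tendsto_const_div_atTop_nhds_zero_nat (s + 1)
      rw [add_zero] at h4
      have := (continuousAt_clog (x := 1) (by simp)).tendsto.comp h4
      rwa [log_one] at this
    have h5 := (tendsto_digamma_add_nat_sub_log h1 h2 him).sub h3
    rw [sub_zero] at h5
    refine h5.congr' ?_
    filter_upwards [eventually_ge_atTop 1] with n hn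
    have hn' : (0 : ℝ) < n := by exact_mod_cast hn
    have hn0 : (n : ℂ) ≠ 0 := by exact_mod_cast hn'.ne'
    have hne : 1 + (s + 1) / (n : ℂ) ≠ 0 := by
      intro h0
      have : s + n + 1 = 0 := by field_simp at h0; linear_combination h0
      exact hs (n + 1) (by push_cast; linear_combination this)
    have e : s + n + 1 = ((n : ℝ) : ℂ) * (1 + (s + 1) / n) := by
      push_cast; field_simp; ring
    rw [e, log_ofReal_mul hn' hne, ofReal_log hn'.le]
    push_cast
    ring
  have hlim2 : Tendsto (fun n : ℕ => ‖(digamma (s + (n + 1 : ℕ)) - log (s + (n + 1 : ℕ))) -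
      (digamma s - log s)‖) atTop (𝓝 ‖0 - (digamma s - log s)‖) := by
    refine (Tendsto.sub_const ?_ _).norm
    refine hlim.congr fun n => ?_
    push_cast
    rw [add_assoc]
  rw [zero_sub, norm_neg] at hlim2
  refine le_of_tendsto hlim2 (Eventually.of_forall fun n => (hbd (n + 1)).trans ?_)
  have h6 : 0 ≤ 1 / (v + (n + 1 : ℕ) - 1 / 2) := by
    have : (0 : ℝ) ≤ (n + 1 : ℕ) := Nat.cast_nonneg _
    exact div_nonneg zero_le_one (by linarith)
  have h7 : 1 / (v - 1 / 2) ≤ 2 / v := by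
    rw [div_le_div_iff₀ (by linarith) (by linarith)]
    linarith
  have h8 : 8 / v = 4 * (2 / v) := by ring
  rw [h8]
  linarith

/-! ### The functional equation for `ζ'/ζ` -/

/-- The function `ζ'/ζ (s) + ζ'/ζ (1 - s)`, expressed by digamma functions. -/
noncomputable def zetaReflection (s : ℂ) : ℂ :=
  Real.log Real.pi - (digamma (s / 2) + digamma ((1 - s) / 2)) / 2

theorem im_ne_zero_ne {s : ℂ} (h : s.im ≠ 0) (x : ℝ) : s ≠ x := by
  rintro rfl; simp at h

theorem Gammaℝ_ne_zero_of_im_ne_zero {s : ℂ} (h : s.im ≠ 0) : Gammaℝ s ≠ 0 := by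
  rw [Ne, Gammaℝ_eq_zero_iff]
  rintro ⟨n, hn⟩
  rw [hn] at h
  simp at h

theorem differentiableAt_Gammaℝ {s : ℂ} (h : s.im ≠ 0) : DifferentiableAt ℂ Gammaℝ s := by
  have := Gammaℝ_ne_zero_of_im_ne_zero h
  have h1 := (differentiable_Gammaℝ_inv s).inv (inv_ne_zero this)
  have h2 : (fun s => (Gammaℝ s)⁻¹)⁻¹ = Gammaℝ := by ext z; simp
  rwa [h2] at h1

theorem half_ne_neg_nat {s : ℂ} (h : s.im ≠ 0) (m : ℕ) : s / 2 ≠ -m := fun hm => by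
  have : s = -(2 * m) := by linear_combination 2 * hm
  rw [this] at h
  simp at h

theorem logDeriv_Gammaℝ {s : ℂ} (h : s.im ≠ 0) :
    logDeriv Gammaℝ s = -Real.log Real.pi / 2 + digamma (s / 2) / 2 := by
  have hpi : (Real.pi : ℂ) ≠ 0 := by exact_mod_cast Real.pi_ne_zero
  have hG := Gamma_ne_zero (half_ne_neg_nat h)
  have h1 : HasDerivAt (fun z : ℂ => (Real.pi : ℂ) ^ (-z / 2))
      ((Real.pi : ℂ) ^ (-s / 2) * log Real.pi * (-1 / 2)) s := by
    simpa using ((hasDerivAt_id s).neg.div_const 2).const_cpow (Or.inl hpi)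
  have h2 : HasDerivAt (fun z : ℂ => Gamma (z / 2)) (deriv Gamma (s / 2) * (1 / 2)) s :=
    (differentiableAt_Gamma _ (half_ne_neg_nat h)).hasDerivAt.comp s ((hasDerivAt_id s).div_const 2)
  have h3 : Gammaℝ = fun z => (Real.pi : ℂ) ^ (-z / 2) * Gamma (z / 2) := rfl
  have h4 : (Real.pi : ℂ) ^ (-s / 2) ≠ 0 := by simp [cpow_eq_zero_iff, hpi]
  rw [h3, logDeriv_mul s h4 hG h1.differentiableAt h2.differentiableAt, logDeriv_apply,
    logDeriv_apply, h1.deriv, h2.deriv, digamma_def, logDeriv_apply, ofReal_log Real.pi_pos.le]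
  field_simp

theorem completedRiemannZeta_eventuallyEq {s : ℂ} (h : s.im ≠ 0) :
    completedRiemannZeta =ᶠ[𝓝 s] fun z => Gammaℝ z * riemannZeta z := by
  have ho : {z : ℂ | z.im ≠ 0} ∈ 𝓝 s :=
    (isOpen_ne.preimage continuous_im).mem_nhds h
  filter_upwards [ho] with z hz
  rw [riemannZeta_def_of_ne_zero (by simpa using im_ne_zero_ne hz 0),
    mul_div_cancel₀ _ (Gammaℝ_ne_zero_of_im_ne_zero hz)]

theorem riemannZeta_one_sub_eq_zero_iff {s : ℂ} (h : s.im ≠ 0) :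
    riemannZeta (1 - s) = 0 ↔ riemannZeta s = 0 := by
  have h' : (1 - s).im ≠ 0 := by simpa using h
  have e1 := (completedRiemannZeta_eventuallyEq h).self_of_nhds
  have e2 := (completedRiemannZeta_eventuallyEq h').self_of_nhds
  rw [completedRiemannZeta_one_sub, e1] at e2
  simp only at e2
  have g1 := Gammaℝ_ne_zero_of_im_ne_zero h
  have g2 := Gammaℝ_ne_zero_of_im_ne_zero h'
  constructor <;> intro h0
  · rw [h0, mul_zero] at e2
    exact (mul_eq_zero.1 e2).resolve_left g1
  · rw [h0, mul_zero] at e2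
    exact (mul_eq_zero.1 e2.symm).resolve_left g2

theorem differentiableAt_riemannZeta_of_im_ne_zero {s : ℂ} (h : s.im ≠ 0) :
    DifferentiableAt ℂ riemannZeta s :=
  differentiableAt_riemannZeta (by simpa using im_ne_zero_ne h 1)

theorem isOpen_im_ne_zero : IsOpen {z : ℂ | z.im ≠ 0} := isOpen_ne.preimage continuous_im

theorem analyticAt_riemannZeta_of_im_ne_zero {s : ℂ} (h : s.im ≠ 0) :
    AnalyticAt ℂ riemannZeta s :=
  DifferentiableOn.analyticAt (s := {z : ℂ | z.im ≠ 0})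
    (fun _ hz => (differentiableAt_riemannZeta_of_im_ne_zero hz).differentiableWithinAt)
    (isOpen_im_ne_zero.mem_nhds h)

theorem analyticAt_completedRiemannZeta_of_im_ne_zero {s : ℂ} (h : s.im ≠ 0) :
    AnalyticAt ℂ completedRiemannZeta s :=
  DifferentiableOn.analyticAt (s := {z : ℂ | z.im ≠ 0})
    (fun z hz => (differentiableAt_completedZeta (by simpa using im_ne_zero_ne hz 0)
      (by simpa using im_ne_zero_ne hz 1)).differentiableWithinAt)
    (isOpen_im_ne_zero.mem_nhds h)

theorem analyticAt_Gammaℝ_of_im_ne_zero {s : ℂ} (h : s.im ≠ 0) : AnalyticAt ℂ Gammaℝ s :=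
  DifferentiableOn.analyticAt (s := {z : ℂ | z.im ≠ 0})
    (fun _ hz => (differentiableAt_Gammaℝ hz).differentiableWithinAt)
    (isOpen_im_ne_zero.mem_nhds h)

theorem logDeriv_completedRiemannZeta {s : ℂ} (h : s.im ≠ 0) (h0 : riemannZeta s ≠ 0) :
    logDeriv completedRiemannZeta s =
      -Real.log Real.pi / 2 + digamma (s / 2) / 2 + logDeriv riemannZeta s := by
  have he := completedRiemannZeta_eventuallyEq h
  rw [logDeriv_apply, he.deriv_eq, he.eq_of_nhds, ← logDeriv_apply, logDeriv_mul s (Gammaℝ_ne_zero_of_im_ne_zero h) h0 (differentiableAt_Gammaℝ h)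
      (differentiableAt_riemannZeta_of_im_ne_zero h), logDeriv_Gammaℝ h]

/-- Logarithmic differentiation of the symmetry `s ↦ 1 - s` of the completed zeta function; the
factors `Gammaℝ` supply the digamma terms. -/
theorem logDeriv_riemannZeta_add_one_sub {s : ℂ} (h : s.im ≠ 0) (h0 : riemannZeta s ≠ 0) :
    logDeriv riemannZeta s + logDeriv riemannZeta (1 - s) = zetaReflection s := by
  have h' : (1 - s).im ≠ 0 := by simpa using h
  have h0' : riemannZeta (1 - s) ≠ 0 := fun h1 => h0 ((riemannZeta_one_sub_eq_zero_iff h).1 h1)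
  have e : logDeriv completedRiemannZeta s = -logDeriv completedRiemannZeta (1 - s) := by
    have hd := (analyticAt_completedRiemannZeta_of_im_ne_zero h').differentiableAt.hasDerivAt
    have h1 : HasDerivAt (fun z => completedRiemannZeta (1 - z))
        (deriv completedRiemannZeta (1 - s) * -1) s :=
      hd.comp s ((hasDerivAt_id s).const_sub 1)
    simp only [completedRiemannZeta_one_sub] at h1
    rw [logDeriv_apply, logDeriv_apply, completedRiemannZeta_one_sub, h1.deriv]
    ring
  rw [logDeriv_completedRiemannZeta h h0, logDeriv_completedRiemannZeta h' h0'] at e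
  rw [zetaReflection]
  linear_combination e

/-- Off the real axis `Gammaℝ` is analytic and non-zero, so `ζ` and the completed function, which is
symmetric, have equal orders. Zeros left of the critical line can thus be counted on its right. -/
theorem analyticOrderAt_riemannZeta_one_sub {s : ℂ} (h : s.im ≠ 0) :
    analyticOrderAt riemannZeta (1 - s) = analyticOrderAt riemannZeta s := by
  have key : ∀ {z : ℂ}, z.im ≠ 0 →
      analyticOrderAt completedRiemannZeta z = analyticOrderAt riemannZeta z := by
    intro z hz
    rw [analyticOrderAt_congr (completedRiemannZeta_eventuallyEq hz)]
    have := analyticOrderAt_mul (analyticAt_Gammaℝ_of_im_ne_zero hz)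
      (analyticAt_riemannZeta_of_im_ne_zero hz)
    rw [(analyticAt_Gammaℝ_of_im_ne_zero hz).analyticOrderAt_eq_zero.2
      (Gammaℝ_ne_zero_of_im_ne_zero hz), zero_add] at this
    exact this
  have h' : (1 - s).im ≠ 0 := by simpa using h
  rw [← key h, ← key h']
  have hcomp := analyticOrderAt_comp_of_deriv_ne_zero (f := completedRiemannZeta)
    (g := fun z => 1 - z) (z₀ := s) (by fun_prop) (by simp)
  rw [← hcomp]
  congr 1
  ext z
  simp [completedRiemannZeta_one_sub]

/-- Otherwise `ζ` would vanish on the whole half-plane containing `s`, in particular at a point with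
real part `2`. -/
theorem analyticOrderAt_riemannZeta_ne_top {s : ℂ} (h : s.im ≠ 0) :
    analyticOrderAt riemannZeta s ≠ ⊤ := by
  intro htop
  rw [analyticOrderAt_eq_top] at htop
  obtain ⟨e, he⟩ : ∃ e : ℝ, 0 < e * s.im := ⟨s.im, mul_self_pos.2 h⟩
  have hconv : Convex ℝ {z : ℂ | 0 < e * z.im} :=
    convex_halfSpace_gt (f := fun z : ℂ => e * z.im)
      ⟨fun x y => by simp [mul_add], fun c x => by simp; ring⟩ 0
  have hA : AnalyticOnNhd ℂ riemannZeta {z : ℂ | 0 < e * z.im} := fun z hz =>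
    analyticAt_riemannZeta_of_im_ne_zero fun h0 => by
      rw [mem_ofPred_eq, h0] at hz; simp at hz
  have := hA.eqOn_zero_of_preconnected_of_eventuallyEq_zero hconv.isPreconnected he htop
    (show (2 : ℂ) + s.im * I ∈ {z : ℂ | 0 < e * z.im} by simpa using he)
  exact riemannZeta_ne_zero_of_one_le_re (by simp) this

theorem analyticAt_digamma {s : ℂ} (h : s.im ≠ 0) : AnalyticAt ℂ digamma s := by
  have hne : ∀ z : ℂ, z.im ≠ 0 → ∀ m : ℕ, z ≠ -m := fun z hz m hm => by
    rw [hm] at hz; simp at hz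
  have hG : AnalyticAt ℂ Gamma s := DifferentiableOn.analyticAt (s := {z : ℂ | z.im ≠ 0})
    (fun z hz => (differentiableAt_Gamma z (hne z hz)).differentiableWithinAt)
    (isOpen_im_ne_zero.mem_nhds h)
  exact hG.deriv.div hG (Gamma_ne_zero (hne s h))

theorem differentiableAt_zetaReflection {s : ℂ} (h : s.im ≠ 0) :
    DifferentiableAt ℂ zetaReflection s := by
  have h1 : DifferentiableAt ℂ (fun z : ℂ => digamma (z / 2)) s :=
    DifferentiableAt.comp s (g := digamma)
      (analyticAt_digamma (by simpa using h)).differentiableAt (by fun_prop)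
  have h2 : DifferentiableAt ℂ (fun z : ℂ => digamma ((1 - z) / 2)) s :=
    DifferentiableAt.comp s (g := digamma)
      (analyticAt_digamma (by simpa using h)).differentiableAt (by fun_prop)
  exact ((h1.add h2).div_const 2).const_sub _

theorem norm_log_le_of_im {w : ℂ} {t : ℝ} (h1 : 1 ≤ ‖w‖) (h2 : ‖w‖ ≤ t) :
    ‖log w‖ ≤ Real.log t + Real.pi := by
  refine (norm_le_abs_re_add_abs_im _).trans (add_le_add ?_ ?_)
  · rw [log_re, abs_of_nonneg (Real.log_nonneg h1)]
    exact Real.log_le_log (by linarith) h2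
  · rw [log_im]; exact abs_arg_le_pi w

theorem norm_zetaReflection_le {s : ℂ} (h1 : -(1 / 2) ≤ s.re) (h2 : s.re ≤ 3 / 2)
    (h : 2 ≤ |s.im|) : ‖zetaReflection s‖ ≤ 25 * Real.log |s.im| := by
  have hL : 0.69 ≤ Real.log |s.im| :=
    le_trans (by linarith [Real.log_two_gt_d9]) (Real.log_le_log (by norm_num) h)
  have hpi1 := Real.pi_lt_d2
  have hlogpi : Real.log Real.pi ≤ 2.2 := by
    have := Real.log_le_sub_one_of_pos Real.pi_pos
    linarith
  have hlogpi0 : 0 ≤ Real.log Real.pi := Real.log_nonneg (by linarith [Real.pi_gt_three])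
  -- `11.15 = 8 + 3.15`: the error `8/|Im w|` with `|Im w| ≥ 1`, and the argument of `w`.
  have key : ∀ w : ℂ, -(1 / 4) ≤ w.re → w.re ≤ 3 / 4 → |w.im| = |s.im| / 2 →
      ‖digamma w‖ ≤ Real.log |s.im| + 11.15 := by
    intro w a1 a2 a3
    have b1 := norm_digamma_sub_log_le (s := w) a1 (by linarith) (by linarith)
    have b2 : 8 / |w.im| ≤ 8 := div_le_self (by norm_num) (by linarith)
    have b3 : 1 ≤ ‖w‖ := le_trans (by linarith) (abs_im_le_norm w)
    have b4 : ‖w‖ ≤ |s.im| := by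
      refine (norm_le_abs_re_add_abs_im w).trans ?_
      have : |w.re| ≤ 3 / 4 := abs_le.2 ⟨by linarith, a2⟩
      linarith
    have b5 := norm_log_le_of_im b3 b4
    have b6 := norm_add_le (digamma w - log w) (log w)
    rw [sub_add_cancel] at b6
    linarith
  have k1 := key (s / 2) (by simp; linarith) (by simp; linarith) (by simp [abs_div])
  have k2 := key ((1 - s) / 2) (by simp; linarith) (by simp; linarith) (by simp [abs_div])
  rw [zetaReflection]
  refine (norm_sub_le _ _).trans ?_
  rw [norm_real, Real.norm_of_nonneg hlogpi0, norm_div]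
  have k3 := norm_add_le (digamma (s / 2)) (digamma ((1 - s) / 2))
  have k4 : ‖(2 : ℂ)‖ = 2 := by simp
  rw [k4]
  linarith

/-- On the critical line `s/2` and `(1 - s)/2` are complex conjugates, so the two logarithms add up
to the real number `log |w|²`, and `|w|² = t²/4 + 1/16`. -/
theorem norm_zetaReflection_half_add_log_le {t : ℝ} (ht : 2 ≤ t) :
    ‖zetaReflection (1 / 2 + t * I) + Real.log (t / (2 * Real.pi))‖ ≤ 17 / t := by
  have ht0 : 0 < t := by linarith
  set w : ℂ := 1 / 4 + (t / 2 : ℝ) * I with hw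
  have hwre : w.re = 1 / 4 := by simp [hw]
  have hwim : w.im = t / 2 := by simp [hw]
  set w' : ℂ := starRingEnd ℂ w with hw'
  have e1 : (1 / 2 + t * I) / 2 = w := by rw [hw]; push_cast; ring
  have e2 : (1 - (1 / 2 + t * I)) / 2 = w' := by
    rw [hw', hw]
    simp only [map_add, map_mul, conj_ofReal, conj_I]
    have : (starRingEnd ℂ) (1 / 4 : ℂ) = 1 / 4 := by
      rw [map_div₀, map_one, map_ofNat]
    rw [this]; push_cast; ring
  have d1 := norm_digamma_sub_log_le (s := w) (by rw [hwre]; norm_num) (by rw [hwre]; norm_num)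
    (by rw [hwim, abs_of_pos (by linarith)]; linarith)
  have d2 := norm_digamma_sub_log_le (s := w') (by rw [hw', conj_re, hwre]; norm_num)
    (by rw [hw', conj_re, hwre]; norm_num)
    (by rw [hw', conj_im, hwim, abs_neg, abs_of_pos (by linarith)]; linarith)
  rw [hw', conj_im, hwim, abs_neg, abs_of_pos (by linarith), ← hw'] at d2
  rw [hwim, abs_of_pos (by linarith)] at d1
  have hsum : log w + log w' = ((Real.log (1 / 16 + t ^ 2 / 4) : ℝ) : ℂ) := by
    have harg : arg w ≠ Real.pi := by
      intro h
      have := (arg_eq_pi_iff.1 h).2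
      rw [hwim] at this; linarith
    rw [hw', log_conj w harg, add_conj, log_re]
    have hn : 1 / 16 + t ^ 2 / 4 = ‖w‖ ^ 2 := by
      rw [← normSq_eq_norm_sq, normSq_apply, hwre, hwim]; ring
    rw [hn, Real.log_pow]
    push_cast; ring
  have hlog : |Real.log (1 / 16 + t ^ 2 / 4) - 2 * Real.log (t / 2)| ≤ 1 / t := by
    have h3 : 1 / 16 + t ^ 2 / 4 = (t / 2) ^ 2 * (1 + 1 / (4 * t ^ 2)) := by field_simp; ring
    have h4 : Real.log (1 / 16 + t ^ 2 / 4) =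
        2 * Real.log (t / 2) + Real.log (1 + 1 / (4 * t ^ 2)) := by
      rw [h3, Real.log_mul (by positivity) (by positivity), Real.log_pow]
      push_cast; ring
    rw [h4, add_sub_cancel_left, abs_of_nonneg (Real.log_nonneg (by
      have : 0 < 1 / (4 * t ^ 2) := by positivity
      linarith))]
    have h5 := Real.log_le_sub_one_of_pos (show 0 < 1 + 1 / (4 * t ^ 2) by positivity)
    refine h5.trans ?_
    rw [add_sub_cancel_left]
    apply one_div_le_one_div_of_le ht0
    nlinarith
  have hl2 : Real.log (t / (2 * Real.pi)) = Real.log (t / 2) - Real.log Real.pi := by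
    rw [← Real.log_div (by positivity) Real.pi_ne_zero]
    congr 1
    field_simp
  have hid : zetaReflection (1 / 2 + t * I) + Real.log (t / (2 * Real.pi)) =
      -((digamma w - log w) / 2) - ((digamma w' - log w') / 2) -
        ((Real.log (1 / 16 + t ^ 2 / 4) - 2 * Real.log (t / 2) : ℝ) : ℂ) / 2 := by
    rw [zetaReflection, e1, e2, hl2, ofReal_sub, ofReal_sub, ← hsum]
    push_cast
    ring
  rw [hid]
  have n1 : ∀ z : ℂ, ‖z / 2‖ = ‖z‖ / 2 := fun z => by rw [norm_div]; simp
  refine (norm_sub_le _ _).trans ?_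
  have n2 := norm_sub_le (-((digamma w - log w) / 2)) ((digamma w' - log w') / 2)
  rw [norm_neg, n1, n1] at n2
  rw [n1, norm_real, Real.norm_eq_abs]
  have n3 : 8 / (t / 2) = 16 / t := by field_simp; norm_num
  rw [n3] at d1 d2
  have n4 : 17 / t = 16 / t + 1 / t := by ring
  have n5 : 0 < 1 / t := by positivity
  linarith

/-! ### Zeros in short intervals and good heights -/

open Set Filter Topology MeasureTheory Metric

theorem mem_closedBall_two_add {T r a b : ℝ} (hr : 0 ≤ r) {z : ℂ} (h1 : |z.re - 2| ≤ a)
    (h2 : |z.im - T| ≤ b) (h : a ^ 2 + b ^ 2 ≤ r ^ 2) : z ∈ closedBall (2 + T * I : ℂ) r := by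
  rw [mem_closedBall, dist_eq_norm, ← sq_le_sq₀ (norm_nonneg _) hr, ← normSq_eq_norm_sq,
    normSq_apply]
  have e1 : (z - (2 + T * I)).re = z.re - 2 := by simp
  have e2 : (z - (2 + T * I)).im = z.im - T := by simp
  rw [e1, e2]
  have h3 := sq_le_sq' (by linarith [neg_abs_le (z.re - 2), abs_nonneg (z.re-2)]) h1
  have h4 := sq_le_sq' (by linarith [neg_abs_le (z.im - T), abs_nonneg (z.im-T)]) h2
  rw [sq_abs] at h3 h4
  nlinarith

/-- Landau's lemma around `2 + iT`. The outer radius `1.9 < 2` stays in `Re s > 0` and off the real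
axis; `1.5` reaches the critical line; the disc of radius `1.85` contains all points with `|Re z -
2| ≤ 1.5` and `|Im z - T| ≤ 1`. Everything left of the critical line is later reached by `s ↦ 1 -
s`, which is why negative `T` is included. -/
theorem exists_zeta_local_zeros : ∃ C : ℝ, 0 < C ∧ ∀ T : ℝ, 2 ≤ |T| → ∃ S : Finset ℂ,
    (∀ z, z ∈ S ↔ z ∈ closedBall (2 + T * I : ℂ) 1.85 ∧ riemannZeta z = 0) ∧
    (∀ z ∈ S, z.im ≠ 0) ∧
    ((∑ ρ ∈ S, analyticOrderNatAt riemannZeta ρ : ℕ) : ℝ) ≤ C * Real.log |T| ∧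
    ∀ z ∈ closedBall (2 + T * I : ℂ) 1.5, riemannZeta z ≠ 0 →
      ‖logDeriv riemannZeta z - ∑ ρ ∈ S, (analyticOrderNatAt riemannZeta ρ : ℂ) / (z - ρ)‖ ≤
        C * Real.log |T| := by
  set k : ℝ := Real.log (1.9 / 1.85) with hk
  have hkpos : 0 < k := Real.log_pos (by norm_num)
  refine ⟨9 / k * (1.85 / (1.9 ^ 2 - 1.85 * 1.5)) + 4 * (1.5 + 1.85) / (1.85 - 1.5) ^ 2 * 9 + 9 / k,
    by norm_num; positivity, fun T hT => ?_⟩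
  have hfin := (isCompact_closedBall (2 + T * I : ℂ) 1.85).inter_riemannZetaZeros_finite
  have hLpos : 0 < Real.log |T| := Real.log_pos (by linarith)
  have hL : 0.69 ≤ Real.log |T| :=
    le_trans (by linarith [Real.log_two_gt_d9]) (Real.log_le_log (by norm_num) hT)
  have him : ∀ z ∈ closedBall (2 + T * I : ℂ) 1.9, 0.1 ≤ |z.im| ∧ 0.1 ≤ z.re ∧ ‖z‖ ≤ 4 * |T| := by
    intro z hz
    rw [mem_closedBall, dist_eq_norm] at hz
    have h1 := (abs_im_le_norm _).trans hz
    have h2 := abs_le.1 ((abs_re_le_norm _).trans hz)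
    simp at h1 h2
    have h3 := abs_sub_abs_le_abs_sub T z.im
    rw [abs_sub_comm] at h3
    have h4 : ‖(2 + T * I : ℂ)‖ ≤ 2 + |T| := by
      refine (norm_add_le _ _).trans ?_
      simp
    have h5 := norm_add_le (z - (2 + T * I)) (2 + T * I)
    rw [sub_add_cancel] at h5
    exact ⟨by norm_num at h1 ⊢; linarith, by norm_num at h2 ⊢; linarith, by norm_num at hz; linarith⟩
  have hU : closedBall (2 + T * I : ℂ) 1.9 ⊆ {z : ℂ | z.im ≠ 0} := fun z hz h0 => by
    have := (him z hz).1
    rw [h0, abs_zero] at this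
    norm_num at this
  have hs₀ : 1 / 3 ≤ ‖riemannZeta (2 + T * I)‖ := one_third_le_norm_riemannZeta (by simp)
  have hS : ∀ z, z ∈ hfin.toFinset ↔ z ∈ closedBall (2 + T * I : ℂ) 1.85 ∧ riemannZeta z = 0 := by
    intro z; rw [Set.Finite.mem_toFinset]; rfl
  have hSim : ∀ z ∈ hfin.toFinset, z.im ≠ 0 := fun z hz =>
    hU (closedBall_subset_closedBall (by norm_num) ((hS z).1 hz).1)
  -- `M = 240 |T|`: on the outer circle `|ζ| ≤ 80 |T|`, and at the centre `|ζ| ≥ 1/3`.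
  have key := logDeriv_sub_sum_zeros (F := riemannZeta) (U := {z : ℂ | z.im ≠ 0})
    (s₀ := 2 + T * I) (r₁ := 1.5) (r₂ := 1.85) (R := 1.9) (M := 240 * |T|)
    (by norm_num) (by norm_num) (by norm_num) hU
    (fun z hz => analyticAt_riemannZeta_of_im_ne_zero hz) (by linarith)
    (fun h => by rw [h, norm_zero] at hs₀; norm_num at hs₀) ?_ hfin.toFinset hS
    (fun z hz => analyticOrderAt_riemannZeta_ne_top (hSim z hz))
  · have hlogM : Real.log (240 * |T|) ≤ 9 * Real.log |T| := by
      have h1 : Real.log 240 ≤ 8 * Real.log 2 := by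
        rw [show (8 : ℝ) = ((8 : ℕ) : ℝ) by norm_num, ← Real.log_pow]
        exact Real.log_le_log (by norm_num) (by norm_num)
      have h2 : Real.log 2 ≤ Real.log |T| := Real.log_le_log (by norm_num) hT
      rw [Real.log_mul (by norm_num) (by linarith)]
      linarith
    have hN : ((∑ ρ ∈ hfin.toFinset, analyticOrderNatAt riemannZeta ρ : ℕ) : ℝ) ≤
        9 / k * Real.log |T| := by
      rw [div_mul_eq_mul_div, le_div_iff₀ hkpos]
      exact key.1.trans hlogM
    refine ⟨hfin.toFinset, hS, hSim, hN.trans ?_, fun z hz hz0 => (key.2 z hz hz0).trans ?_⟩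
    · refine mul_le_mul_of_nonneg_right ?_ hLpos.le
      rw [le_add_iff_nonneg_left]
      norm_num; positivity
    · have c1 : (0 : ℝ) ≤ 1.85 / (1.9 ^ 2 - 1.85 * 1.5) := by norm_num
      have c2 : (0 : ℝ) ≤ 4 * (1.5 + 1.85) / (1.85 - 1.5) ^ 2 := by norm_num
      have a1 := mul_le_mul_of_nonneg_right hN c1
      have a2 := mul_le_mul_of_nonneg_left hlogM c2
      have a3 : 0 ≤ 9 / k * Real.log |T| := by positivity
      linarith
  · intro z hz
    obtain ⟨h1, h2, h3⟩ := him z (sphere_subset_closedBall hz)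
    have h4 := norm_riemannZeta_le (s := z) (by linarith) (hU (sphere_subset_closedBall hz))
    have h5 : ‖z‖ / |z.im| ≤ 4 * |T| / 0.1 := by gcongr
    have h6 : ‖z‖ / z.re ≤ 4 * |T| / 0.1 := by gcongr
    have h7 : 240 * |T| * (1 / 3) ≤ 240 * |T| * ‖riemannZeta (2 + T * I)‖ := by gcongr
    have h8 : 4 * |T| / 0.1 = 40 * |T| := by ring
    linarith

theorem analyticOrderNatAt_riemannZeta_one_sub {s : ℂ} (h : s.im ≠ 0) :
    analyticOrderNatAt riemannZeta (1 - s) = analyticOrderNatAt riemannZeta s := by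
  rw [analyticOrderNatAt, analyticOrderNatAt, analyticOrderAt_riemannZeta_one_sub h]

theorem log_add_le_two_mul_log {T u : ℝ} (hT : 2 ≤ T) (hu : u ≤ 1) (hpos : 0 < T + u) :
    Real.log (T + u) ≤ 2 * Real.log T := by
  rw [← Real.log_rpow (by linarith)]
  refine Real.log_le_log hpos ?_
  norm_cast
  nlinarith

/-- The number of nontrivial zeros with ordinate in `[T, T + 1)`, with multiplicity, is
`O(log T)`. -/
theorem exists_zeta_zero_count : ∃ C : ℝ, 0 < C ∧ ∀ T : ℝ, 2 ≤ T →
    ((∑ ρ ∈ (nontrivialZerosBetween_finite T (T + 1)).toFinset,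
      analyticOrderNatAt riemannZeta ρ : ℕ) : ℝ) ≤ C * Real.log T := by
  classical
  obtain ⟨C, hC, h⟩ := exists_zeta_local_zeros
  refine ⟨4 * C, by positivity, fun T hT => ?_⟩
  have habs : |T + 1 / 2| = T + 1 / 2 := abs_of_pos (by linarith)
  have habs' : |(-(T + 1 / 2))| = T + 1 / 2 := by rw [abs_neg, habs]
  obtain ⟨S, hS, -, hSc, -⟩ := h (T + 1 / 2) (by rw [habs]; linarith)
  obtain ⟨S', hS', -, hSc', -⟩ := h (-(T + 1 / 2)) (by rw [habs']; linarith)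
  rw [habs] at hSc
  rw [habs'] at hSc'
  set Z := (nontrivialZerosBetween_finite T (T + 1)).toFinset with hZ
  have hmem : ∀ ρ ∈ Z, riemannZeta ρ = 0 ∧ ρ.im ≠ 0 ∧ T ≤ ρ.im ∧ ρ.im < T + 1 := fun ρ hρ => by
    rw [hZ, Set.Finite.mem_toFinset] at hρ; exact hρ
  have h1 : ∑ ρ ∈ Z with 1 / 2 ≤ ρ.re, analyticOrderNatAt riemannZeta ρ ≤
      ∑ ρ ∈ S, analyticOrderNatAt riemannZeta ρ := by
    refine Finset.sum_le_sum_of_subset fun ρ hρ => ?_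
    rw [Finset.mem_filter] at hρ
    obtain ⟨a1, a2, a3, a4⟩ := hmem ρ hρ.1
    have a5 := (re_mem_Icc_of_nontrivial_zero a1 a2).2
    refine (hS ρ).2 ⟨mem_closedBall_two_add (a := 1.5) (b := 1) (by norm_num) ?_ ?_ (by norm_num), a1⟩
    · rw [abs_le]; norm_num; constructor <;> linarith [hρ.2]
    · rw [abs_le]; constructor <;> linarith
  -- Zeros left of the critical line are reflected: `1 - ρ` has the same order and lies in the disc
  -- at height `-(T + 1/2)`.
  have h2 : ∑ ρ ∈ Z with ¬ 1 / 2 ≤ ρ.re, analyticOrderNatAt riemannZeta ρ ≤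
      ∑ ρ ∈ S', analyticOrderNatAt riemannZeta ρ := by
    have e : ∑ ρ ∈ Z with ¬ 1 / 2 ≤ ρ.re, analyticOrderNatAt riemannZeta (1 - ρ) =
      ∑ ρ ∈ (Z.filter fun ρ => ¬ 1 / 2 ≤ ρ.re).image (fun ρ => 1 - ρ),
        analyticOrderNatAt riemannZeta ρ := by
      rw [Finset.sum_image fun a _ b _ hab => by simpa using hab]
    have e0 : ∑ ρ ∈ Z with ¬ 1 / 2 ≤ ρ.re, analyticOrderNatAt riemannZeta ρ =
        ∑ ρ ∈ Z with ¬ 1 / 2 ≤ ρ.re, analyticOrderNatAt riemannZeta (1 - ρ) :=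
      Finset.sum_congr rfl fun ρ hρ => (analyticOrderNatAt_riemannZeta_one_sub
        (hmem ρ (Finset.mem_filter.1 hρ).1).2.1).symm
    rw [e0, e]
    refine Finset.sum_le_sum_of_subset fun z hz => ?_
    obtain ⟨ρ, hρ, rfl⟩ := Finset.mem_image.1 hz
    rw [Finset.mem_filter] at hρ
    obtain ⟨a1, a2, a3, a4⟩ := hmem ρ hρ.1
    have a5 := (re_mem_Icc_of_nontrivial_zero a1 a2).1
    refine (hS' _).2 ⟨mem_closedBall_two_add (a := 1.5) (b := 1) (by norm_num) ?_ ?_ (by norm_num),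
      (riemannZeta_one_sub_eq_zero_iff a2).2 a1⟩
    · rw [abs_le]; norm_num; constructor <;> linarith [hρ.2]
    · rw [abs_le]; simp only [sub_im, one_im]; constructor <;> linarith
  rw [← Finset.sum_filter_add_sum_filter_not Z (fun ρ => 1 / 2 ≤ ρ.re)]
  have h3 := log_add_le_two_mul_log hT (u := 1 / 2) (by norm_num) (by linarith)
  have h4 : ((∑ ρ ∈ Z with 1 / 2 ≤ ρ.re, analyticOrderNatAt riemannZeta ρ +
      ∑ ρ ∈ Z with ¬ 1 / 2 ≤ ρ.re, analyticOrderNatAt riemannZeta ρ : ℕ) : ℝ) ≤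
      ((∑ ρ ∈ S, analyticOrderNatAt riemannZeta ρ : ℕ) : ℝ) +
      ((∑ ρ ∈ S', analyticOrderNatAt riemannZeta ρ : ℕ) : ℝ) := by
    exact_mod_cast add_le_add h1 h2
  refine h4.trans ?_
  have h5 := mul_le_mul_of_nonneg_left h3 hC.le
  linarith

/-- Pigeonhole: the midpoints of `card + 1` equal subintervals are `1/(card + 1)` apart, so no point
of `W` is close to two of them. -/
theorem exists_forall_le_abs_sub (W : Finset ℝ) (T : ℝ) :
    ∃ t ∈ Icc T (T + 1), ∀ w ∈ W, 1 / (2 * ((W.card : ℝ) + 1)) ≤ |t - w| := by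
  by_contra hcon
  push Not at hcon
  set N := W.card with hN
  set p : ℕ → ℝ := fun k => T + (2 * k + 1) / (2 * ((N : ℝ) + 1)) with hp
  have hpk : ∀ k ∈ Finset.range (N + 1), ∃ w ∈ W, |p k - w| < 1 / (2 * ((N : ℝ) + 1)) := by
    intro k hk
    refine hcon (p k) ⟨?_, ?_⟩
    · simp only [hp]
      have : 0 ≤ (2 * (k : ℝ) + 1) / (2 * ((N : ℝ) + 1)) := by positivity
      linarith
    · simp only [hp]
      have hk' : (k : ℝ) + 1 ≤ N + 1 := by
        exact_mod_cast Finset.mem_range.1 hk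
      have : (2 * (k : ℝ) + 1) / (2 * ((N : ℝ) + 1)) ≤ 1 := by
        rw [div_le_one (by positivity)]; linarith
      linarith
  choose! g hg hgl using hpk
  obtain ⟨a, ha, b, hb, hab, heq⟩ := Finset.exists_ne_map_eq_of_card_lt_of_maps_to
    (s := Finset.range (N + 1)) (t := W) (by simp [hN]) (f := g) hg
  have h1 := hgl a ha
  have h2 := hgl b hb
  rw [heq] at h1
  have h3 : |p a - p b| < 1 / ((N : ℝ) + 1) := by
    have h4 := abs_sub_le (p a) (g b) (p b)
    rw [abs_sub_comm (g b)] at h4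
    have h5 : 1 / ((N : ℝ) + 1) = 1 / (2 * ((N : ℝ) + 1)) + 1 / (2 * ((N : ℝ) + 1)) := by
      field_simp; norm_num
    linarith
  have h6 : p a - p b = ((a : ℝ) - b) * (1 / ((N : ℝ) + 1)) := by
    simp only [hp]; field_simp; ring
  have h7 : (1 : ℝ) ≤ |(a : ℝ) - b| := by
    have : (1 : ℤ) ≤ |(a : ℤ) - b| := Int.one_le_abs (by omega)
    exact_mod_cast this
  have h8 : 0 < 1 / ((N : ℝ) + 1) := by positivity
  rw [h6, abs_mul, abs_of_pos h8] at h3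
  nlinarith

/-- In every unit interval there is a height at which `ζ'/ζ` is `O(log² T)` across the critical
strip. -/
theorem exists_good_height : ∃ C : ℝ, 0 < C ∧ ∀ T : ℝ, 2 ≤ T → ∃ t ∈ Icc T (T + 1),
    ∀ σ ∈ Icc (-(1 / 2) : ℝ) (3 / 2), riemannZeta (σ + t * I) ≠ 0 ∧
      ‖logDeriv riemannZeta (σ + t * I)‖ ≤ C * Real.log T ^ 2 := by
  classical
  obtain ⟨C, hC, h⟩ := exists_zeta_local_zeros
  refine ⟨2 * C * 3 + 2 * C * (2 * (4 * C + 2)) + 75, by positivity, fun T hT => ?_⟩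
  have habs : |T + 1 / 2| = T + 1 / 2 := abs_of_pos (by linarith)
  have habs' : |(-(T + 1 / 2))| = T + 1 / 2 := by rw [abs_neg, habs]
  obtain ⟨S, hS, hSim, hSc, -⟩ := h (T + 1 / 2) (by rw [habs]; linarith)
  obtain ⟨S', hS', hSim', hSc', -⟩ := h (-(T + 1 / 2)) (by rw [habs']; linarith)
  rw [habs] at hSc
  rw [habs'] at hSc'
  -- All ordinates to be avoided: those of zeros near height `T`, and the negatives of those near
  -- `-T`. Zeros in the left half of the strip enter through their reflections.
  set W : Finset ℝ := S.image (fun z => z.im) ∪ S'.image (fun z => -z.im) with hW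
  obtain ⟨t, ht, htW⟩ := exists_forall_le_abs_sub W T
  set η : ℝ := 1 / (2 * ((W.card : ℝ) + 1)) with hη
  have hL : 0.69 ≤ Real.log T :=
    le_trans (by linarith [Real.log_two_gt_d9]) (Real.log_le_log (by norm_num) hT)
  have hηpos : 0 < η := by positivity
  have hη2 : η ≤ 1 / 2 := by
    rw [hη]
    apply one_div_le_one_div_of_le (by norm_num)
    have : (0 : ℝ) ≤ W.card := Nat.cast_nonneg _
    linarith
  -- Each zero has order at least one, so the number of distinct ordinates is bounded by the count
  -- with multiplicity.
  have hord : ∀ z : ℂ, z.im ≠ 0 → riemannZeta z = 0 → 1 ≤ analyticOrderNatAt riemannZeta z := by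
    intro z hz h0
    rw [Nat.one_le_iff_ne_zero, Ne, analyticOrderNatAt, ENat.toNat_eq_zero]
    push Not
    refine ⟨fun h1 => ?_, analyticOrderAt_riemannZeta_ne_top hz⟩
    exact ((analyticAt_riemannZeta_of_im_ne_zero hz).analyticOrderAt_eq_zero.1 h1) h0
  have hcardS : ∀ S : Finset ℂ, (∀ z ∈ S, z.im ≠ 0) → (∀ z ∈ S, riemannZeta z = 0) →
      (S.card : ℝ) ≤ ((∑ ρ ∈ S, analyticOrderNatAt riemannZeta ρ : ℕ) : ℝ) := by
    intro S h1 h2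
    rw [Finset.card_eq_sum_ones]
    exact_mod_cast Finset.sum_le_sum fun z hz => hord z (h1 z hz) (h2 z hz)
  have hcard : (W.card : ℝ) ≤ 4 * C * Real.log T := by
    have h1 : W.card ≤ S.card + S'.card :=
      (Finset.card_union_le _ _).trans (add_le_add Finset.card_image_le Finset.card_image_le)
    have h2 : (W.card : ℝ) ≤ S.card + S'.card := by exact_mod_cast h1
    have h3 := hcardS S hSim fun z hz => ((hS z).1 hz).2
    have h4 := hcardS S' hSim' fun z hz => ((hS' z).1 hz).2
    have h5 := mul_le_mul_of_nonneg_left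
      (log_add_le_two_mul_log hT (u := 1 / 2) (by norm_num) (by linarith)) hC.le
    linarith
  have hηinv : 1 / η ≤ 2 * (4 * C + 2) * Real.log T := by
    rw [hη, one_div_one_div]
    linarith
  -- Both `t` and `-t` keep distance `η` from every ordinate. Zeros further than `1/2` away are
  -- harmless because `η ≤ 1/2`; the height `-t` is needed for the reflection below.
  have hgap : ∀ e : ℝ, e = 1 ∨ e = -1 → ∀ ρ : ℂ, riemannZeta ρ = 0 → ρ.im ≠ 0 →
      η ≤ |e * t - ρ.im| := by
    intro e he ρ h0 him
    by_contra hlt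
    push Not at hlt
    obtain ⟨r1, r2⟩ := re_mem_Icc_of_nontrivial_zero h0 him
    have hlt' := abs_lt.1 (hlt.trans_le hη2)
    have h0' := (riemannZeta_one_sub_eq_zero_iff him).2 h0
    have hmem : e * ρ.im ∈ W := by
      rw [hW, Finset.mem_union, Finset.mem_image, Finset.mem_image]
      rcases he with rfl | rfl
      · by_cases hre : 1 / 2 ≤ ρ.re
        · left
          refine ⟨ρ, (hS ρ).2 ⟨mem_closedBall_two_add (a := 1.5) (b := 1) (by norm_num) ?_ ?_
            (by norm_num), h0⟩, by ring⟩
          · rw [abs_le]; norm_num; constructor <;> linarith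
          · rw [abs_le]; constructor <;> linarith [ht.1, ht.2]
        · right
          refine ⟨1 - ρ, (hS' _).2 ⟨mem_closedBall_two_add (a := 1.5) (b := 1) (by norm_num) ?_ ?_
            (by norm_num), h0'⟩, by simp⟩
          · rw [abs_le]; norm_num; constructor <;> linarith
          · rw [abs_le]; simp only [sub_im, one_im]; constructor <;> linarith [ht.1, ht.2]
      · by_cases hre : 1 / 2 ≤ ρ.re
        · right
          refine ⟨ρ, (hS' ρ).2 ⟨mem_closedBall_two_add (a := 1.5) (b := 1) (by norm_num) ?_ ?_
            (by norm_num), h0⟩, by ring⟩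
          · rw [abs_le]; norm_num; constructor <;> linarith
          · rw [abs_le]; constructor <;> linarith [ht.1, ht.2]
        · left
          refine ⟨1 - ρ, (hS _).2 ⟨mem_closedBall_two_add (a := 1.5) (b := 1) (by norm_num) ?_ ?_
            (by norm_num), h0'⟩, by simp⟩
          · rw [abs_le]; norm_num; constructor <;> linarith
          · rw [abs_le]; simp only [sub_im, one_im]; constructor <;> linarith [ht.1, ht.2]
    have h1 := htW _ hmem
    have h2 : |t - e * ρ.im| = |e * t - ρ.im| := by
      rcases he with rfl | rfl
      · rw [one_mul, one_mul]
      · rw [← abs_neg]; congr 1; ring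
    rw [h2] at h1
    exact absurd h1 (not_le.2 hlt)
  have htpos : 0 < t := by linarith [ht.1]
  have hlogt : Real.log t ≤ 2 * Real.log T := by
    refine le_trans (Real.log_le_log htpos ht.2) ?_
    exact log_add_le_two_mul_log hT le_rfl (by linarith)
  have hright : ∀ e : ℝ, e = 1 ∨ e = -1 → ∀ σ ∈ Icc (1 / 2 : ℝ) (3 / 2),
      riemannZeta (σ + (e * t : ℝ) * I) ≠ 0 ∧
      ‖logDeriv riemannZeta (σ + (e * t : ℝ) * I)‖ ≤
        (2 * C * 3 + 2 * C * (2 * (4 * C + 2))) * Real.log T ^ 2 := by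
    intro e he σ hσ
    have heabs : |e * t| = t := by
      rcases he with rfl | rfl
      · rw [one_mul, abs_of_pos htpos]
      · rw [abs_mul, abs_neg, abs_one, one_mul, abs_of_pos htpos]
    have hsim : (σ + (e * t : ℝ) * I : ℂ).im = e * t := by simp
    have hne : riemannZeta (σ + (e * t : ℝ) * I) ≠ 0 := by
      intro h0
      have him : (σ + (e * t : ℝ) * I : ℂ).im ≠ 0 := by
        rw [hsim, ← abs_pos, heabs]; exact htpos
      have := hgap e he _ h0 him
      rw [hsim, sub_self, abs_zero] at this
      linarith
    refine ⟨hne, ?_⟩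
    obtain ⟨S₁, hS₁, hSim₁, hSc₁, hld⟩ := h (e * t) (by rw [heabs]; linarith [ht.1])
    rw [heabs] at hSc₁ hld
    have h1 := hld (σ + (e * t : ℝ) * I) (mem_closedBall_two_add (a := 1.5) (b := 0) (by norm_num)
      (by simp; rw [abs_le]; norm_num; constructor <;> linarith [hσ.1, hσ.2]) (by simp)
      (by norm_num)) hne
    have h2 : ‖∑ ρ ∈ S₁, (analyticOrderNatAt riemannZeta ρ : ℂ) / (σ + (e * t : ℝ) * I - ρ)‖ ≤
        C * Real.log t * (1 / η) := by
      refine (norm_sum_le _ _).trans ?_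
      refine le_trans ?_ (mul_le_mul_of_nonneg_right hSc₁ (by positivity))
      rw [Nat.cast_sum, Finset.sum_mul]
      refine Finset.sum_le_sum fun ρ hρ => ?_
      rw [norm_div, norm_natCast, div_eq_mul_one_div]
      have h3 : η ≤ ‖(σ + (e * t : ℝ) * I : ℂ) - ρ‖ := by
        refine (hgap e he ρ ((hS₁ ρ).1 hρ).2 (hSim₁ ρ hρ)).trans ?_
        have := abs_im_le_norm ((σ + (e * t : ℝ) * I : ℂ) - ρ)
        rwa [sub_im, hsim] at this
      gcongr
    have h3 := norm_add_le (logDeriv riemannZeta (σ + (e * t : ℝ) * I) -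
      ∑ ρ ∈ S₁, (analyticOrderNatAt riemannZeta ρ : ℂ) / (σ + (e * t : ℝ) * I - ρ))
      (∑ ρ ∈ S₁, (analyticOrderNatAt riemannZeta ρ : ℂ) / (σ + (e * t : ℝ) * I - ρ))
    rw [sub_add_cancel] at h3
    have h4 : C * Real.log t ≤ 2 * C * Real.log T := by nlinarith
    have h5 : C * Real.log t * (1 / η) ≤
        2 * C * Real.log T * (2 * (4 * C + 2) * Real.log T) := by gcongr
    have h6 : 2 * C * Real.log T ≤ 2 * C * 3 * Real.log T ^ 2 := by
      nlinarith [mul_pos hC (show 0 < Real.log T by linarith)]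
    nlinarith
  refine ⟨t, ht, fun σ hσ => ?_⟩
  by_cases hσ2 : 1 / 2 ≤ σ
  · have := hright 1 (Or.inl rfl) σ ⟨hσ2, hσ.2⟩
    rw [one_mul] at this
    refine ⟨this.1, this.2.trans ?_⟩
    nlinarith [sq_nonneg (Real.log T)]
  -- Left of the critical line the functional equation transfers the bound from `1 - s`, whose
  -- height is `-t`.
  · have h1 := hright (-1) (Or.inr rfl) (1 - σ) ⟨by linarith, by linarith [hσ.1]⟩
    have e1 : (((1 - σ : ℝ) : ℂ) + ((-1 * t : ℝ) : ℂ) * I) = 1 - (σ + t * I) := by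
      push_cast; ring
    rw [e1] at h1
    have him : (σ + t * I : ℂ).im ≠ 0 := by simpa using htpos.ne'
    have hne : riemannZeta (σ + t * I) ≠ 0 := fun h0 =>
      h1.1 ((riemannZeta_one_sub_eq_zero_iff him).2 h0)
    refine ⟨hne, ?_⟩
    have h2 := logDeriv_riemannZeta_add_one_sub him hne
    rw [← eq_sub_iff_add_eq] at h2
    rw [h2]
    refine (norm_sub_le _ _).trans ?_
    have h3 := norm_zetaReflection_le (s := σ + t * I) (by simpa using hσ.1)
      (by simpa using hσ.2) (by simp; rw [abs_of_pos htpos]; linarith [ht.1])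
    have h4 : |(σ + t * I : ℂ).im| = t := by simp [abs_of_pos htpos]
    rw [h4] at h3
    nlinarith [h1.2]

/-! ### The Dirichlet series of `-ζ'/ζ` -/

open Set Filter Topology MeasureTheory Metric ArithmeticFunction

/-- `∑ Λ(n) n^{-a}` -/
noncomputable def vonMangoldtSeries (a : ℝ) : ℝ := ∑' n : ℕ, vonMangoldt n * (n : ℝ) ^ (-a)

theorem hasSum_vonMangoldt_cpow {s : ℂ} (hs : 1 < s.re) :
    HasSum (fun n : ℕ => (vonMangoldt n : ℂ) * (n : ℂ) ^ (-s)) (-logDeriv riemannZeta s) := by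
  have h := (LSeriesSummable_vonMangoldt hs).hasSum
  have h2 := LSeries_vonMangoldt_eq_deriv_riemannZeta_div hs
  rw [LSeries] at h2
  rw [h2] at h
  rw [logDeriv_apply, ← neg_div]
  convert! h using 2 with n
  rw [LSeries.term_def₀ (by simp)]

theorem norm_vonMangoldt_cpow (n : ℕ) (s : ℂ) :
    ‖(vonMangoldt n : ℂ) * (n : ℂ) ^ (-s)‖ = vonMangoldt n * (n : ℝ) ^ (-s.re) := by
  rw [norm_mul, norm_real, Real.norm_of_nonneg vonMangoldt_nonneg]
  rcases Nat.eq_zero_or_pos n with rfl | hn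
  · simp
  · rw [norm_natCast_cpow_of_pos hn, neg_re]

theorem summable_vonMangoldt_rpow {a : ℝ} (ha : 1 < a) :
    Summable fun n : ℕ => vonMangoldt n * (n : ℝ) ^ (-a) := by
  have h := (hasSum_vonMangoldt_cpow (s := a) (by simpa using ha)).summable.norm
  refine h.congr fun n => ?_
  rw [norm_vonMangoldt_cpow, ofReal_re]

theorem norm_logDeriv_riemannZeta_le {s : ℂ} (hs : 1 < s.re) :
    ‖logDeriv riemannZeta s‖ ≤ vonMangoldtSeries s.re := by
  rw [← norm_neg, ← (hasSum_vonMangoldt_cpow hs).tsum_eq, vonMangoldtSeries]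
  have e : ∀ n : ℕ, ‖(vonMangoldt n : ℂ) * (n : ℂ) ^ (-s)‖ = vonMangoldt n * (n : ℝ) ^ (-s.re) :=
    fun n => norm_vonMangoldt_cpow n s
  refine (norm_tsum_le_tsum_norm ?_).trans (le_of_eq ?_)
  · simpa only [e] using summable_vonMangoldt_rpow hs
  · simp only [e]

theorem vonMangoldtSeries_nonneg (a : ℝ) : 0 ≤ vonMangoldtSeries a :=
  tsum_nonneg fun _ => mul_nonneg vonMangoldt_nonneg (by positivity)

/-- The pole of `ζ` at `1` is simple: `(s - 1)ζ(s)`, which is `LFunctionTrivChar₁ 1`, has a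
continuous logarithmic derivative on `[1, 2]`, so `-ζ'/ζ(a) - 1/(a - 1)` is bounded there. -/
theorem exists_vonMangoldtSeries_le : ∃ C : ℝ, 0 < C ∧ ∀ a : ℝ, 1 < a → a ≤ 2 →
    vonMangoldtSeries a ≤ C / (a - 1) := by
  have hcont : ContinuousOn (fun a : ℝ => ‖-deriv (DirichletCharacter.LFunctionTrivChar₁ 1) a /
      DirichletCharacter.LFunctionTrivChar₁ 1 a‖) (Icc 1 2) := by
    refine ContinuousOn.norm ?_
    refine (DirichletCharacter.continuousOn_neg_logDeriv_LFunctionTrivChar₁ 1).comp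
      continuous_ofReal.continuousOn fun a ha => ?_
    by_cases h : a = 1
    · left; rw [h]; simp
    · right
      rw [show DirichletCharacter.LFunctionTrivChar 1 = riemannZeta from
        DirichletCharacter.LFunction_modOne_eq]
      exact riemannZeta_ne_zero_of_one_le_re (by simpa using ha.1)
  obtain ⟨B, hB⟩ := (isCompact_Icc.image_of_continuousOn hcont).bddAbove
  have hB0 : 0 ≤ B := (norm_nonneg _).trans (hB ⟨1, by norm_num, rfl⟩)
  refine ⟨1 + B, by linarith, fun a h1 h2 => ?_⟩
  have hb := hB ⟨a, ⟨h1.le, h2⟩, rfl⟩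
  simp only at hb
  have hne : (a : ℂ) ≠ 1 := by exact_mod_cast h1.ne'
  have hz : riemannZeta a ≠ 0 := riemannZeta_ne_zero_of_one_le_re (by simpa using h1.le)
  have hsub : (a : ℂ) - 1 ≠ 0 := sub_ne_zero.2 hne
  have e1 : DirichletCharacter.LFunctionTrivChar 1 = riemannZeta :=
    DirichletCharacter.LFunction_modOne_eq
  rw [DirichletCharacter.deriv_LFunctionTrivChar₁_apply_of_ne_one _ hne,
    DirichletCharacter.LFunctionTrivChar₁, Function.update_of_ne hne, e1] at hb
  have e2 : -((a - 1) * deriv riemannZeta a + riemannZeta a) / ((a - 1) * riemannZeta a) =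
      -logDeriv riemannZeta a - 1 / (a - 1) := by
    rw [logDeriv_apply]; field_simp; ring
  have hs := hasSum_vonMangoldt_cpow (s := a) (by simpa using h1)
  have e3 : (vonMangoldtSeries a : ℂ) = -logDeriv riemannZeta a := by
    rw [← hs.tsum_eq, vonMangoldtSeries, ofReal_tsum]
    congr 1
    ext n
    rw [ofReal_mul, ofReal_cpow (Nat.cast_nonneg n)]
    simp
  have hb2 : ‖-logDeriv riemannZeta a - 1 / ((a : ℂ) - 1)‖ ≤ B := by
    rw [← e2]
    convert! hb using 3
  rw [← e3] at hb2
  have h3 := norm_add_le ((vonMangoldtSeries a : ℂ) - 1 / ((a : ℂ) - 1)) (1 / ((a : ℂ) - 1))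
  rw [sub_add_cancel, norm_real, Real.norm_of_nonneg (vonMangoldtSeries_nonneg a)] at h3
  have h4 : ‖1 / ((a : ℂ) - 1)‖ = 1 / (a - 1) := by
    rw [norm_div, norm_one]
    have : (a : ℂ) - 1 = ((a - 1 : ℝ) : ℂ) := by push_cast; ring
    rw [this, norm_real, Real.norm_of_nonneg (by linarith)]
  rw [h4] at h3
  have h5 : B ≤ B / (a - 1) := by
    rw [le_div_iff₀ (by linarith)]
    nlinarith
  rw [add_div]
  linarith

/-! ### The weight and oscillatory integrals on vertical lines -/

/-- The weight `(i (1/2 - s))^{-iτ}`. -/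
noncomputable def zetaWeight (τ : ℝ) (s : ℂ) : ℂ := (I * (1 / 2 - s)) ^ (-(I * (τ : ℂ)))

theorem zetaWeight_line (τ σ t : ℝ) :
    zetaWeight τ (σ + t * I) = ((t : ℂ) + (1 / 2 - σ : ℝ) * I) ^ (-(I * (τ : ℂ))) := by
  rw [zetaWeight]
  congr 1
  push_cast
  linear_combination (-t : ℂ) * I_sq

theorem weight_base_mem_slitPlane {s : ℂ} (h : 0 < s.im) : I * (1 / 2 - s) ∈ slitPlane :=
  Or.inl (by simpa using h)

theorem differentiableAt_zetaWeight (τ : ℝ) {s : ℂ} (h : 0 < s.im) :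
    DifferentiableAt ℂ (zetaWeight τ) s := by
  have := weight_base_mem_slitPlane h
  unfold zetaWeight
  fun_prop (disch := assumption)

/-- The modulus is `exp(τ arg z)`, and `arg z ≤ tan (arg z) = Im z / Re z` when `Im z ≥ 0`. -/
theorem norm_cpow_neg_I_mul_le {z : ℂ} {τ b x : ℝ} (hτ : 0 ≤ τ) (hb : 0 ≤ b) (hx : 0 < x)
    (hre : x ≤ z.re) (him : z.im ≤ b) : ‖z ^ (-(I * (τ : ℂ)))‖ ≤ Real.exp (τ * b / x) := by
  have hzre : 0 < z.re := by linarith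
  have hz : z ≠ 0 := fun h => by rw [h] at hzre; simp at hzre
  rw [norm_cpow_of_ne_zero hz]
  have e1 : (-(I * (τ : ℂ))).re = 0 := by simp
  have e2 : (-(I * (τ : ℂ))).im = -τ := by simp
  rw [e1, e2, Real.rpow_zero, one_div, ← Real.exp_neg]
  apply Real.exp_le_exp.2
  rw [mul_neg, neg_neg, mul_comm, mul_div_assoc]
  refine mul_le_mul_of_nonneg_left ?_ hτ
  rcases le_or_gt 0 z.im with h | h
  · have ha0 : 0 ≤ arg z := arg_nonneg_iff.2 h
    have ha1 : arg z < Real.pi / 2 := by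
      have := abs_arg_lt_pi_div_two_iff.2 (Or.inl hzre)
      exact (abs_lt.1 this).2
    have h3 := Real.le_tan ha0 ha1
    rw [tan_arg] at h3
    refine h3.trans ?_
    gcongr
  · exact (arg_neg_iff.2 h).le.trans (by positivity)

theorem norm_zetaWeight_le {s : ℂ} {τ b x : ℝ} (hτ : 0 ≤ τ) (hb : 0 ≤ b) (hx : 0 < x)
    (him : x ≤ s.im) (hre : 1 / 2 - b ≤ s.re) : ‖zetaWeight τ s‖ ≤ Real.exp (τ * b / x) :=
  norm_cpow_neg_I_mul_le hτ hb hx (by simpa using him) (by simp; linarith)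

/-- First derivative test for the oscillatory integral of `e^{iLt} (t + ib)^{-iτ}`. -/
theorem norm_integral_exp_mul_cpow_le {L τ b x y l H : ℝ} (hx : 0 < x) (hxy : x ≤ y)
    (hτ : 0 ≤ τ) (hl : 0 < l)
    (hphase : ∀ t ∈ Icc x y, l ≤ ‖(L : ℂ) - τ / (t + b * I)‖)
    (hH : ∀ t ∈ Icc x y, ‖((t : ℂ) + b * I) ^ (-(I * (τ : ℂ)))‖ ≤ H) :
    ‖∫ t in x..y, exp (I * L * t) * ((t : ℂ) + b * I) ^ (-(I * (τ : ℂ)))‖ ≤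
      H * (2 / l + τ * (y - x) / (x ^ 2 * l ^ 2)) := by
  set h : ℝ → ℂ := fun t => exp (I * L * t) * ((t : ℂ) + b * I) ^ (-(I * (τ : ℂ))) with hh
  set P : ℝ → ℂ := fun t => (L : ℂ) - τ / (t + b * I) with hP
  have hbase : ∀ t ∈ Icc x y, (t : ℂ) + b * I ∈ slitPlane := fun t ht =>
    Or.inl (by simpa using hx.trans_le ht.1)
  have hbase0 : ∀ t ∈ Icc x y, (t : ℂ) + b * I ≠ 0 := fun t ht => slitPlane_ne_zero (hbase t ht)
  have hP0 : ∀ t ∈ Icc x y, P t ≠ 0 := fun t ht => norm_pos_iff.1 (hl.trans_le (hphase t ht))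
  have hnormh : ∀ t ∈ Icc x y, ‖h t‖ ≤ H := by
    intro t ht
    have e : ‖exp (I * L * t)‖ = 1 := by
      rw [norm_exp]; simp
    rw [hh, norm_mul, e, one_mul]
    exact hH t ht
  have hder_h : ∀ t ∈ Icc x y, HasDerivAt h (I * P t * h t) t := by
    intro t ht
    have h1 : HasDerivAt (fun z : ℂ => exp (I * L * z)) (exp (I * L * t) * (I * L)) (t : ℂ) := by
      simpa using ((hasDerivAt_id (t : ℂ)).const_mul (I * L)).cexp
    have h2 := ((hasDerivAt_id (t : ℂ)).add_const ((b : ℂ) * I)).cpow_const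
      (c := -(I * (τ : ℂ))) (hbase t ht)
    have h3 := (h1.mul h2).comp_ofReal
    refine h3.congr_deriv ?_
    have h4 : ((t : ℂ) + b * I) ^ (-(I * (τ : ℂ)) - 1) =
        ((t : ℂ) + b * I) ^ (-(I * (τ : ℂ))) / (t + b * I) := by
      rw [cpow_sub _ _ (hbase0 t ht), cpow_one]
    simp only [id, hh, hP, h4]
    have := hbase0 t ht
    field_simp
    ring
  have hder_P : ∀ t ∈ Icc x y, HasDerivAt P (τ / ((t : ℂ) + b * I) ^ 2) t := by
    intro t ht
    have h1 := ((((hasDerivAt_id (t : ℂ)).add_const ((b : ℂ) * I)).inv (hbase0 t ht)).const_mul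
      (τ : ℂ)).const_sub (L : ℂ)
    have h2 := h1.comp_ofReal
    have h3 : P = fun t : ℝ => (L : ℂ) - τ * ((t : ℂ) + b * I)⁻¹ := by
      ext t; rw [hP]; simp only [div_eq_mul_inv]
    rw [h3]
    refine h2.congr_deriv ?_
    simp only [id]
    ring
  set q : ℝ → ℂ := fun t => h t * (τ / ((t : ℂ) + b * I) ^ 2) / (I * P t ^ 2) with hq
  -- Integration by parts: as `h' = iPh`, the quotient `h/(iP)` is a primitive of `h` up to `q =
  -- hP'/(iP²)`, and `|q| ≤ Hτ/(x²l²)`.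
  have hder : ∀ t ∈ uIcc x y, HasDerivAt (fun t => h t / (I * P t)) (h t - q t) t := by
    intro t ht
    rw [uIcc_of_le hxy] at ht
    refine ((hder_h t ht).fun_div ((hder_P t ht).const_mul I) (mul_ne_zero I_ne_zero
      (hP0 t ht))).congr_deriv ?_
    rw [hq]
    have := hP0 t ht
    have := hbase0 t ht
    field_simp
  have hch : ContinuousOn h (uIcc x y) := fun t ht => by
    rw [uIcc_of_le hxy] at ht
    exact (hder_h t ht).continuousAt.continuousWithinAt
  have hcP : ContinuousOn P (uIcc x y) := fun t ht => by
    rw [uIcc_of_le hxy] at ht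
    exact (hder_P t ht).continuousAt.continuousWithinAt
  have hcq : ContinuousOn q (uIcc x y) := by
    have hmem : ∀ t ∈ uIcc x y, t ∈ Icc x y := fun t ht => by rwa [uIcc_of_le hxy] at ht
    refine (hch.mul (continuousOn_const.div (by fun_prop) fun t ht =>
      pow_ne_zero 2 (hbase0 t (hmem t ht)))).div (continuousOn_const.mul (hcP.pow 2)) fun t ht =>
        mul_ne_zero I_ne_zero (pow_ne_zero 2 (hP0 t (hmem t ht)))
  have hint := intervalIntegral.integral_eq_sub_of_hasDerivAt hder
    (hch.sub hcq).intervalIntegrable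
  rw [intervalIntegral.integral_sub hch.intervalIntegrable hcq.intervalIntegrable,
    sub_eq_iff_eq_add] at hint
  have hH0 : 0 ≤ H := (norm_nonneg _).trans (hH x ⟨le_rfl, hxy⟩)
  have hbd : ∀ t ∈ Icc x y, ‖h t / (I * P t)‖ ≤ H / l := by
    intro t ht
    rw [norm_div, norm_mul I, norm_I, one_mul]
    have h1 := hnormh t ht
    have h2 := hphase t ht
    gcongr
  have hqbd : ∀ t ∈ Set.uIoc x y, ‖q t‖ ≤ H * (τ / x ^ 2) / l ^ 2 := by
    intro t ht
    rw [uIoc_of_le hxy] at ht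
    have ht' : t ∈ Icc x y := ⟨ht.1.le, ht.2⟩
    rw [show q t = h t * (τ / ((t : ℂ) + b * I) ^ 2) / (I * P t ^ 2) from rfl, norm_div,
      norm_mul (h t), norm_mul I, norm_I, one_mul, norm_div, norm_pow, norm_pow, norm_real,
      Real.norm_of_nonneg hτ]
    have h1 := hnormh t ht'
    have h2 : l ≤ ‖P t‖ := hphase t ht'
    have h3 : x ≤ ‖(t : ℂ) + b * I‖ := by
      have := abs_re_le_norm ((t : ℂ) + b * I)
      simp at this
      exact ht'.1.trans ((le_abs_self t).trans this)
    gcongr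
  have hqint := intervalIntegral.norm_integral_le_of_norm_le_const hqbd
  rw [abs_of_nonneg (by linarith)] at hqint
  rw [hint]
  refine (norm_add_le _ _).trans ?_
  have h1 := (norm_sub_le (h y / (I * P y)) (h x / (I * P x))).trans
    (add_le_add (hbd y ⟨hxy, le_rfl⟩) (hbd x ⟨le_rfl, hxy⟩))
  have e : H * (2 / l + τ * (y - x) / (x ^ 2 * l ^ 2)) =
      H / l + H / l + H * (τ / x ^ 2) / l ^ 2 * (y - x) := by
    field_simp; ring
  rw [e]
  exact add_le_add h1 hqint

/-- Termwise integration of the Dirichlet series of `-ζ'/ζ` along a vertical segment. -/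
theorem hasSum_integral_vonMangoldt {a e x y : ℝ} (ha : 1 < a)
    {g : ℝ → ℂ} (hg : ContinuousOn g (uIcc x y)) :
    HasSum (fun n : ℕ => (vonMangoldt n : ℂ) *
        ∫ t in x..y, (n : ℂ) ^ (-((a : ℂ) + (e * t : ℝ) * I)) * g t)
      (∫ t in x..y, -logDeriv riemannZeta ((a : ℂ) + (e * t : ℝ) * I) * g t) := by
  obtain ⟨B, hB⟩ := (isCompact_uIcc.image_of_continuousOn hg.norm).bddAbove
  have hre : ∀ t : ℝ, ((a : ℂ) + (e * t : ℝ) * I).re = a := fun t => by simp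
  have hnorm : ∀ (n : ℕ) (t : ℝ), ‖(vonMangoldt n : ℂ) *
      (n : ℂ) ^ (-((a : ℂ) + (e * t : ℝ) * I))‖ = vonMangoldt n * (n : ℝ) ^ (-a) := by
    intro n t
    rw [norm_vonMangoldt_cpow, hre]
  simp only [← intervalIntegral.integral_const_mul]
  refine intervalIntegral.hasSum_integral_of_dominated_convergence
    (fun n _ => vonMangoldt n * (n : ℝ) ^ (-a) * B) (fun n => ?_) (fun n => ?_) ?_ ?_ ?_
  · rcases Nat.eq_zero_or_pos n with rfl | hn
    · simp only [ArithmeticFunction.map_zero, ofReal_zero, zero_mul]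
      exact aestronglyMeasurable_const
    · refine ContinuousOn.aestronglyMeasurable ?_ measurableSet_uIoc
      refine continuousOn_const.mul (ContinuousOn.mul (Continuous.continuousOn ?_)
        (hg.mono uIoc_subset_uIcc))
      refine Continuous.const_cpow (by fun_prop) (Or.inl ?_)
      exact_mod_cast hn.ne'
  · refine Eventually.of_forall fun t ht => ?_
    rw [← mul_assoc, norm_mul, hnorm]
    refine mul_le_mul_of_nonneg_left (hB ⟨t, uIoc_subset_uIcc ht, rfl⟩) ?_
    exact mul_nonneg vonMangoldt_nonneg (by positivity)
  · exact Eventually.of_forall fun t _ => (summable_vonMangoldt_rpow ha).mul_right B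
  · exact intervalIntegrable_const
  · refine Eventually.of_forall fun t _ => ?_
    have := (hasSum_vonMangoldt_cpow (s := (a : ℂ) + (e * t : ℝ) * I)
      (by rw [hre]; exact ha)).mul_right (g t)
    simpa only [mul_assoc] using this

/-! ### The explicit formula for the sum over zeros -/

theorem zeroSum_eq_sum (x y τ : ℝ) : zeroSum x y τ =
    ∑ ρ ∈ (nontrivialZerosBetween_finite x y).toFinset,
      (analyticOrderNatAt riemannZeta ρ : ℂ) * zetaWeight τ ρ :=
  finsum_mem_eq_finite_toFinset_sum _ (nontrivialZerosBetween_finite x y)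

theorem zeroSum_add {a b c : ℝ} (τ : ℝ) (hab : a ≤ b) (hbc : b ≤ c) :
    zeroSum a b τ + zeroSum b c τ = zeroSum a c τ := by
  have hu : nontrivialZerosBetween a c =
      nontrivialZerosBetween a b ∪ nontrivialZerosBetween b c := by
    ext ρ
    constructor
    · rintro ⟨h1, h2, h3, h4⟩
      rcases lt_or_ge ρ.im b with h | h
      · exact Or.inl ⟨h1, h2, h3, h⟩
      · exact Or.inr ⟨h1, h2, h, h4⟩
    · rintro (⟨h1, h2, h3, h4⟩ | ⟨h1, h2, h3, h4⟩)
      · exact ⟨h1, h2, h3, h4.trans_le hbc⟩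
      · exact ⟨h1, h2, hab.trans h3, h4⟩
  have hd : Disjoint (nontrivialZerosBetween a b) (nontrivialZerosBetween b c) :=
    Set.disjoint_left.2 fun ρ h1 h2 => absurd h1.2.2.2 (not_lt.2 h2.2.2.1)
  unfold zeroSum
  rw [hu, finsum_mem_union hd (nontrivialZerosBetween_finite a b)
    (nontrivialZerosBetween_finite b c)]

/-- Since `Re ρ ≥ 0`, the weight at each zero is at most `e^{τ/(2T)}`. This pays for shifting the
ends of the range to good heights. -/
theorem exists_norm_zeroSum_le : ∃ C : ℝ, 0 < C ∧ ∀ T v τ : ℝ, 2 ≤ T → v ≤ T + 1 →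
    0 ≤ τ → ‖zeroSum T v τ‖ ≤ Real.exp (τ / (2 * T)) * (C * Real.log T) := by
  obtain ⟨C, hC, h⟩ := exists_zeta_zero_count
  refine ⟨C, hC, fun T v τ hT hvT hτ => ?_⟩
  have hsub : (nontrivialZerosBetween_finite T v).toFinset ⊆
      (nontrivialZerosBetween_finite T (T + 1)).toFinset := by
    intro ρ hρ
    rw [Set.Finite.mem_toFinset] at hρ ⊢
    exact ⟨hρ.1, hρ.2.1, hρ.2.2.1, hρ.2.2.2.trans_le hvT⟩
  rw [zeroSum_eq_sum]
  calc _ ≤ ∑ ρ ∈ (nontrivialZerosBetween_finite T v).toFinset,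
        (analyticOrderNatAt riemannZeta ρ : ℝ) * Real.exp (τ / (2 * T)) := by
        refine norm_sum_le_of_le _ fun ρ hρ => ?_
        rw [Set.Finite.mem_toFinset] at hρ
        rw [norm_mul, norm_natCast]
        refine mul_le_mul_of_nonneg_left ?_ (Nat.cast_nonneg _)
        have h1 := norm_zetaWeight_le (s := ρ) (b := 1 / 2) hτ (by norm_num)
          (by linarith : 0 < T) hρ.2.2.1 (by
            have := (re_mem_Icc_of_nontrivial_zero hρ.1 hρ.2.1).1
            linarith)
        refine h1.trans (le_of_eq ?_)
        congr 1
        field_simp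
    _ ≤ ∑ ρ ∈ (nontrivialZerosBetween_finite T (T + 1)).toFinset,
        (analyticOrderNatAt riemannZeta ρ : ℝ) * Real.exp (τ / (2 * T)) :=
        Finset.sum_le_sum_of_subset_of_nonneg hsub fun _ _ _ => by positivity
    _ ≤ _ := by
        rw [← Finset.sum_mul, mul_comm]
        refine mul_le_mul_of_nonneg_left ?_ (Real.exp_nonneg _)
        have := h T hT
        push_cast at this
        exact this

/-- With `a > 1` all non-real zeros lie strictly between the vertical sides. As no zero has ordinate
`y`, the half-open range of ordinates and the closed rectangle select the same zeros. -/
theorem zeroSum_eq_rectIntegral {a x y : ℝ} (τ : ℝ) (hx : 0 < x) (hxy : x < y) (ha : 1 < a)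
    (ha2 : a ≤ 3 / 2)
    (h1 : ∀ σ ∈ Icc (-(1 / 2) : ℝ) (3 / 2), riemannZeta (σ + x * I) ≠ 0)
    (h2 : ∀ σ ∈ Icc (-(1 / 2) : ℝ) (3 / 2), riemannZeta (σ + y * I) ≠ 0) :
    rectIntegral (fun z => zetaWeight τ z * logDeriv riemannZeta z) (1 - a) a x y =
      2 * Real.pi * I * zeroSum x y τ := by
  have him : ∀ z : ℂ, z ∈ Icc (1 - a) a ×ℂ Icc x y → 0 < z.im := fun z hz =>
    hx.trans_le hz.2.1
  have e : ∀ z : ℂ, ((z.re : ℂ) + z.im * I) = z := re_add_im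
  rw [zeroSum_eq_sum]
  refine rectIntegral_mul_logDeriv (U := {z : ℂ | 0 < z.im}) (by linarith) hxy
    (isOpen_lt continuous_const continuous_im) him
    (fun z hz => (differentiableAt_zetaWeight τ hz).differentiableWithinAt)
    (fun z hz => analyticAt_riemannZeta_of_im_ne_zero (ne_of_gt hz)) _ ?_ ?_ ?_
  · intro z
    rw [Set.Finite.mem_toFinset]
    constructor
    · rintro ⟨hz, him, hzx, hzy⟩
      have := re_mem_Icc_of_nontrivial_zero hz him
      exact ⟨⟨⟨by linarith [this.1], by linarith [this.2]⟩, hzx, hzy.le⟩, hz⟩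
    · rintro ⟨hz, h0⟩
      refine ⟨h0, (him z hz).ne', hz.2.1, lt_of_le_of_ne hz.2.2 fun hy => ?_⟩
      refine h2 z.re ⟨by linarith [hz.1.1], by linarith [hz.1.2]⟩ ?_
      rw [← hy, e, h0]
  · rintro z (⟨hre, h | h⟩ | ⟨h | h, hz⟩) h0
    · exact h1 z.re ⟨by linarith [hre.1], by linarith [hre.2]⟩ (by rw [← h, e, h0])
    · exact h2 z.re ⟨by linarith [hre.1], by linarith [hre.2]⟩ (by rw [← h, e, h0])
    · have := re_mem_Icc_of_nontrivial_zero h0 (by linarith [hz.1] : 0 < z.im).ne'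
      linarith [this.1]
    · exact riemannZeta_ne_zero_of_one_le_re (by linarith) h0
  · intro z hz
    rw [Set.Finite.mem_toFinset] at hz
    exact analyticOrderAt_riemannZeta_ne_top hz.2.1

theorem vonMangoldt_eq_zero_of_lt_two {n : ℕ} (hn : n < 2) : vonMangoldt n = 0 := by
  interval_cases n
  · exact ArithmeticFunction.map_zero
  · exact vonMangoldt_apply_one

theorem natCast_cpow_line {n : ℕ} (hn : n ≠ 0) (a e t : ℝ) :
    (n : ℂ) ^ (-((a : ℂ) + (e * t : ℝ) * I)) =
      ((n : ℝ) ^ (-a) : ℝ) * exp (I * (-e * Real.log n : ℝ) * t) := by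
  have hn' : (n : ℂ) ≠ 0 := by exact_mod_cast hn
  rw [ofReal_cpow (Nat.cast_nonneg n), ofReal_natCast, cpow_def_of_ne_zero hn',
    cpow_def_of_ne_zero hn', ← exp_add, ← natCast_log]
  congr 1
  push_cast
  ring

theorem continuousOn_zetaWeight_line (τ σ : ℝ) {x y : ℝ} (hx : 0 < x) (hxy : x ≤ y) :
    ContinuousOn (fun t : ℝ => zetaWeight τ (σ + t * I)) (uIcc x y) := by
  intro t ht
  rw [uIcc_of_le hxy] at ht
  have := differentiableAt_zetaWeight τ (s := (σ : ℂ) + t * I)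
    (by simpa using hx.trans_le ht.1)
  refine ContinuousAt.continuousWithinAt ?_
  exact ContinuousAt.comp (f := fun t : ℝ => (σ : ℂ) + t * I) this.continuousAt (by fun_prop)

theorem norm_integral_cpow_mul_zetaWeight_le {n : ℕ} (hn : n ≠ 0) {a e σ x y τ l H : ℝ}
    (hx : 0 < x) (hxy : x ≤ y) (hτ : 0 ≤ τ) (hl : 0 < l)
    (hphase : ∀ t ∈ Icc x y, l ≤ ‖((-e * Real.log n : ℝ) : ℂ) - τ / (t + (1 / 2 - σ : ℝ) * I)‖)
    (hH : ∀ t ∈ Icc x y, ‖zetaWeight τ (σ + t * I)‖ ≤ H) :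
    ‖∫ t in x..y, (n : ℂ) ^ (-((a : ℂ) + (e * t : ℝ) * I)) * zetaWeight τ (σ + t * I)‖ ≤
      (n : ℝ) ^ (-a) * (H * (2 / l + τ * (y - x) / (x ^ 2 * l ^ 2))) := by
  simp only [natCast_cpow_line hn, zetaWeight_line, mul_assoc] at hH ⊢
  rw [intervalIntegral.integral_const_mul, norm_mul, norm_real,
    Real.norm_of_nonneg (by positivity)]
  refine mul_le_mul_of_nonneg_left ?_ (by positivity)
  have := norm_integral_exp_mul_cpow_le hx hxy hτ hl hphase hH
  simpa only [mul_assoc] using this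

/-- On the line `Re s = a` the phases have no stationary points. -/
theorem norm_integral_logDeriv_right_le {a x y τ : ℝ} (hx : 0 < x) (hxy : x ≤ y) (hτ : 0 ≤ τ)
    (ha : 1 < a) :
    ‖∫ t in x..y, zetaWeight τ (a + t * I) * logDeriv riemannZeta (a + t * I)‖ ≤
      vonMangoldtSeries a * (2 / Real.log 2 + τ * (y - x) / (x ^ 2 * Real.log 2 ^ 2)) := by
  have h := hasSum_integral_vonMangoldt (e := 1) ha (continuousOn_zetaWeight_line τ a hx hxy)
  have hl2 : 0 < Real.log 2 := Real.log_pos (by norm_num)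
  have e1 : ∫ t in x..y, zetaWeight τ (a + t * I) * logDeriv riemannZeta (a + t * I) =
      -∫ t in x..y, -logDeriv riemannZeta ((a : ℂ) + (1 * t : ℝ) * I) *
        zetaWeight τ (a + t * I) := by
    rw [← intervalIntegral.integral_neg]
    congr 1
    ext t
    simp only [one_mul]
    ring
  rw [e1, norm_neg, ← h.tsum_eq, vonMangoldtSeries, ← tsum_mul_right]
  refine tsum_of_norm_bounded ((summable_vonMangoldt_rpow ha).mul_right _).hasSum fun n => ?_
  rcases lt_or_ge n 2 with hn | hn
  · simp [vonMangoldt_eq_zero_of_lt_two hn]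
  rw [norm_mul, norm_real, Real.norm_of_nonneg vonMangoldt_nonneg, mul_assoc]
  refine mul_le_mul_of_nonneg_left ?_ vonMangoldt_nonneg
  -- `H = 1`, since right of the critical line the base of the weight has negative imaginary part.
  -- Both parts of the phase derivative, `-log n` and `-τ/t`, have the same sign, so `l = log 2`
  -- works for all `n ≥ 2`.
  have h2 := norm_integral_cpow_mul_zetaWeight_le (n := n) (by omega) (a := a) (e := 1) (σ := a)
    (H := 1) hx hxy hτ hl2 (fun t ht => ?_) (fun t ht => ?_)
  · rwa [one_mul] at h2
  · have ht0 : 0 < t := hx.trans_le ht.1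
    have hlog : Real.log 2 ≤ Real.log n :=
      Real.log_le_log (by norm_num) (by exact_mod_cast hn)
    refine le_trans ?_ (abs_re_le_norm _)
    have hre : (((-1 * Real.log n : ℝ) : ℂ) - τ / (t + (1 / 2 - a : ℝ) * I)).re =
        -Real.log n - τ * t / normSq (t + (1 / 2 - a : ℝ) * I) := by
      rw [sub_re, ofReal_re, div_re]
      simp
    rw [hre]
    have : 0 ≤ τ * t / normSq (t + (1 / 2 - a : ℝ) * I) :=
      div_nonneg (by positivity) (normSq_nonneg _)
    rw [abs_of_nonpos (by linarith)]
    linarith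
  · have := norm_zetaWeight_le (s := (a : ℂ) + t * I) (b := 0) (x := x) hτ le_rfl hx
      (by simpa using ht.1) (by simp; linarith)
    simpa using this

theorem norm_integral_sub_integral_le {f : ℝ → ℂ} {x y x' y' M : ℝ} (h1 : x ≤ x') (h2 : x' ≤ y')
    (h3 : y ≤ y') (h4 : x ≤ y) (hf : ContinuousOn f (Icc x y')) (hM : ∀ t ∈ Icc x y', ‖f t‖ ≤ M) :
    ‖(∫ t in x'..y', f t) - ∫ t in x..y, f t‖ ≤ M * ((x' - x) + (y' - y)) := by
  have hi : ∀ u v, u ∈ Icc x y' → v ∈ Icc x y' → IntervalIntegrable f volume u v := fun u v hu hv =>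
    (hf.mono (uIcc_subset_Icc hu hv)).intervalIntegrable
  have hx : x ∈ Icc x y' := ⟨le_rfl, h1.trans h2⟩
  have hx' : x' ∈ Icc x y' := ⟨h1, h2⟩
  have hy : y ∈ Icc x y' := ⟨h4, h3⟩
  have hy' : y' ∈ Icc x y' := ⟨h1.trans h2, le_rfl⟩
  have e1 := intervalIntegral.integral_add_adjacent_intervals (hi x x' hx hx') (hi x' y' hx' hy')
  have e2 := intervalIntegral.integral_add_adjacent_intervals (hi x y hx hy) (hi y y' hy hy')
  have e3 : (∫ t in x'..y', f t) - ∫ t in x..y, f t =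
      (∫ t in y..y', f t) - ∫ t in x..x', f t := by
    linear_combination e1 - e2
  have b : ∀ u v, u ∈ Icc x y' → v ∈ Icc x y' → u ≤ v → ‖∫ t in u..v, f t‖ ≤ M * (v - u) := by
    intro u v hu hv huv
    have := intervalIntegral.norm_integral_le_of_norm_le_const (f := f) (a := u) (b := v) (C := M)
      fun t ht => hM t (uIcc_subset_Icc hu hv (uIoc_subset_uIcc ht))
    rwa [abs_of_nonneg (by linarith)] at this
  rw [e3]
  refine (norm_sub_le _ _).trans ?_
  linarith [b _ _ hx hx' h1, b _ _ hy hy' h3]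

/-- Moving the integral of the reflection term from `Re s = 1 - a` to the critical line. -/
theorem norm_integral_zetaReflection_add_le {a x y τ : ℝ} (hx : 2 ≤ x) (hxy : x ≤ y) (hτ : 0 ≤ τ)
    (ha : 1 < a) (ha2 : a ≤ 3 / 2) :
    ‖(∫ t in x..y, zetaWeight τ ((1 - a : ℝ) + t * I) * zetaReflection ((1 - a : ℝ) + t * I)) +
      2 * Real.pi * mainIntegral x y τ‖ ≤
      50 * Real.exp (τ * (a - 1 / 2) / x) * Real.log y + 17 * (y - x) / x := by
  set G : ℂ → ℂ := fun s => zetaWeight τ s * zetaReflection s with hG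
  set E := Real.exp (τ * (a - 1 / 2) / x) with hE
  have hx0 : 0 < x := by linarith
  have hdiff : ∀ s : ℂ, 0 < s.im → DifferentiableAt ℂ G s := fun s hs =>
    (differentiableAt_zetaWeight τ hs).mul (differentiableAt_zetaReflection hs.ne')
  -- The reflection term has no singularities off the real axis, so the contour may be moved to the
  -- critical line, where the weight is `t^{-iτ}` of modulus one.
  have hrect : rectIntegral G (1 - a) (1 / 2) x y = 0 :=
    rectIntegral_eq_zero (by linarith) hxy fun s hs =>
      (hdiff s (hx0.trans_le hs.2.1)).differentiableWithinAt
  have hlogy : 0 ≤ Real.log y := Real.log_nonneg (by linarith)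
  have hhor : ∀ v ∈ Icc x y, ‖∫ u in (1 - a : ℝ)..(1 / 2), G (u + v * I)‖ ≤
      25 * E * Real.log y := by
    intro v hv
    have hb : ∀ u ∈ Set.uIoc (1 - a : ℝ) (1 / 2), ‖G (u + v * I)‖ ≤ 25 * E * Real.log y := by
      intro u hu
      rw [uIoc_of_le (by linarith)] at hu
      have h1 := norm_zetaWeight_le (s := (u : ℂ) + v * I) (b := a - 1 / 2) (x := x) hτ
        (by linarith) hx0 (by simpa using hv.1) (by simp; linarith [hu.1])
      have h2 := norm_zetaReflection_le (s := (u : ℂ) + v * I) (by simp; linarith [hu.1])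
        (by simp; linarith [hu.2]) (by
          simp
          exact (hx.trans hv.1).trans (le_abs_self v))
      have h3 : Real.log |((u : ℂ) + v * I).im| ≤ Real.log y := by
        simp only [add_im, ofReal_im, mul_im, ofReal_re, I_im, I_re, mul_zero, mul_one, zero_add,
          add_zero]
        have : 0 < v := by linarith [hv.1]
        rw [abs_of_pos this]
        exact Real.log_le_log this hv.2
      rw [hG]
      simp only [norm_mul]
      calc _ ≤ E * (25 * Real.log y) := by
            refine mul_le_mul h1 (h2.trans (by linarith)) (norm_nonneg _) (Real.exp_nonneg _)
        _ = _ := by ring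
    have := intervalIntegral.norm_integral_le_of_norm_le_const hb
    refine this.trans ?_
    rw [abs_of_nonneg (by linarith)]
    have h0 : 0 ≤ 25 * E * Real.log y := by positivity
    nlinarith
  have hcrit : ‖(∫ t in x..y, G ((1 / 2 : ℝ) + t * I)) + 2 * Real.pi * mainIntegral x y τ‖ ≤
      17 / x * (y - x) := by
    have hpi : (Real.pi : ℂ) ≠ 0 := by exact_mod_cast Real.pi_ne_zero
    have hc1 : ContinuousOn (fun t : ℝ => G ((1 / 2 : ℝ) + t * I)) (uIcc x y) := by
      intro t ht
      rw [uIcc_of_le hxy] at ht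
      refine ContinuousAt.continuousWithinAt ?_
      exact ContinuousAt.comp (f := fun t : ℝ => ((1 / 2 : ℝ) : ℂ) + t * I)
        (hdiff _ (by simpa using hx0.trans_le ht.1)).continuousAt (by fun_prop)
    have hc2 : ContinuousOn (fun t : ℝ => 2 * (Real.pi : ℂ) *
        ((t : ℂ) ^ (-(I * (τ : ℂ))) / (2 * (Real.pi : ℂ)) *
        (Real.log (t / (2 * Real.pi)) : ℂ))) (uIcc x y) := by
      intro t ht
      rw [uIcc_of_le hxy] at ht
      have ht0 : 0 < t := hx0.trans_le ht.1
      refine ContinuousAt.continuousWithinAt ?_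
      have h1 : ContinuousAt (fun t : ℝ => (t : ℂ) ^ (-(I * (τ : ℂ)))) t :=
        ContinuousAt.cpow (by fun_prop) (by fun_prop) (Or.inl (by simpa using ht0))
      have h2 : ContinuousAt (fun t : ℝ => Real.log (t / (2 * Real.pi))) t :=
        ContinuousAt.log (by fun_prop) (by positivity)
      fun_prop
    rw [mainIntegral, ← intervalIntegral.integral_const_mul,
      ← intervalIntegral.integral_add hc1.intervalIntegrable hc2.intervalIntegrable]
    have := intervalIntegral.norm_integral_le_of_norm_le_const (a := x) (b := y) (C := 17 / x)
      (f := fun t : ℝ => G ((1 / 2 : ℝ) + t * I) + 2 * (Real.pi : ℂ) *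
        ((t : ℂ) ^ (-(I * (τ : ℂ))) / (2 * (Real.pi : ℂ)) *
        (Real.log (t / (2 * Real.pi)) : ℂ))) ?_
    · rwa [abs_of_nonneg (by linarith)] at this
    · intro t ht
      rw [uIoc_of_le hxy] at ht
      have ht0 : 0 < t := hx0.trans ht.1
      have e : G ((1 / 2 : ℝ) + t * I) + 2 * (Real.pi : ℂ) *
          ((t : ℂ) ^ (-(I * (τ : ℂ))) / (2 * (Real.pi : ℂ)) * (Real.log (t / (2 * Real.pi)) : ℂ)) =
          (t : ℂ) ^ (-(I * (τ : ℂ))) * (zetaReflection (1 / 2 + t * I) +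
            Real.log (t / (2 * Real.pi))) := by
        rw [hG]
        simp only [zetaWeight_line]
        push_cast
        simp only [sub_self, zero_mul, add_zero]
        field_simp
      rw [e, norm_mul, norm_cpow_eq_rpow_re_of_pos ht0]
      simp only [neg_re, mul_re, I_re, ofReal_re, I_im, ofReal_im, zero_mul, mul_zero, sub_self,
        neg_zero, Real.rpow_zero, one_mul]
      refine (norm_zetaReflection_half_add_log_le (by linarith [ht.1])).trans ?_
      gcongr
      exact ht.1.le
  rw [rectIntegral] at hrect
  have e1 : (∫ t in x..y, G ((1 - a : ℝ) + t * I)) = (∫ t in x..y, G ((1 / 2 : ℝ) + t * I)) -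
      I * ((∫ u in (1 - a : ℝ)..(1 / 2), G (u + x * I)) -
        ∫ u in (1 - a : ℝ)..(1 / 2), G (u + y * I)) := by
    push_cast at hrect ⊢
    linear_combination (I) * hrect + ((∫ t in x..y, G (1 - a + t * I)) -
      (∫ t in x..y, G (1 / 2 + t * I))) * I_sq
  change ‖(∫ t in x..y, G ((1 - a : ℝ) + t * I)) + _‖ ≤ _
  rw [e1, sub_add_eq_add_sub]
  refine (norm_sub_le _ _).trans ?_
  rw [norm_mul, norm_I, one_mul]
  have h4 := norm_sub_le (∫ u in (1 - a : ℝ)..(1 / 2), G (u + x * I))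
    (∫ u in (1 - a : ℝ)..(1 / 2), G (u + y * I))
  have h5 := hhor x ⟨le_rfl, hxy⟩
  have h6 := hhor y ⟨hxy, le_rfl⟩
  have h7 : 17 * (y - x) / x = 17 / x * (y - x) := by ring
  linarith

/-- The upper height is sought in `[y + 1, y + 2]` and not in `[y, y + 1]`, so that `x' < y'` even
when `y - x` is small. The two sums over zeros differ by three windows of length at most one. -/
theorem exists_good_rectangle : ∃ C : ℝ, 0 < C ∧ ∀ x y τ : ℝ, 2 ≤ x → x < y → 0 ≤ τ →
    ∃ x' ∈ Icc x (x + 1), ∃ y' ∈ Icc (y + 1) (y + 2),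
      (∀ v, v = x' ∨ v = y' → ∀ σ ∈ Icc (-(1 / 2) : ℝ) (3 / 2), riemannZeta (σ + v * I) ≠ 0 ∧
        ‖logDeriv riemannZeta (σ + v * I)‖ ≤ C * Real.log y ^ 2) ∧
      ‖zeroSum x y τ - zeroSum x' y' τ‖ ≤ C * Real.exp (τ / (2 * x)) * Real.log y := by
  obtain ⟨C1, hC1, h1⟩ := exists_good_height
  obtain ⟨C2, hC2, h2⟩ := exists_norm_zeroSum_le
  refine ⟨4 * C1 + 6 * C2, by positivity, fun x y τ hx hxy hτ => ?_⟩
  obtain ⟨x', hx', hgx⟩ := h1 x hx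
  obtain ⟨y', hy', hgy⟩ := h1 (y + 1) (by linarith)
  have hlogy : 0 ≤ Real.log y := Real.log_nonneg (by linarith)
  have hlogx : 0 ≤ Real.log x := Real.log_nonneg (by linarith)
  have hlxy : Real.log x ≤ Real.log y := Real.log_le_log (by linarith) hxy.le
  have hly1 : Real.log (y + 1) ≤ 2 * Real.log y :=
    log_add_le_two_mul_log (by linarith) le_rfl (by linarith)
  have hly0 : 0 ≤ Real.log (y + 1) := Real.log_nonneg (by linarith)
  refine ⟨x', hx', y', ⟨hy'.1, by linarith [hy'.2]⟩, ?_, ?_⟩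
  · rintro v (rfl | rfl) σ hσ
    · refine ⟨(hgx σ hσ).1, (hgx σ hσ).2.trans ?_⟩
      have : Real.log x ^ 2 ≤ Real.log y ^ 2 := by gcongr
      nlinarith [sq_nonneg (Real.log y), mul_nonneg hC1.le (sq_nonneg (Real.log y)),
        mul_nonneg hC2.le (sq_nonneg (Real.log y))]
    · refine ⟨(hgy σ hσ).1, (hgy σ hσ).2.trans ?_⟩
      have : Real.log (y + 1) ^ 2 ≤ (2 * Real.log y) ^ 2 := by gcongr
      nlinarith [mul_nonneg hC2.le (sq_nonneg (Real.log y))]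
  · have e1 := zeroSum_add τ hx'.1 (by linarith [hx'.2, hy'.1] : x' ≤ y')
    have e2 := zeroSum_add τ hxy.le (by linarith [hy'.1] : y ≤ y')
    have e3 := zeroSum_add τ (by linarith : y ≤ y + 1) hy'.1
    have e : zeroSum x y τ - zeroSum x' y' τ =
        zeroSum x x' τ - (zeroSum y (y + 1) τ + zeroSum (y + 1) y' τ) := by
      linear_combination e2 - e1 + e3
    have hb : ∀ T v : ℝ, x ≤ T → T ≤ y + 1 → v ≤ T + 1 →
        ‖zeroSum T v τ‖ ≤ 2 * C2 * (Real.exp (τ / (2 * x)) * Real.log y) := by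
      intro T v hT hTy hv
      refine (h2 T v τ (hx.trans hT) hv hτ).trans ?_
      have l1 : Real.log T ≤ 2 * Real.log y := (Real.log_le_log (by linarith) hTy).trans hly1
      have l2 : Real.exp (τ / (2 * T)) ≤ Real.exp (τ / (2 * x)) := by gcongr
      calc _ ≤ Real.exp (τ / (2 * x)) * (C2 * (2 * Real.log y)) := by
            have : 0 ≤ Real.log T := Real.log_nonneg (by linarith)
            gcongr
        _ = _ := by ring
    rw [e]
    have t1 := norm_sub_le (zeroSum x x' τ) (zeroSum y (y + 1) τ + zeroSum (y + 1) y' τ)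
    have t2 := norm_add_le (zeroSum y (y + 1) τ) (zeroSum (y + 1) y' τ)
    have t3 := hb x x' le_rfl (by linarith) hx'.2
    have t4 := hb y (y + 1) hxy.le (by linarith) le_rfl
    have t5 := hb (y + 1) y' (by linarith) le_rfl hy'.2
    have : 0 ≤ Real.exp (τ / (2 * x)) * Real.log y := by positivity
    nlinarith

theorem norm_mainIntegrand_le {t τ : ℝ} (ht : 1 ≤ t) :
    ‖(t : ℂ) ^ (-(I * (τ : ℂ))) / (2 * (Real.pi : ℂ)) * (Real.log (t / (2 * Real.pi)) : ℂ)‖ ≤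
      Real.log t + 2 := by
  have ht0 : 0 < t := by linarith
  have hpi := Real.pi_gt_three
  have hl0 := Real.log_nonneg ht
  rw [norm_mul, norm_div, norm_cpow_eq_rpow_re_of_pos ht0, norm_real, Real.norm_eq_abs, norm_mul,
    norm_real, Real.norm_of_nonneg Real.pi_pos.le]
  simp only [neg_re, mul_re, I_re, ofReal_re, I_im, ofReal_im, zero_mul, mul_zero, sub_self,
      neg_zero, Real.rpow_zero, norm_ofNat]
  have h2 : Real.log (2 * Real.pi) ≤ 2 := by
    rw [Real.log_le_iff_le_exp (by positivity)]
    have := Real.pi_lt_d2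
    have e : Real.exp 2 = Real.exp 1 * Real.exp 1 := by rw [← Real.exp_add]; norm_num
    have := Real.exp_one_gt_d9
    rw [e]
    nlinarith
  have h3 : 0 ≤ Real.log (2 * Real.pi) := Real.log_nonneg (by linarith)
  rw [Real.log_div (by positivity) (by positivity)]
  have h4 : |Real.log t - Real.log (2 * Real.pi)| ≤ Real.log t + 2 := by
    rw [abs_le]; constructor <;> linarith
  have h5 : 1 / (2 * Real.pi) ≤ 1 := by
    rw [div_le_one (by positivity)]; linarith
  calc _ ≤ 1 * (Real.log t + 2) := by gcongr
    _ = _ := one_mul _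

theorem norm_mainIntegral_sub_le {x y x' y' τ : ℝ} (hx : 2 ≤ x) (h1 : x ≤ x') (h2 : x' ≤ y')
    (h3 : y ≤ y') (h4 : x ≤ y) :
    ‖mainIntegral x' y' τ - mainIntegral x y τ‖ ≤
      (Real.log y' + 2) * ((x' - x) + (y' - y)) := by
  refine norm_integral_sub_integral_le h1 h2 h3 h4 (fun t ht => ?_) fun t ht => ?_
  · have ht0 : 0 < t := by linarith [ht.1]
    refine ContinuousAt.continuousWithinAt ?_
    have h1 : ContinuousAt (fun t : ℝ => (t : ℂ) ^ (-(I * (τ : ℂ)))) t :=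
      ContinuousAt.cpow (by fun_prop) (by fun_prop) (Or.inl (by simpa using ht0))
    have h2 : ContinuousAt (fun t : ℝ => Real.log (t / (2 * Real.pi))) t :=
      ContinuousAt.log (by fun_prop) (by have := Real.pi_pos; positivity)
    have hpi : (2 * (Real.pi : ℂ)) ≠ 0 := by
      have : (Real.pi : ℂ) ≠ 0 := by exact_mod_cast Real.pi_ne_zero
      simp [this]
    fun_prop (disch := assumption)
  · refine (norm_mainIntegrand_le (by linarith [ht.1])).trans ?_
    have := Real.log_le_log (by linarith [ht.1]) ht.2
    linarith

theorem continuousAt_zetaWeight_line (τ σ : ℝ) {t : ℝ} (ht : 0 < t) :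
    ContinuousAt (fun t : ℝ => zetaWeight τ (σ + t * I)) t :=
  ContinuousAt.comp (f := fun t : ℝ => (σ : ℂ) + t * I)
    (differentiableAt_zetaWeight τ (by simpa using ht)).continuousAt (by fun_prop)

theorem continuousAt_logDeriv_zeta_line {a t : ℝ} (ha : 1 < a) (ht : 0 < t) :
    ContinuousAt (fun t : ℝ => logDeriv riemannZeta ((a : ℂ) + (-1 * t : ℝ) * I)) t := by
  have hne : ((a : ℂ) + (-1 * t : ℝ) * I).im ≠ 0 := by simpa using ht.ne'
  have han := analyticAt_riemannZeta_of_im_ne_zero hne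
  have hz : riemannZeta ((a : ℂ) + (-1 * t : ℝ) * I) ≠ 0 :=
    riemannZeta_ne_zero_of_one_le_re (by simpa using ha.le)
  exact ContinuousAt.comp (f := fun t : ℝ => (a : ℂ) + (-1 * t : ℝ) * I)
    (han.deriv.continuousAt.div han.continuousAt hz) (by fun_prop)

theorem continuousAt_zetaReflection_line (σ : ℝ) {t : ℝ} (ht : 0 < t) :
    ContinuousAt (fun t : ℝ => zetaReflection (σ + t * I)) t :=
  ContinuousAt.comp (f := fun t : ℝ => (σ : ℂ) + t * I)
    (differentiableAt_zetaReflection (by simpa using ht.ne')).continuousAt (by fun_prop)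

/-- The functional equation on `Re s = 1 - a`: there `1 - s = a - it` lies in the half-plane of
absolute convergence, whence the coefficient `-1` of `t`. -/
theorem integral_logDeriv_left_eq {a x y : ℝ} (τ : ℝ) (hx : 0 < x) (hxy : x ≤ y) (ha : 1 < a) :
    ∫ t in x..y, zetaWeight τ ((1 - a : ℝ) + t * I) * logDeriv riemannZeta ((1 - a : ℝ) + t * I) =
      (∫ t in x..y, zetaWeight τ ((1 - a : ℝ) + t * I) * zetaReflection ((1 - a : ℝ) + t * I)) -
        ∫ t in x..y, logDeriv riemannZeta ((a : ℂ) + (-1 * t : ℝ) * I) *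
          zetaWeight τ ((1 - a : ℝ) + t * I) := by
  have hpos : ∀ t ∈ uIcc x y, 0 < t := fun t ht => by
    rw [uIcc_of_le hxy] at ht
    exact hx.trans_le ht.1
  rw [← intervalIntegral.integral_sub]
  · refine intervalIntegral.integral_congr fun t ht => ?_
    have ht0 := hpos t ht
    have him : ((1 - a : ℝ) + t * I : ℂ).im ≠ 0 := by simpa using ht0.ne'
    have h0 : riemannZeta ((1 - a : ℝ) + t * I) ≠ 0 := fun h0 => by
      have := (re_mem_Icc_of_nontrivial_zero h0 him).1
      simp at this
      linarith
    have h1 := logDeriv_riemannZeta_add_one_sub him h0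
    have e : (1 : ℂ) - ((1 - a : ℝ) + t * I) = (a : ℂ) + (-1 * t : ℝ) * I := by
      push_cast; ring
    rw [e] at h1
    rw [← h1]
    ring
  · exact ContinuousOn.intervalIntegrable fun t ht =>
      ((continuousAt_zetaWeight_line τ (1 - a) (hpos t ht)).mul
        (continuousAt_zetaReflection_line (1 - a) (hpos t ht))).continuousWithinAt
  · exact ContinuousOn.intervalIntegrable fun t ht =>
      ((continuousAt_logDeriv_zeta_line ha (hpos t ht)).mul
        (continuousAt_zetaWeight_line τ (1 - a) (hpos t ht))).continuousWithinAt

/-- The explicit formula on a rectangle with good horizontal sides, all error terms explicit. -/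
theorem norm_rect_formula_le {a x y x' y' τ M : ℝ} (hx : 2 ≤ x) (hxy : x ≤ y) (hx' : x ≤ x')
    (hy' : y ≤ y') (hxy' : x' < y') (hτ : 0 ≤ τ) (ha1 : 1 < a) (ha2 : a ≤ 3 / 2) (hM : 0 ≤ M)
    (hg : ∀ v, v = x' ∨ v = y' → ∀ σ ∈ Icc (-(1 / 2) : ℝ) (3 / 2), riemannZeta (σ + v * I) ≠ 0 ∧
        ‖logDeriv riemannZeta (σ + v * I)‖ ≤ M) :
    ‖2 * Real.pi * zeroSum x' y' τ - 2 * Real.pi * mainIntegral x y τ +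
      ∑' n : ℕ, (vonMangoldt n : ℂ) * ∫ t in x..y, (n : ℂ) ^ (-((a : ℂ) + (-1 * t : ℝ) * I)) *
        zetaWeight τ ((1 - a : ℝ) + t * I)‖ ≤
      4 * (Real.exp (τ * (a - 1 / 2) / x) * M) +
      vonMangoldtSeries a * (2 / Real.log 2 + τ * (y' - x') / (x' ^ 2 * Real.log 2 ^ 2)) +
      (50 * Real.exp (τ * (a - 1 / 2) / x') * Real.log y' + 17 * (y' - x') / x') +
      7 * ((Real.log y' + 2) * ((x' - x) + (y' - y))) +
      vonMangoldtSeries a * Real.exp (τ * (a - 1 / 2) / x) * ((x' - x) + (y' - y)) := by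
  have hx0 : 0 < x := by linarith
  have hx'0 : 0 < x' := by linarith
  set E := Real.exp (τ * (a - 1 / 2) / x) with hE
  have hEpos : 0 < E := Real.exp_pos _
  have hwt : ∀ s : ℂ, x ≤ s.im → 1 - a ≤ s.re → ‖zetaWeight τ s‖ ≤ E := fun s h1 h2 =>
    norm_zetaWeight_le hτ (by linarith) hx0 h1 (by linarith)
  have hrect := zeroSum_eq_rectIntegral τ hx'0 hxy' ha1 ha2
    (fun σ hσ => (hg x' (Or.inl rfl) σ hσ).1) (fun σ hσ => (hg y' (Or.inr rfl) σ hσ).1)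
  have hhor : ∀ v, v = x' ∨ v = y' →
      ‖∫ u in (1 - a)..a, zetaWeight τ (u + v * I) * logDeriv riemannZeta (u + v * I)‖ ≤
      2 * (E * M) := by
    intro v hv
    have hvx : x ≤ v := by
      rcases hv with rfl | rfl <;> linarith
    have := intervalIntegral.norm_integral_le_of_norm_le_const (a := 1 - a) (b := a)
      (f := fun u : ℝ => zetaWeight τ (u + v * I) * logDeriv riemannZeta (u + v * I))
      (C := E * M) fun u hu => by
        rw [uIoc_of_le (by linarith)] at hu
        have h1 := (hg v hv u ⟨by linarith [hu.1], by linarith [hu.2]⟩).2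
        have h2 := hwt ((u : ℂ) + v * I) (by simpa using hvx) (by simpa using hu.1.le)
        rw [norm_mul]
        exact mul_le_mul h2 h1 (norm_nonneg _) hEpos.le
    refine this.trans ?_
    rw [abs_of_nonneg (by linarith), mul_comm]
    exact mul_le_mul_of_nonneg_right (by linarith) (by positivity)
  have hright := norm_integral_logDeriv_right_le hx'0 hxy'.le hτ ha1
  have hrefl := norm_integral_zetaReflection_add_le (hx.trans hx') hxy'.le hτ ha1 ha2
  have hmain := norm_mainIntegral_sub_le (τ := τ) hx hx' hxy'.le hy' hxy
  have hfc : ContinuousOn (fun t : ℝ => logDeriv riemannZeta ((a : ℂ) + (-1 * t : ℝ) * I) *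
      zetaWeight τ ((1 - a : ℝ) + t * I)) (Icc x y') := fun t ht =>
    ((continuousAt_logDeriv_zeta_line ha1 (hx0.trans_le ht.1)).mul
      (continuousAt_zetaWeight_line τ (1 - a) (hx0.trans_le ht.1))).continuousWithinAt
  have hfb : ∀ t ∈ Icc x y', ‖logDeriv riemannZeta ((a : ℂ) + (-1 * t : ℝ) * I) *
      zetaWeight τ ((1 - a : ℝ) + t * I)‖ ≤ vonMangoldtSeries a * E := by
    intro t ht
    have h1 := norm_logDeriv_riemannZeta_le (s := (a : ℂ) + (-1 * t : ℝ) * I) (by simpa using ha1)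
    have h2 := hwt ((1 - a : ℝ) + t * I) (by simpa using ht.1) (by simp)
    have h3 : ((a : ℂ) + (-1 * t : ℝ) * I).re = a := by simp
    rw [h3] at h1
    rw [norm_mul]
    exact mul_le_mul h1 h2 (norm_nonneg _) (vonMangoldtSeries_nonneg _)
  have hshift := norm_integral_sub_integral_le hx' hxy'.le hy' hxy hfc hfb
  have hsum := (hasSum_integral_vonMangoldt (e := -1) ha1
    (continuousOn_zetaWeight_line τ (1 - a) hx0 hxy)).tsum_eq
  have hneg : ∫ t in x..y, -logDeriv riemannZeta ((a : ℂ) + (-1 * t : ℝ) * I) *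
      zetaWeight τ ((1 - a : ℝ) + t * I) =
      -∫ t in x..y, logDeriv riemannZeta ((a : ℂ) + (-1 * t : ℝ) * I) *
      zetaWeight τ ((1 - a : ℝ) + t * I) := by
    rw [← intervalIntegral.integral_neg]
    congr 1
    ext t
    simp only [neg_mul]
  rw [hsum, hneg]
  have hleft := integral_logDeriv_left_eq τ hx'0 hxy'.le ha1
  have hmain2 : ‖(2 * Real.pi : ℂ) * (mainIntegral x' y' τ - mainIntegral x y τ)‖ ≤
      7 * ((Real.log y' + 2) * ((x' - x) + (y' - y))) := by
    rw [norm_mul, norm_mul, norm_ofNat, norm_real, Real.norm_of_nonneg Real.pi_pos.le]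
    have hpi := Real.pi_lt_d2
    exact mul_le_mul (by linarith) hmain (norm_nonneg _) (by norm_num)
  rw [rectIntegral, hleft] at hrect
  generalize hH1 : (∫ u in (1 - a)..a, zetaWeight τ (u + x' * I) *
    logDeriv riemannZeta (u + x' * I)) = H1 at *
  generalize hH2 : (∫ u in (1 - a)..a, zetaWeight τ (u + y' * I) *
    logDeriv riemannZeta (u + y' * I)) = H2 at *
  generalize hR : (∫ t in x'..y', zetaWeight τ (a + t * I) *
    logDeriv riemannZeta (a + t * I)) = R at *
  generalize (∫ t in x'..y', zetaWeight τ ((1 - a : ℝ) + t * I) *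
    zetaReflection ((1 - a : ℝ) + t * I)) = J at *
  generalize (∫ t in x'..y', logDeriv riemannZeta ((a : ℂ) + (-1 * t : ℝ) * I) *
    zetaWeight τ ((1 - a : ℝ) + t * I)) = S' at *
  generalize (∫ t in x..y, logDeriv riemannZeta ((a : ℂ) + (-1 * t : ℝ) * I) *
    zetaWeight τ ((1 - a : ℝ) + t * I)) = S at *
  have hh1 := hhor x' (Or.inl rfl)
  have hh2 := hhor y' (Or.inr rfl)
  rw [hH1] at hh1
  rw [hH2] at hh2
  -- The contour identity multiplied by `i`, grouped so that each piece has a bound already: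
  -- horizontal sides, right side, reflection term against the main integral, and the two changes of
  -- range from `[x', y']` to `[x, y]`.
  have key : 2 * Real.pi * zeroSum x' y' τ - 2 * Real.pi * mainIntegral x y τ + -S =
      -I * (H1 - H2) + R - (J + 2 * Real.pi * mainIntegral x' y' τ) +
        2 * Real.pi * (mainIntegral x' y' τ - mainIntegral x y τ) + (S' - S) := by
    linear_combination (I) * hrect + (2 * Real.pi * zeroSum x' y' τ - R + J - S') * I_sq
  rw [key]
  refine (norm_add_le _ _).trans (add_le_add ((norm_add_le _ _).trans (add_le_add
    ((norm_sub_le _ _).trans (add_le_add ((norm_add_le _ _).trans (add_le_add ?_ hright)) hrefl))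
      hmain2)) hshift)
  rw [norm_mul, norm_neg, norm_I, one_mul]
  linarith [norm_sub_le H1 H2]

theorem half_le_log {x : ℝ} (hx : 2 ≤ x) : 1 / 2 ≤ Real.log x := by
  have h1 := Real.log_le_log (by norm_num) hx
  have h2 := Real.log_two_gt_d9
  linarith

theorem abscissa_mem_Ioc {x a : ℝ} (hx : 2 ≤ x) (ha : a = 1 + 1 / (4 * Real.log x)) :
    a ∈ Ioc 1 (3 / 2) := by
  have hl := half_le_log hx
  have h1 : 0 < 1 / (4 * Real.log x) := by
    have : 0 < Real.log x := by linarith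
    positivity
  have h2 : 1 / (4 * Real.log x) ≤ 1 / 2 := by
    rw [div_le_div_iff₀ (by linarith) (by norm_num)]; linarith
  exact ⟨by linarith, by linarith⟩

/-- The part `a - 1 = 1/(4 log x)` of the exponent contributes `τ/(4x log x) ≤ A/4`: moving the line
this far beyond `Re s = 0` costs only a constant factor. -/
theorem exp_abscissa_le {A x τ a : ℝ} (hx : 2 ≤ x) (hτ : τ ≤ A * x * Real.log x)
    (ha : a = 1 + 1 / (4 * Real.log x)) :
    Real.exp (τ * (a - 1 / 2) / x) ≤ Real.exp (A / 4) * Real.exp (τ / (2 * x)) := by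
  have hx0 : 0 < x := by linarith
  have hl0 : 0 < Real.log x := by linarith [half_le_log hx]
  rw [← Real.exp_add]
  apply Real.exp_le_exp.2
  rw [ha, div_add_div _ _ (by norm_num) (by positivity), div_le_div_iff₀ hx0 (by positivity)]
  have e : τ * (1 + 1 / (4 * Real.log x) - 1 / 2) * (4 * (2 * x)) =
      4 * τ * x + 2 * τ * x / Real.log x := by
    field_simp; ring
  rw [e]
  have : 2 * τ * x / Real.log x ≤ 2 * A * x * x := by
    rw [div_le_iff₀ hl0]
    have := mul_le_mul_of_nonneg_right hτ hx0.le
    linarith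
  linarith

theorem log_le_mul_log {K x y : ℝ} (hK : 1 ≤ K) (hx : 2 ≤ x) (hy : 0 < y) (hyK : y ≤ K * x) :
    Real.log y ≤ (1 + Real.log K / Real.log 2) * Real.log x := by
  have hl2 : 0 < Real.log 2 := Real.log_pos (by norm_num)
  have hlK : 0 ≤ Real.log K := Real.log_nonneg hK
  have h1 : Real.log y ≤ Real.log K + Real.log x := by
    rw [← Real.log_mul (by linarith) (by linarith)]
    exact Real.log_le_log hy hyK
  have h2 : Real.log K ≤ Real.log K / Real.log 2 * Real.log x := by
    have : Real.log 2 ≤ Real.log x := Real.log_le_log (by norm_num) hx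
    calc Real.log K = Real.log K / Real.log 2 * Real.log 2 := by field_simp
      _ ≤ _ := by gcongr
  linarith

theorem exists_vonMangoldtSeries_abscissa_le : ∃ C : ℝ, 0 < C ∧ ∀ x a : ℝ, 2 ≤ x →
    a = 1 + 1 / (4 * Real.log x) → vonMangoldtSeries a ≤ C * Real.log x := by
  obtain ⟨C, hC, h⟩ := exists_vonMangoldtSeries_le
  refine ⟨4 * C, by positivity, fun x a hx ha => ?_⟩
  obtain ⟨h1, h2⟩ := abscissa_mem_Ioc hx ha
  have hl0 : 0 < Real.log x := by linarith [half_le_log hx]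
  refine (h a h1 (by linarith)).trans (le_of_eq ?_)
  rw [ha]
  field_simp
  ring

set_option maxHeartbeats 1000000 in
/-- The sum over zeros as the main integral and an integrated Dirichlet series on
`Re s = -1 / (4 log x)`. -/
theorem exists_zeroSum_formula (K A : ℝ) : ∃ C : ℝ, 0 < C ∧ ∀ x y τ a : ℝ, 2 ≤ x → x < y →
    y ≤ K * x → 0 ≤ τ → τ ≤ A * x * Real.log x → a = 1 + 1 / (4 * Real.log x) →
    ‖2 * Real.pi * zeroSum x y τ - 2 * Real.pi * mainIntegral x y τ +
      ∑' n : ℕ, (vonMangoldt n : ℂ) * ∫ t in x..y, (n : ℂ) ^ (-((a : ℂ) + (-1 * t : ℝ) * I)) *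
        zetaWeight τ ((1 - a : ℝ) + t * I)‖ ≤ C * Real.exp (τ / (2 * x)) * Real.log x ^ 2 := by
  -- For `K ≤ 1` the range `x < y ≤ Kx` is empty, and for `A < 0` the conditions on `τ` contradict
  -- each other.
  by_cases hK : 1 < K
  swap
  · refine ⟨1, one_pos, fun x y τ a hx hxy hyK => ?_⟩
    push Not at hK
    nlinarith
  by_cases hA : 0 ≤ A
  swap
  · refine ⟨1, one_pos, fun x y τ a hx hxy hyK hτ hτA => ?_⟩
    have h1 : 0 < x * Real.log x := mul_pos (by linarith) (Real.log_pos (by linarith))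
    push Not at hA
    nlinarith
  obtain ⟨C1, hC1, hvm⟩ := exists_vonMangoldtSeries_abscissa_le
  obtain ⟨C2, hC2, hgood⟩ := exists_good_rectangle
  have hl2 : 0 < Real.log 2 := Real.log_pos (by norm_num)
  have hlK : 0 < Real.log K := Real.log_pos hK
  set κ := 1 + Real.log K / Real.log 2 with hκ
  have hκ1 : 1 ≤ κ := by
    have : 0 ≤ Real.log K / Real.log 2 := by positivity
    linarith
  set D := Real.exp (A / 4) with hD
  have hD1 : 1 ≤ D := Real.one_le_exp (by positivity)
  -- The summands are the constants of `b1` to `b6` below, in this order; lower powers of `log x`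
  -- are absorbed into `P` by means of `log x ≥ 1/2`.
  refine ⟨14 * C2 * κ + (4 * (D * (C2 * κ ^ 2)) +
    C1 * (4 / Real.log 2 + A * K / Real.log 2 ^ 2) + (200 * D * κ + 68 * K) +
    21 * (4 * κ + 8) + 6 * D * C1), by positivity, fun x y τ a hx hxy hyK hτ hτA ha => ?_⟩
  set l := Real.log x with hl
  set E0 := Real.exp (τ / (2 * x)) with hE0
  have hx0 : 0 < x := by linarith
  have hl1 : 1 / 2 ≤ l := half_le_log hx
  have hl0 : 0 < l := by linarith
  have hE1 : 1 ≤ E0 := Real.one_le_exp (by positivity)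
  obtain ⟨ha1, ha2⟩ := abscissa_mem_Ioc hx ha
  have hly : Real.log y ≤ κ * l := log_le_mul_log hK.le hx (by linarith) hyK
  have hly0 : 0 ≤ Real.log y := Real.log_nonneg (by linarith)
  have hV : vonMangoldtSeries a ≤ C1 * l := hvm x a hx ha
  have hV0 := vonMangoldtSeries_nonneg a
  obtain ⟨x', hx', y', hy', hg, hz⟩ := hgood x y τ hx hxy hτ
  have hxy' : x' < y' := by linarith [hx'.2, hy'.1]
  have hx'0 : 0 < x' := by linarith [hx'.1]
  have hlen : y' - x' ≤ K * x := by linarith [hx'.1, hy'.2]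
  have hlen0 : 0 ≤ y' - x' := by linarith
  have hED : Real.exp (τ * (a - 1 / 2) / x) ≤ D * E0 := exp_abscissa_le hx hτA ha
  have hED' : Real.exp (τ * (a - 1 / 2) / x') ≤ D * E0 := by
    refine le_trans (Real.exp_le_exp.2 ?_) hED
    have := hx'.1
    have : 0 ≤ a - 1 / 2 := by linarith
    gcongr
  have hly' : Real.log y' ≤ 2 * (κ * l) := by
    have h1 : Real.log y' ≤ Real.log (y ^ 2) :=
      Real.log_le_log (by linarith [hy'.1]) (by
        have := hy'.2
        have : y + 2 ≤ y ^ 2 := by nlinarith only [hx, hxy]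
        linarith)
    rw [Real.log_pow] at h1
    push_cast at h1
    linarith
  have hly'0 : 0 ≤ Real.log y' := Real.log_nonneg (by linarith [hy'.1])
  have hrf := norm_rect_formula_le hx hxy.le hx'.1 (by linarith [hy'.1]) hxy' hτ ha1 ha2
    (by positivity) hg
  set P := E0 * l ^ 2 with hP
  have hPl2 : l ^ 2 ≤ P := by
    rw [hP]; exact le_mul_of_one_le_left (sq_nonneg l) hE1
  have hPEl : E0 * l ≤ 2 * P := by
    rw [hP]
    have : E0 * l ≤ E0 * (2 * l ^ 2) := mul_le_mul_of_nonneg_left (by nlinarith only [hl1]) (by linarith)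
    linarith
  have hPl : l ≤ 2 * P := by
    have : l ≤ 2 * l ^ 2 := by nlinarith only [hl1]
    linarith
  have hP1 : 1 ≤ 4 * P := by
    have : 1 ≤ 4 * l ^ 2 := by nlinarith only [hl1]
    linarith
  have hP0 : 0 < P := by positivity
  have b1 : ‖2 * Real.pi * (zeroSum x y τ - zeroSum x' y' τ)‖ ≤ 14 * C2 * κ * P := by
    rw [norm_mul, norm_mul, norm_ofNat, norm_real, Real.norm_of_nonneg Real.pi_pos.le]
    have hpi := Real.pi_lt_d2
    have h1 : C2 * E0 * Real.log y ≤ C2 * κ * (2 * P) := by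
      calc _ ≤ C2 * E0 * (κ * l) := by gcongr
        _ = C2 * κ * (E0 * l) := by ring
        _ ≤ _ := by gcongr
    calc _ ≤ 7 * (C2 * κ * (2 * P)) := mul_le_mul (by linarith) (hz.trans h1) (norm_nonneg _)
          (by norm_num)
      _ = _ := by ring
  have b2 : 4 * (Real.exp (τ * (a - 1 / 2) / x) * (C2 * Real.log y ^ 2)) ≤
      4 * (D * (C2 * κ ^ 2)) * P := by
    calc _ ≤ 4 * (D * E0 * (C2 * (κ * l) ^ 2)) := by gcongr
      _ = _ := by rw [hP]; ring
  have b3 : vonMangoldtSeries a * (2 / Real.log 2 + τ * (y' - x') / (x' ^ 2 * Real.log 2 ^ 2)) ≤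
      C1 * (4 / Real.log 2 + A * K / Real.log 2 ^ 2) * P := by
    have h1 : τ * (y' - x') / (x' ^ 2 * Real.log 2 ^ 2) ≤ A * K / Real.log 2 ^ 2 * l := by
      calc _ ≤ (A * x * l) * (K * x) / (x ^ 2 * Real.log 2 ^ 2) := by
            have := hx'.1
            have : 0 ≤ A * x * l := by positivity
            gcongr
        _ = _ := by field_simp
    have h2 : 2 / Real.log 2 ≤ 4 / Real.log 2 * l := by
      have : 4 / Real.log 2 * l = 2 / Real.log 2 * (2 * l) := by ring
      rw [this]
      exact le_mul_of_one_le_right (by positivity) (by linarith)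
    calc _ ≤ C1 * l * (4 / Real.log 2 * l + A * K / Real.log 2 ^ 2 * l) := by
          gcongr
      _ = C1 * (4 / Real.log 2 + A * K / Real.log 2 ^ 2) * l ^ 2 := by ring
      _ ≤ _ := by gcongr
  have b4 : 50 * Real.exp (τ * (a - 1 / 2) / x') * Real.log y' + 17 * (y' - x') / x' ≤
      (200 * D * κ + 68 * K) * P := by
    have h1 : 17 * (y' - x') / x' ≤ 17 * K := by
      calc _ ≤ 17 * (K * x) / x := by
            have := hx'.1
            gcongr
        _ = _ := by field_simp
    calc _ ≤ 50 * (D * E0) * (2 * (κ * l)) + 17 * K * 1 := by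
          rw [mul_one]
          gcongr
      _ = 100 * D * κ * (E0 * l) + 17 * K * 1 := by ring
      _ ≤ 100 * D * κ * (2 * P) + 17 * K * (4 * P) := by gcongr
      _ = _ := by ring
  have hgap : (x' - x) + (y' - y) ≤ 3 := by linarith [hx'.2, hy'.2]
  have hgap0 : 0 ≤ (x' - x) + (y' - y) := by linarith [hx'.1, hy'.1]
  have b5 : 7 * ((Real.log y' + 2) * ((x' - x) + (y' - y))) ≤ 21 * (4 * κ + 8) * P := by
    calc _ ≤ 7 * ((2 * (κ * l) + 2 * 1) * 3) := by
          rw [mul_one]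
          gcongr
      _ = 7 * ((2 * κ * l + 2 * 1) * 3) := by ring
      _ ≤ 7 * ((2 * κ * (2 * P) + 2 * (4 * P)) * 3) := by gcongr
      _ = _ := by ring
  have b6 : vonMangoldtSeries a * Real.exp (τ * (a - 1 / 2) / x) * ((x' - x) + (y' - y)) ≤
      6 * D * C1 * P := by
    calc _ ≤ C1 * l * (D * E0) * 3 := by gcongr
      _ = 3 * D * C1 * (E0 * l) := by ring
      _ ≤ 3 * D * C1 * (2 * P) := by gcongr
      _ = _ := by ring
  have e : 2 * Real.pi * zeroSum x y τ - 2 * Real.pi * mainIntegral x y τ +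
      (∑' n : ℕ, (vonMangoldt n : ℂ) * ∫ t in x..y, (n : ℂ) ^ (-((a : ℂ) + (-1 * t : ℝ) * I)) *
        zetaWeight τ ((1 - a : ℝ) + t * I)) =
      2 * Real.pi * (zeroSum x y τ - zeroSum x' y' τ) +
      (2 * Real.pi * zeroSum x' y' τ - 2 * Real.pi * mainIntegral x y τ +
      ∑' n : ℕ, (vonMangoldt n : ℂ) * ∫ t in x..y, (n : ℂ) ^ (-((a : ℂ) + (-1 * t : ℝ) * I)) *
        zetaWeight τ ((1 - a : ℝ) + t * I)) := by ring
  rw [e, mul_assoc (14 * C2 * κ + _), ← hP]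
  refine (norm_add_le _ _).trans ?_
  rw [add_mul]
  refine add_le_add b1 (hrf.trans ?_)
  exact (add_le_add (add_le_add (add_le_add (add_le_add b2 b3) b4) b5) b6).trans
    (le_of_eq (by ring))

/-! ### Fresnel integrals -/

theorem norm_exp_neg_mul_sq_le {b : ℂ} (hb : 0 ≤ b.re) (u : ℝ) : ‖exp (-b * (u : ℂ) ^ 2)‖ ≤ 1 := by
  rw [norm_exp, Real.exp_le_one_iff]
  have : (-b * (u : ℂ) ^ 2).re = -b.re * u ^ 2 := by
    rw [← ofReal_pow, re_mul_ofReal, neg_re]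
  rw [this]
  nlinarith [mul_nonneg hb (sq_nonneg u)]

/-- Integration by parts against `1/(2bu)`; the endpoint terms and the remainder add up to the
stated bound. Only `Re b ≥ 0` enters, so the estimate is uniform up to the imaginary axis. -/
theorem norm_integral_exp_neg_mul_sq_le {b : ℂ} (hb : 0 ≤ b.re) (hb0 : b ≠ 0) {p q : ℝ}
    (hp : 0 < p) (hpq : p ≤ q) : ‖∫ u in p..q, exp (-b * (u : ℂ) ^ 2)‖ ≤ 1 / (‖b‖ * p) := by
  have hbn : 0 < ‖b‖ := norm_pos_iff.2 hb0
  have hu0 : ∀ u ∈ uIcc p q, 0 < u := fun u hu => by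
    rw [uIcc_of_le hpq] at hu
    exact hp.trans_le hu.1
  have hder : ∀ u ∈ uIcc p q, HasDerivAt
      (fun u : ℝ => -exp (-b * (u : ℂ) ^ 2) / (2 * b * u))
      (exp (-b * (u : ℂ) ^ 2) + exp (-b * (u : ℂ) ^ 2) / (2 * b * (u : ℂ) ^ 2)) u := by
    intro u hu
    have hu' : (u : ℂ) ≠ 0 := by exact_mod_cast (hu0 u hu).ne'
    have h1 : HasDerivAt (fun z : ℂ => exp (-b * z ^ 2)) (exp (-b * (u : ℂ) ^ 2) *
        (-b * (2 * u))) (u : ℂ) := by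
      simpa using (((hasDerivAt_id (u : ℂ)).pow 2).const_mul (-b)).cexp
    have h2 := (h1.fun_neg.fun_div ((hasDerivAt_id (u : ℂ)).const_mul (2 * b))
      (by simp [hb0, hu'])).comp_ofReal
    refine h2.congr_deriv ?_
    simp only [id]
    field_simp
    ring
  have hc1 : ContinuousOn (fun u : ℝ => exp (-b * (u : ℂ) ^ 2)) (uIcc p q) :=
    Continuous.continuousOn (by fun_prop)
  have hc2 : ContinuousOn (fun u : ℝ => exp (-b * (u : ℂ) ^ 2) / (2 * b * (u : ℂ) ^ 2))
      (uIcc p q) := by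
    refine hc1.div (by fun_prop) fun u hu => ?_
    have hu' : (u : ℂ) ≠ 0 := by exact_mod_cast (hu0 u hu).ne'
    simp [hb0, hu']
  have hint := intervalIntegral.integral_eq_sub_of_hasDerivAt hder
    (hc1.add hc2).intervalIntegrable
  rw [intervalIntegral.integral_add hc1.intervalIntegrable hc2.intervalIntegrable,
    ← eq_sub_iff_add_eq] at hint
  have hend : ∀ u : ℝ, 0 < u → ‖-exp (-b * (u : ℂ) ^ 2) / (2 * b * u)‖ ≤ 1 / (2 * ‖b‖) * u⁻¹ := by
    intro u hu
    rw [norm_div, norm_neg, norm_mul, norm_mul, norm_ofNat, norm_real, Real.norm_of_nonneg hu.le]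
    calc _ ≤ 1 / (2 * ‖b‖ * u) := by
          gcongr
          exact norm_exp_neg_mul_sq_le hb u
      _ = _ := by field_simp
  have hrem : ‖∫ u in p..q, exp (-b * (u : ℂ) ^ 2) / (2 * b * (u : ℂ) ^ 2)‖ ≤
      1 / (2 * ‖b‖) * (p⁻¹ - q⁻¹) := by
    have hder2 : ∀ u ∈ uIcc p q, HasDerivAt (fun u : ℝ => -(1 / (2 * ‖b‖) * u⁻¹))
        (1 / (2 * ‖b‖) * (u ^ 2)⁻¹) u := by
      intro u hu
      refine (((hasDerivAt_inv (hu0 u hu).ne').const_mul (1 / (2 * ‖b‖))).fun_neg).congr_deriv ?_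
      ring
    have hc3 : ContinuousOn (fun u : ℝ => 1 / (2 * ‖b‖) * (u ^ 2)⁻¹) (uIcc p q) := by
      refine continuousOn_const.mul (ContinuousOn.inv₀ (by fun_prop) fun u hu => ?_)
      exact pow_ne_zero 2 (hu0 u hu).ne'
    have h3 := intervalIntegral.integral_eq_sub_of_hasDerivAt hder2 hc3.intervalIntegrable
    refine (intervalIntegral.norm_integral_le_of_norm_le (g := fun u => 1 / (2 * ‖b‖) * (u ^ 2)⁻¹)
      hpq (Eventually.of_forall fun u hu => ?_) hc3.intervalIntegrable).trans (le_of_eq ?_)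
    · have hu0 : 0 < u := hp.trans hu.1
      rw [norm_div, norm_mul, norm_mul, norm_ofNat, norm_pow, norm_real,
        Real.norm_of_nonneg hu0.le]
      calc _ ≤ 1 / (2 * ‖b‖ * u ^ 2) := by
            gcongr
            exact norm_exp_neg_mul_sq_le hb u
        _ = _ := by field_simp
    · rw [h3]; ring
  rw [hint]
  have e1 := hend q (hp.trans_le hpq)
  have e2 := hend p hp
  have t1 := norm_sub_le (-exp (-b * (q : ℂ) ^ 2) / (2 * b * q) -
    -exp (-b * (p : ℂ) ^ 2) / (2 * b * p))
    (∫ u in p..q, exp (-b * (u : ℂ) ^ 2) / (2 * b * (u : ℂ) ^ 2))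
  have t2 := norm_sub_le (-exp (-b * (q : ℂ) ^ 2) / (2 * b * q))
    (-exp (-b * (p : ℂ) ^ 2) / (2 * b * p))
  have e3 : 1 / (‖b‖ * p) = 2 * (1 / (2 * ‖b‖) * p⁻¹) := by field_simp
  rw [e3]
  linarith

theorem norm_integral_exp_neg_mul_sq_sub_le_of_re_pos {b : ℂ} (hb : 0 < b.re) {p : ℝ}
    (hp : 0 < p) :
    ‖(∫ u in (0 : ℝ)..p, exp (-b * (u : ℂ) ^ 2)) - (Real.pi / b) ^ (1 / 2 : ℂ) / 2‖ ≤
      1 / (‖b‖ * p) := by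
  have hb0 : b ≠ 0 := fun h => by rw [h] at hb; simp at hb
  have hi : Integrable (fun u : ℝ => exp (-b * (u : ℂ) ^ 2)) := integrable_cexp_neg_mul_sq hb
  have hlim := intervalIntegral_tendsto_integral_Ioi 0 hi.integrableOn
    (tendsto_id : Tendsto (id : ℝ → ℝ) atTop atTop)
  rw [integral_gaussian_complex_Ioi hb] at hlim
  have hlim2 := (hlim.const_sub (∫ u in (0 : ℝ)..p, exp (-b * (u : ℂ) ^ 2))).norm
  refine le_of_tendsto hlim2 ?_
  filter_upwards [eventually_ge_atTop p] with q hq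
  have := intervalIntegral.integral_add_adjacent_intervals
    (hi.intervalIntegrable (a := 0) (b := p)) (hi.intervalIntegrable (a := p) (b := q))
  simp only [id]
  rw [← this, sub_add_cancel_left, norm_neg]
  exact norm_integral_exp_neg_mul_sq_le hb.le hb0 hp hq

/-- The Gaussian case with `b = ε - iτ/2`, and then `ε → 0+`: the tail bound does not deteriorate in
the limit. -/
theorem integral_fresnel_sub_le {τ p : ℝ} (hτ : 0 < τ) (hp : 0 < p) :
    ‖(∫ u in (0 : ℝ)..p, exp (I * τ * ((u : ℂ) ^ 2 / 2))) -
      (Real.sqrt (2 * Real.pi / τ) : ℂ) * exp (I * (Real.pi / 4)) / 2‖ ≤ 2 / (τ * p) := by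
  set b : ℝ → ℂ := fun ε => ε - I * (τ / 2) with hbdef
  have hbc : Continuous b := by fun_prop
  have hb0 : b 0 ≠ 0 := by
    intro h
    have := congrArg im h
    simp [hbdef] at this
    linarith
  have hbn : ‖b 0‖ = τ / 2 := by
    rw [hbdef]
    have : ((0 : ℝ) : ℂ) - I * (τ / 2) = -(I * (τ / 2 : ℝ)) := by push_cast; ring
    simp only
    rw [this, norm_neg, norm_mul, norm_I, norm_real, Real.norm_of_nonneg (by linarith), one_mul]
  have hpib : (Real.pi : ℂ) / b 0 = ((2 * Real.pi / τ : ℝ) : ℂ) * I := by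
    have hτ' : (τ : ℂ) ≠ 0 := by exact_mod_cast hτ.ne'
    rw [div_eq_iff hb0, hbdef]
    push_cast
    field_simp
    linear_combination (τ : ℂ) * I_sq
  have hr : 0 < 2 * Real.pi / τ := by have := Real.pi_pos; positivity
  have hcpow : ((Real.pi : ℂ) / b 0) ^ (1 / 2 : ℂ) =
      (Real.sqrt (2 * Real.pi / τ) : ℂ) * exp (I * (Real.pi / 4)) := by
    have hr' : ((2 * Real.pi / τ : ℝ) : ℂ) ≠ 0 := by exact_mod_cast hr.ne'
    rw [hpib, cpow_def_of_ne_zero (mul_ne_zero hr' I_ne_zero), log_ofReal_mul hr I_ne_zero, log_I,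
      Real.sqrt_eq_rpow, Real.rpow_def_of_pos hr, ofReal_exp, ← exp_add]
    congr 1
    push_cast
    ring
  have h1 : Tendsto (fun ε : ℝ => ‖(∫ u in (0 : ℝ)..p, exp (-b ε * (u : ℂ) ^ 2)) -
      (Real.pi / b ε) ^ (1 / 2 : ℂ) / 2‖) (𝓝[>] 0)
      (𝓝 ‖(∫ u in (0 : ℝ)..p, exp (-b 0 * (u : ℂ) ^ 2)) - (Real.pi / b 0) ^ (1 / 2 : ℂ) / 2‖) := by
    have hcont : Continuous fun ε : ℝ => ∫ u in (0 : ℝ)..p, exp (-b ε * (u : ℂ) ^ 2) := by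
      refine intervalIntegral.continuous_parametric_intervalIntegral_of_continuous' ?_ _ _
      fun_prop
    -- `π / b 0` lies on the positive imaginary axis, away from the branch cut of the square root.
    have hc2 : ContinuousAt (fun ε : ℝ => (Real.pi / b ε) ^ (1 / 2 : ℂ)) 0 := by
      refine ContinuousAt.cpow (continuousAt_const.div hbc.continuousAt hb0) continuousAt_const ?_
      rw [hpib]
      right
      rw [im_ofReal_mul, I_im, mul_one]
      exact hr.ne'
    exact ((hcont.continuousAt.sub (hc2.div_const 2)).norm).tendsto.mono_left nhdsWithin_le_nhds
  have h2 : Tendsto (fun ε : ℝ => 1 / (‖b ε‖ * p)) (𝓝[>] 0) (𝓝 (1 / (‖b 0‖ * p))) := by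
    have : ContinuousAt (fun ε : ℝ => 1 / (‖b ε‖ * p)) 0 :=
      continuousAt_const.div (hbc.continuousAt.norm.mul_const p) (by
        rw [hbn]; positivity)
    exact this.tendsto.mono_left nhdsWithin_le_nhds
  have h3 := le_of_tendsto_of_tendsto h1 h2 (by
    filter_upwards [self_mem_nhdsWithin] with ε hε
    exact norm_integral_exp_neg_mul_sq_sub_le_of_re_pos (by simpa [hbdef] using hε) hp)
  rw [hcpow, hbn] at h3
  have e1 : (fun u : ℝ => exp (-b 0 * (u : ℂ) ^ 2)) =
      fun u : ℝ => exp (I * τ * ((u : ℂ) ^ 2 / 2)) := by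
    ext u
    congr 1
    rw [hbdef]
    push_cast
    ring
  rw [e1] at h3
  refine h3.trans (le_of_eq ?_)
  field_simp

/-- Truncated Fresnel integrals. -/
theorem norm_fresnel_sub_le {τ p : ℝ} (hτ : 0 < τ) (hp : 0 ≤ p) :
    ‖(∫ u in (0 : ℝ)..p, exp (I * τ * ((u : ℂ) ^ 2 / 2))) -
      (Real.sqrt (2 * Real.pi / τ) : ℂ) * exp (I * (Real.pi / 4)) / 2‖ ≤
      6 / (Real.sqrt τ + τ * p) := by
  have hs : 0 < Real.sqrt τ := Real.sqrt_pos.2 hτ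
  have hs2 : Real.sqrt τ * Real.sqrt τ = τ := Real.mul_self_sqrt hτ.le
  -- Below the natural scale `τ^{-1/2}` the tail bound is useless; the integral is then compared
  -- with the one up to `τ^{-1/2}`, the difference being estimated trivially.
  rcases le_or_gt (Real.sqrt τ)⁻¹ p with h | h
  · have hp0 : 0 < p := (by positivity : 0 < (Real.sqrt τ)⁻¹).trans_le h
    refine (integral_fresnel_sub_le hτ hp0).trans ?_
    rw [div_le_div_iff₀ (by positivity) (by positivity)]
    have : 1 ≤ Real.sqrt τ * p := by rwa [inv_le_iff_one_le_mul₀' hs] at h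
    have h2 : Real.sqrt τ ≤ τ * p := by
      have := le_mul_of_one_le_right hs.le this
      rwa [← mul_assoc, hs2] at this
    nlinarith
  · set r := (Real.sqrt τ)⁻¹ with hr
    have hr0 : 0 < r := by positivity
    have hc : Continuous fun u : ℝ => exp (I * τ * ((u : ℂ) ^ 2 / 2)) := by fun_prop
    have h1 := integral_fresnel_sub_le hτ hr0
    have h2 := intervalIntegral.integral_add_adjacent_intervals
      (hc.intervalIntegrable 0 p) (hc.intervalIntegrable p r) (μ := volume)
    have h3 : ‖∫ u in p..r, exp (I * τ * ((u : ℂ) ^ 2 / 2))‖ ≤ 1 * |r - p| := by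
      refine intervalIntegral.norm_integral_le_of_norm_le_const fun u _ => ?_
      have e : I * τ * ((u : ℂ) ^ 2 / 2) = ((τ * (u ^ 2 / 2) : ℝ) : ℂ) * I := by push_cast; ring
      rw [e, norm_exp_ofReal_mul_I]
    rw [abs_of_pos (by linarith), one_mul] at h3
    rw [← h2] at h1
    have h4 : 2 / (τ * r) = 2 * r := by
      rw [div_eq_iff (by positivity), hr]
      field_simp
      rw [Real.sq_sqrt hτ.le]
    rw [h4] at h1
    have h5 : 3 * r ≤ 6 / (Real.sqrt τ + τ * p) := by
      rw [le_div_iff₀ (by positivity)]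
      have : τ * p ≤ Real.sqrt τ := by
        calc τ * p ≤ τ * r := by gcongr
          _ = Real.sqrt τ := by
            rw [hr, ← div_eq_mul_inv, div_eq_iff hs.ne', hs2]
      have : r * Real.sqrt τ = 1 := by rw [hr]; field_simp
      nlinarith
    have h6 := norm_sub_le ((∫ u in (0 : ℝ)..p, exp (I * τ * ((u : ℂ) ^ 2 / 2))) +
      (∫ u in p..r, exp (I * τ * ((u : ℂ) ^ 2 / 2))) -
      (Real.sqrt (2 * Real.pi / τ) : ℂ) * exp (I * (Real.pi / 4)) / 2)
      (∫ u in p..r, exp (I * τ * ((u : ℂ) ^ 2 / 2)))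
    have e7 : ∀ A B L : ℂ, A + B - L - B = A - L := fun A B L => by ring
    rw [e7] at h6
    linarith

theorem norm_fresnel_add_le {τ p : ℝ} (hτ : 0 < τ) (hp : p ≤ 0) :
    ‖(∫ u in (0 : ℝ)..p, exp (I * τ * ((u : ℂ) ^ 2 / 2))) +
      (Real.sqrt (2 * Real.pi / τ) : ℂ) * exp (I * (Real.pi / 4)) / 2‖ ≤
      6 / (Real.sqrt τ + τ * |p|) := by
  have h := norm_fresnel_sub_le hτ (neg_nonneg.2 hp)
  have e : ∫ u in (0 : ℝ)..p, exp (I * τ * ((u : ℂ) ^ 2 / 2)) =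
      -∫ u in (0 : ℝ)..(-p), exp (I * τ * ((u : ℂ) ^ 2 / 2)) := by
    have h1 := intervalIntegral.integral_comp_neg (a := 0) (b := -p)
      (fun u : ℝ => exp (I * τ * ((u : ℂ) ^ 2 / 2)))
    simp only [ofReal_neg, neg_sq, neg_neg, neg_zero] at h1
    rw [h1, intervalIntegral.integral_symm]
  rw [e, abs_of_nonpos hp, ← norm_neg]
  refine le_trans (le_of_eq ?_) h
  congr 1
  ring
-- Stationary phase for `v - 1 - log v`
theorem AnalyticAt.dslope {f : ℝ → ℝ} {a b : ℝ} (hb : AnalyticAt ℝ f b) :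
    AnalyticAt ℝ (dslope f a) b := by
  by_cases h : b = a
  · subst h
    obtain ⟨p, hp⟩ := hb
    exact hp.has_fpower_series_dslope_fslope.analyticAt
  · refine AnalyticAt.congr ?_ (dslope_eventuallyEq_slope_of_ne f h).symm
    have : slope f a = fun z => (z - a)⁻¹ * (f z - f a) := by
      ext z; rw [slope_def_field, div_eq_inv_mul]
    rw [this]
    exact ((analyticAt_id.sub analyticAt_const).inv (sub_ne_zero.2 h)).mul
      (hb.sub analyticAt_const)

/-- The phase `v - 1 - log v` is half the square of an analytic coordinate vanishing at `1`. -/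
theorem exists_phase_coordinate : ∃ w : ℝ → ℝ, (∀ v, 0 < v → AnalyticAt ℝ w v) ∧
    (∀ v, 0 < v → w v ^ 2 / 2 = v - 1 - Real.log v) ∧ (∃ h : ℝ → ℝ, (∀ v, 0 < v → 0 < h v) ∧
      (∀ v, 0 < v → AnalyticAt ℝ h v) ∧ ∀ v, w v = (v - 1) * h v) ∧ deriv w 1 = 1 := by
  set g : ℝ → ℝ := fun v => v - 1 - Real.log v with hg
  have hga : ∀ v, 0 < v → AnalyticAt ℝ g v := fun v hv =>
    (analyticAt_id.sub analyticAt_const).sub (analyticAt_log hv)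
  have hg' : ∀ v, 0 < v → HasDerivAt g ((v - 1) / v) v := fun v hv => by
    refine (((hasDerivAt_id v).sub_const 1).sub (Real.hasDerivAt_log hv.ne')).congr_deriv ?_
    field_simp
  -- Dividing twice by `v - 1` removes the double zero of the phase at `1`: `g = (v - 1)² G2` with
  -- `G2 > 0`, and the coordinate is `(v - 1) √(2 G2)`.
  set G1 := _root_.dslope g 1 with hG1
  set G2 := _root_.dslope G1 1 with hG2
  have hG1a : ∀ v, 0 < v → AnalyticAt ℝ G1 v := fun v hv => (hga v hv).dslope
  have hG2a : ∀ v, 0 < v → AnalyticAt ℝ G2 v := fun v hv => (hG1a v hv).dslope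
  have hg1 : g 1 = 0 := by simp [hg]
  have hG11 : G1 1 = 0 := by
    rw [hG1, dslope_same, (hg' 1 one_pos).deriv]; simp
  have e1 : ∀ v, g v = (v - 1) ^ 2 * G2 v := fun v => by
    have h1 := sub_smul_dslope g 1 v
    have h2 := sub_smul_dslope G1 1 v
    simp only [smul_eq_mul] at h1 h2
    rw [← hG1, hg1] at h1
    rw [← hG2, hG11] at h2
    linear_combination -h1 - (v - 1) * h2
  -- Differentiating `g = (v - 1)² G2`, cancelling `v - 1` for `v > 1` and letting `v → 1+` gives `2
  -- G2(1) - 1 = 0`.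
  have hG21 : G2 1 = 1 / 2 := by
    have hd : ∀ v, 0 < v → 0 = (v - 1) * (2 * G2 v + (v - 1) * deriv G2 v - 1 / v) := fun v hv => by
      have h1 := ((((hasDerivAt_id v).sub_const 1).pow 2).mul
        (hG2a v hv).differentiableAt.hasDerivAt)
      have h2 := h1.unique ((hg' v hv).congr_of_eventuallyEq (Eventually.of_forall fun u =>
        (by simp [e1 u])))
      simp at h2
      field_simp at h2 ⊢
      linarith
    have hc : ContinuousAt (fun v => 2 * G2 v + (v - 1) * deriv G2 v - 1 / v) 1 := by
      have h1 := (hG2a 1 one_pos).continuousAt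
      have h2 := (hG2a 1 one_pos).deriv.continuousAt
      exact ((continuousAt_const.mul h1).add ((continuousAt_id.sub continuousAt_const).mul h2)).sub
        (continuousAt_const.div continuousAt_id one_ne_zero)
    have h0 : Tendsto (fun v => 2 * G2 v + (v - 1) * deriv G2 v - 1 / v) (𝓝[>] 1) (𝓝 0) := by
      refine tendsto_const_nhds.congr' ?_
      filter_upwards [self_mem_nhdsWithin] with v hv
      have hv : (1 : ℝ) < v := hv
      have := hd v (by linarith)
      rcases mul_eq_zero.1 this.symm with h | h
      · linarith
      · exact h.symm
    have := tendsto_nhds_unique (hc.tendsto.mono_left nhdsWithin_le_nhds) h0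
    norm_num at this
    linarith
  have hpos : ∀ v, 0 < v → 0 < G2 v := fun v hv => by
    by_cases h : v = 1
    · rw [h, hG21]; norm_num
    · have h1 := Real.log_lt_sub_one_of_pos hv h
      have h2 : 0 < (v - 1) ^ 2 * G2 v := by rw [← e1 v]; simp only [hg]; linarith
      exact pos_of_mul_pos_right h2 (sq_nonneg _)
  have hha : ∀ v, 0 < v → AnalyticAt ℝ (fun v => Real.sqrt (2 * G2 v)) v := fun v hv => by
    have e : ∀ᶠ u in 𝓝 v, Real.exp (Real.log (2 * G2 u) / 2) = Real.sqrt (2 * G2 u) := by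
      filter_upwards [lt_mem_nhds hv] with u hu
      have := hpos u hu
      rw [Real.sqrt_eq_rpow, Real.rpow_def_of_pos (by positivity)]
      congr 1; ring
    refine AnalyticAt.congr ?_ e
    have h1 : AnalyticAt ℝ (fun u => 2 * G2 u) v := analyticAt_const.mul (hG2a v hv)
    have h2 : AnalyticAt ℝ (fun u => Real.log (2 * G2 u)) v :=
      (analyticAt_log (by have := hpos v hv; positivity)).comp h1
    exact (h2.div analyticAt_const two_ne_zero).rexp
  refine ⟨fun v => (v - 1) * Real.sqrt (2 * G2 v), fun v hv =>
    (analyticAt_id.sub analyticAt_const).mul (hha v hv), fun v hv => ?_,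
    ⟨fun v => Real.sqrt (2 * G2 v), fun v hv => ?_, hha, fun v => rfl⟩, ?_⟩
  · have := hpos v hv
    rw [mul_pow, Real.sq_sqrt (by positivity)]
    have := e1 v
    simp only [hg] at this
    rw [this]; ring
  · have := hpos v hv
    positivity
  · have h1 := ((hasDerivAt_id (1 : ℝ)).sub_const 1).mul
      (hha 1 one_pos).differentiableAt.hasDerivAt
    have := h1.deriv
    simp only [Pi.mul_def, id] at this
    rw [this, hG21]
    norm_num

/-- The substitution `u = w v`, with Jacobian `deriv w`, makes the phase exactly quadratic. -/
theorem integral_phase_eq {w : ℝ → ℝ} (hw : ∀ v, 0 < v → AnalyticAt ℝ w v)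
    (hw2 : ∀ v, 0 < v → w v ^ 2 / 2 = v - 1 - Real.log v) {a b τ : ℝ} (ha : 0 < a) (hab : a ≤ b) :
    ∫ v in a..b, exp (I * τ * (v - 1 - Real.log v : ℝ)) * deriv w v =
      ∫ u in w a..w b, exp (I * τ * ((u : ℂ) ^ 2 / 2)) := by
  have hpos : ∀ v ∈ uIcc a b, 0 < v := fun v hv => by
    rw [uIcc_of_le hab] at hv; exact ha.trans_le hv.1
  have h := intervalIntegral.integral_deriv_smul_comp (f := w) (f' := deriv w) (a := a) (b := b)
    (g := fun u : ℝ => exp (I * τ * ((u : ℂ) ^ 2 / 2)))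
    (fun v hv => (hw v (hpos v hv)).differentiableAt.hasDerivAt)
    (fun v hv => (hw v (hpos v hv)).deriv.continuousAt.continuousWithinAt) (by fun_prop)
  rw [← h]
  refine intervalIntegral.integral_congr fun v hv => ?_
  have e : ((w v : ℂ) ^ 2 / 2) = (v - 1 - Real.log v : ℝ) := by
    rw [← hw2 v (hpos v hv)]; push_cast; ring
  simp only [Function.comp, real_smul, e]
  ring

/-- Stationary phase for `e^{iτ(v - 1 - log v)}`. -/
theorem exists_stationary_phase {m M : ℝ} (hm : 0 < m) (hM : m ≤ M) : ∃ C : ℝ, 0 < C ∧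
    ∀ τ a b : ℝ, 0 < τ → m ≤ a → a ≤ b → b ≤ M →
      ‖(∫ v in a..b, exp (I * τ * (v - 1 - Real.log v : ℝ))) -
        (if a ≤ 1 ∧ 1 ≤ b then (Real.sqrt (2 * Real.pi / τ) : ℂ) * exp (I * (Real.pi / 4))
          else 0)‖ ≤
      C * (1 / τ + 1 / (Real.sqrt τ + τ * |a - 1|) + 1 / (Real.sqrt τ + τ * |b - 1|)) := by
  obtain ⟨w, hwa, hw2, ⟨h, hh0, hha, hwh⟩, hw1⟩ := exists_phase_coordinate
  -- `1 - w'` vanishes at the stationary point, hence is `q` times the phase derivative `(v - 1)/v`.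
  -- Replacing `dv` by `w' dv` therefore costs `O(1/τ)` after integration by parts.
  set q : ℝ → ℝ := fun v => -v * _root_.dslope (deriv w) 1 v with hq
  have hqa : ∀ v, 0 < v → AnalyticAt ℝ q v := fun v hv =>
    analyticAt_id.neg.mul (hwa v hv).deriv.dslope
  have hqw : ∀ v, 0 < v → 1 - deriv w v = (v - 1) / v * q v := fun v hv => by
    have := sub_smul_dslope (deriv w) 1 v
    rw [smul_eq_mul, hw1] at this
    rw [hq]
    field_simp
    linarith
  have hpos : ∀ v ∈ Icc m M, 0 < v := fun v hv => hm.trans_le hv.1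
  have bdd : ∀ f : ℝ → ℝ, (∀ v, 0 < v → AnalyticAt ℝ f v) → ∃ B, 0 ≤ B ∧ ∀ v ∈ Icc m M,
      |f v| ≤ B := by
    intro f hf
    obtain ⟨B, hB⟩ := isCompact_Icc.exists_bound_of_continuousOn
      (fun v hv => (hf v (hpos v hv)).continuousAt.continuousWithinAt)
    exact ⟨B, (norm_nonneg _).trans (hB m ⟨le_rfl, hM⟩), hB⟩
  obtain ⟨B1, hB10, hB1⟩ := bdd q hqa
  obtain ⟨B2, hB20, hB2⟩ := bdd (deriv q) fun v hv => (hqa v hv).deriv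
  obtain ⟨v0, hv0, hmin⟩ := isCompact_Icc.exists_isMinOn (nonempty_Icc.2 hM)
    (fun v hv => (hha v (hpos v hv)).continuousAt.continuousWithinAt : ContinuousOn h (Icc m M))
  -- A lower bound for `|w v| / |v - 1|` on `[m, M]`, capped at `1` so that the summand `√τ` can be
  -- scaled by it as well.
  set μ := min 1 (h v0) with hμ
  have hμ0 : 0 < μ := lt_min one_pos (hh0 v0 (hpos v0 hv0))
  have hμ1 : μ ≤ 1 := min_le_left _ _
  have hμh : ∀ v ∈ Icc m M, μ ≤ h v := fun v hv => (min_le_right _ _).trans (hmin hv)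
  refine ⟨2 * B1 + (M - m) * B2 + 6 / μ, ?_, fun τ a b hτ hma hab hbM => ?_⟩
  · have : 0 ≤ M - m := by linarith
    positivity
  have haI : a ∈ Icc m M := ⟨hma, hab.trans hbM⟩
  have hbI : b ∈ Icc m M := ⟨hma.trans hab, hbM⟩
  have hsub : ∀ v ∈ uIcc a b, v ∈ Icc m M := uIcc_subset_Icc haI hbI
  have ha0 := hpos a haI
  set L : ℂ := (Real.sqrt (2 * Real.pi / τ) : ℂ) * exp (I * (Real.pi / 4)) with hL
  set e : ℝ → ℂ := fun v => exp (I * τ * (v - 1 - Real.log v : ℝ)) with he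
  have hen : ∀ v, ‖e v‖ = 1 := fun v => by
    have : I * τ * (v - 1 - Real.log v : ℝ) = ((τ * (v - 1 - Real.log v) : ℝ) : ℂ) * I := by
      push_cast; ring
    rw [he]
    simp only
    rw [this, norm_exp_ofReal_mul_I]
  have heder : ∀ v ∈ uIcc a b, HasDerivAt e (e v * (I * τ * ((v - 1) / v : ℝ))) v := by
    intro v hv
    have hv0 := hpos v (hsub v hv)
    have h1 : HasDerivAt (fun v : ℝ => v - 1 - Real.log v) ((v - 1) / v) v := by
      refine (((hasDerivAt_id v).sub_const 1).sub (Real.hasDerivAt_log hv0.ne')).congr_deriv ?_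
      field_simp
    exact (h1.ofReal_comp.const_mul (I * τ)).cexp
  have hqd : ∀ v ∈ uIcc a b, HasDerivAt (fun v => (q v : ℂ)) (deriv q v : ℝ) v := fun v hv =>
    (hqa v (hpos v (hsub v hv))).differentiableAt.hasDerivAt.ofReal_comp
  have hIτ : I * (τ : ℂ) ≠ 0 := mul_ne_zero I_ne_zero (by exact_mod_cast hτ.ne')
  have hder : ∀ v ∈ uIcc a b, HasDerivAt (fun v => e v * q v / (I * τ))
      (e v * (1 - deriv w v : ℝ) + e v * (deriv q v : ℝ) / (I * τ)) v := by
    intro v hv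
    refine (((heder v hv).mul (hqd v hv)).div_const (I * τ)).congr_deriv ?_
    have hv0 : (v : ℂ) ≠ 0 := by exact_mod_cast (hpos v (hsub v hv)).ne'
    have hτ0 : (τ : ℂ) ≠ 0 := by exact_mod_cast hτ.ne'
    rw [hqw v (hpos v (hsub v hv))]
    push_cast
    field_simp
  have hce : ContinuousOn e (uIcc a b) := fun v hv =>
    (heder v hv).continuousAt.continuousWithinAt
  have hcw : ContinuousOn (fun v => ((deriv w v : ℝ) : ℂ)) (uIcc a b) := fun v hv =>
    (continuous_ofReal.continuousAt.comp
      (hwa v (hpos v (hsub v hv))).deriv.continuousAt).continuousWithinAt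
  have hcq : ContinuousOn (fun v => ((deriv q v : ℝ) : ℂ)) (uIcc a b) := fun v hv =>
    (continuous_ofReal.continuousAt.comp
      (hqa v (hpos v (hsub v hv))).deriv.continuousAt).continuousWithinAt
  have hc1 : ContinuousOn (fun v => e v * (1 - deriv w v : ℝ)) (uIcc a b) := by
    simp only [ofReal_sub, ofReal_one]
    exact hce.mul (continuousOn_const.sub hcw)
  have hc2 : ContinuousOn (fun v => e v * (deriv q v : ℝ) / (I * τ)) (uIcc a b) :=
    (hce.mul hcq).div_const _
  have hparts := intervalIntegral.integral_eq_sub_of_hasDerivAt hder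
    (hc1.add hc2).intervalIntegrable
  rw [intervalIntegral.integral_add hc1.intervalIntegrable hc2.intervalIntegrable,
    ← eq_sub_iff_add_eq] at hparts
  have hphase := integral_phase_eq hwa hw2 ha0 hab (τ := τ)
  have hsplit : ∫ v in a..b, e v = (∫ v in a..b, e v * (1 - deriv w v : ℝ)) +
      ∫ v in a..b, e v * deriv w v := by
    have hc3 : ContinuousOn (fun v => e v * (deriv w v : ℝ)) (uIcc a b) := hce.mul hcw
    rw [← intervalIntegral.integral_add hc1.intervalIntegrable hc3.intervalIntegrable]
    congr 1
    ext v
    push_cast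
    ring
  have hrem : ‖∫ v in a..b, e v * (1 - deriv w v : ℝ)‖ ≤ (2 * B1 + (M - m) * B2) * (1 / τ) := by
    have hend : ∀ v ∈ Icc m M, ‖e v * q v / (I * τ)‖ ≤ B1 / τ := fun v hv => by
      rw [norm_div, norm_mul, hen, norm_mul, norm_I, norm_real, norm_real,
        Real.norm_of_nonneg hτ.le, one_mul, one_mul]
      gcongr
      exact hB1 v hv
    have hi : ‖∫ v in a..b, e v * (deriv q v : ℝ) / (I * τ)‖ ≤ B2 / τ * |b - a| := by
      refine intervalIntegral.norm_integral_le_of_norm_le_const fun v hv => ?_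
      rw [norm_div, norm_mul, hen, norm_mul, norm_I, norm_real, norm_real,
        Real.norm_of_nonneg hτ.le, one_mul, one_mul]
      gcongr
      exact hB2 v (hsub v (uIoc_subset_uIcc hv))
    have hi2 : B2 / τ * |b - a| ≤ B2 / τ * (M - m) := by
      rw [abs_of_nonneg (by linarith)]
      gcongr
    rw [hparts]
    have t1 := norm_sub_le (e b * q b / (I * τ) - e a * q a / (I * τ))
      (∫ v in a..b, e v * (deriv q v : ℝ) / (I * τ))
    have t2 := norm_sub_le (e b * q b / (I * τ)) (e a * q a / (I * τ))
    have t3 := hend a haI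
    have t4 := hend b hbI
    have e5 : (2 * B1 + (M - m) * B2) * (1 / τ) = B1 / τ + B1 / τ + B2 / τ * (M - m) := by ring
    linarith
  set S : ℝ → ℂ := fun p => ∫ u in (0 : ℝ)..p, exp (I * τ * ((u : ℂ) ^ 2 / 2)) with hS
  have hcF : Continuous fun u : ℝ => exp (I * τ * ((u : ℂ) ^ 2 / 2)) := by fun_prop
  have hSsub : ∫ u in w a..w b, exp (I * τ * ((u : ℂ) ^ 2 / 2)) = S (w b) - S (w a) := by
    rw [hS]
    simp only
    rw [intervalIntegral.integral_interval_sub_left (hcF.intervalIntegrable _ _)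
      (hcF.intervalIntegrable _ _)]
  have hs : 0 < Real.sqrt τ := Real.sqrt_pos.2 hτ
  have hbound : ∀ v ∈ Icc m M, 6 / (Real.sqrt τ + τ * |w v|) ≤
      6 / μ * (1 / (Real.sqrt τ + τ * |v - 1|)) := fun v hv => by
    rw [div_mul_div_comm, mul_one]
    have h1 : μ * |v - 1| ≤ |w v| := by
      rw [hwh, abs_mul, mul_comm, abs_of_pos (hh0 v (hpos v hv))]
      exact mul_le_mul_of_nonneg_left (hμh v hv) (abs_nonneg _)
    have : μ * (Real.sqrt τ + τ * |v - 1|) ≤ Real.sqrt τ + τ * |w v| := by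
      have h2 : μ * Real.sqrt τ ≤ Real.sqrt τ := mul_le_of_le_one_left hs.le hμ1
      have h3 := mul_le_mul_of_nonneg_left h1 hτ.le
      linarith
    gcongr
  have hSr : ∀ v ∈ Icc m M, 1 ≤ v →
      ‖S (w v) - L / 2‖ ≤ 6 / μ * (1 / (Real.sqrt τ + τ * |v - 1|)) := fun v hv h1 => by
    have h2 : 0 ≤ w v := by
      rw [hwh]; exact mul_nonneg (by linarith) (hh0 v (hpos v hv)).le
    refine le_trans ?_ (hbound v hv)
    rw [abs_of_nonneg h2]
    exact norm_fresnel_sub_le hτ h2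
  have hSl : ∀ v ∈ Icc m M, v ≤ 1 →
      ‖S (w v) + L / 2‖ ≤ 6 / μ * (1 / (Real.sqrt τ + τ * |v - 1|)) := fun v hv h1 => by
    have h2 : w v ≤ 0 := by
      rw [hwh]; exact mul_nonpos_of_nonpos_of_nonneg (by linarith) (hh0 v (hpos v hv)).le
    exact (norm_fresnel_add_le hτ h2).trans (hbound v hv)
  have hmain : ‖S (w b) - S (w a) - (if a ≤ 1 ∧ 1 ≤ b then L else 0)‖ ≤
      6 / μ * (1 / (Real.sqrt τ + τ * |a - 1|)) + 6 / μ * (1 / (Real.sqrt τ + τ * |b - 1|)) := by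
    -- `S(w v)` is near `L/2` for `v ≥ 1` and near `-L/2` for `v ≤ 1`; the difference of the
    -- endpoint values is near `L` precisely when the stationary point lies in between.
    rcases le_or_gt a 1 with h1 | h1
    · rcases le_or_gt 1 b with h2 | h2
      · rw [if_pos ⟨h1, h2⟩]
        have t := norm_sub_le (S (w b) - L / 2) (S (w a) + L / 2)
        have e1 : S (w b) - L / 2 - (S (w a) + L / 2) = S (w b) - S (w a) - L := by ring
        rw [e1] at t
        linarith [hSr b hbI h2, hSl a haI h1]
      · rw [if_neg (fun h => absurd h.2 (not_le.2 h2))]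
        have t := norm_sub_le (S (w b) + L / 2) (S (w a) + L / 2)
        have e1 : S (w b) + L / 2 - (S (w a) + L / 2) = S (w b) - S (w a) - 0 := by ring
        rw [e1] at t
        linarith [hSl b hbI h2.le, hSl a haI h1]
    · rw [if_neg (fun h => absurd h.1 (not_le.2 h1))]
      have t := norm_sub_le (S (w b) - L / 2) (S (w a) - L / 2)
      have e1 : S (w b) - L / 2 - (S (w a) - L / 2) = S (w b) - S (w a) - 0 := by ring
      rw [e1] at t
      linarith [hSr b hbI (h1.le.trans hab), hSr a haI h1.le]
  rw [hsplit, hphase, hSsub]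
  have t := norm_add_le (∫ v in a..b, e v * (1 - deriv w v : ℝ))
    (S (w b) - S (w a) - (if a ≤ 1 ∧ 1 ≤ b then L else 0))
  rw [← add_sub_assoc] at t
  refine t.trans ((add_le_add hrem hmain).trans ?_)
  have hb0 := hpos b hbI
  have p1 : 0 ≤ 1 / τ := by positivity
  have p2 : 0 ≤ 1 / (Real.sqrt τ + τ * |a - 1|) := by positivity
  have p3 : 0 ≤ 1 / (Real.sqrt τ + τ * |b - 1|) := by positivity
  have p4 : 0 ≤ 2 * B1 + (M - m) * B2 := by
    have : 0 ≤ M - m := by linarith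
    positivity
  have p5 : 0 ≤ 6 / μ := by positivity
  linarith [mul_nonneg p4 p2, mul_nonneg p4 p3, mul_nonneg p5 p1]

/-! ### The oscillatory integral attached to a single `n` -/

/-- `∫_x^y n^{s-1} (i (1/2 - s))^{-iτ} dt` along `s = 1 - a + it`. -/
noncomputable def lineIntegral (n : ℕ) (a x y τ : ℝ) : ℂ :=
  ∫ t in x..y, (n : ℂ) ^ (-((a : ℂ) + (-1 * t : ℝ) * I)) * zetaWeight τ ((1 - a : ℝ) + t * I)

theorem norm_lineIntegral_le {n : ℕ} (hn : n ≠ 0) {a x y τ l H : ℝ} (hx : 0 < x) (hxy : x ≤ y)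
    (hτ : 0 ≤ τ) (hl : 0 < l)
    (hphase : ∀ t ∈ Icc x y, l ≤ ‖(Real.log n : ℂ) - τ / (t + (a - 1 / 2 : ℝ) * I)‖)
    (hH : ∀ t ∈ Icc x y, ‖zetaWeight τ ((1 - a : ℝ) + t * I)‖ ≤ H) :
    ‖lineIntegral n a x y τ‖ ≤
      (n : ℝ) ^ (-a) * (H * (2 / l + τ * (y - x) / (x ^ 2 * l ^ 2))) := by
  refine norm_integral_cpow_mul_zetaWeight_le hn hx hxy hτ hl (fun t ht => ?_) hH
  have h := hphase t ht
  rwa [neg_neg, one_mul, show (1 / 2 - (1 - a) : ℝ) = a - 1 / 2 by ring]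

theorem re_div_add_mul_I_le {τ t b : ℝ} (hτ : 0 ≤ τ) (ht : 0 < t) :
    ((τ : ℂ) / (t + b * I)).re ≤ τ / t := by
  have h : ((τ : ℂ) / (t + b * I)).re = τ * t / (t * t + b * b) := by
    rw [div_re, normSq_apply]
    simp
  have hpos : 0 < t * t + b * b := by nlinarith [mul_self_nonneg b, mul_pos ht ht]
  rw [h, div_le_div_iff₀ hpos ht]
  nlinarith [mul_nonneg hτ (mul_self_nonneg b)]

/-- No stationary point when `log n` is larger than all `τ / t`. -/
theorem norm_lineIntegral_le_of_log_ge {n : ℕ} (hn : n ≠ 0) {a x y τ l : ℝ} (hx : 0 < x)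
    (hxy : x ≤ y) (hτ : 0 ≤ τ) (hl : 0 < l) (ha : 1 / 2 ≤ a) (hlog : τ / x + l ≤ Real.log n) :
    ‖lineIntegral n a x y τ‖ ≤
      (n : ℝ) ^ (-a) * (Real.exp (τ * (a - 1 / 2) / x) *
        (2 / l + τ * (y - x) / (x ^ 2 * l ^ 2))) := by
  refine norm_lineIntegral_le hn hx hxy hτ hl (fun t ht => ?_) fun t ht => ?_
  · have ht0 : 0 < t := hx.trans_le ht.1
    refine le_trans ?_ (re_le_norm _)
    rw [sub_re, ofReal_re]
    have h1 := re_div_add_mul_I_le (b := a - 1 / 2) hτ ht0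
    have h2 : τ / t ≤ τ / x := by
      have := ht.1
      gcongr
    linarith
  · exact norm_zetaWeight_le hτ (by linarith) hx (by simpa using ht.1) (by simp; linarith)

/-- On the critical line the weight has modulus one, and the phase derivative `log n - τ/t` is at
most `-l` throughout `[x, y]`. -/
theorem norm_lineIntegral_half_le_of_log_le {n : ℕ} (hn : n ≠ 0) {x y τ l : ℝ} (hx : 0 < x)
    (hxy : x ≤ y) (hτ : 0 ≤ τ) (hl : 0 < l) (hlog : Real.log n ≤ τ / y - l) :
    ‖lineIntegral n (1 / 2) x y τ‖ ≤
      (n : ℝ) ^ (-(1 / 2) : ℝ) * (2 / l + τ * (y - x) / (x ^ 2 * l ^ 2)) := by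
  have := norm_lineIntegral_le hn (a := 1 / 2) (H := 1) hx hxy hτ hl (fun t ht => ?_)
    fun t ht => ?_
  · rwa [one_mul] at this
  · have ht0 : 0 < t := hx.trans_le ht.1
    have h2 : τ / y ≤ τ / t := by
      have := ht.2
      gcongr
    have e : (Real.log n : ℂ) - τ / (t + (1 / 2 - 1 / 2 : ℝ) * I) = (Real.log n - τ / t : ℝ) := by
      push_cast; simp
    rw [e, norm_real, Real.norm_eq_abs]
    refine le_trans ?_ (neg_le_abs _)
    linarith
  · have := norm_zetaWeight_le (s := ((1 - 1 / 2 : ℝ) : ℂ) + t * I) (b := 0) (x := x) hτ le_rfl hx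
      (by simpa using ht.1) (by rw [add_re, ofReal_re]; simp; norm_num)
    simpa only [mul_zero, zero_div, Real.exp_zero] using this

/-- Moving the line of integration to the critical line. -/
theorem norm_lineIntegral_sub_half_le {n : ℕ} (hn : n ≠ 0) {a x y τ : ℝ} (hx : 0 < x)
    (hxy : x ≤ y) (hτ : 0 ≤ τ) (ha : 1 / 2 ≤ a) (ha2 : a ≤ 3 / 2) :
    ‖lineIntegral n a x y τ - lineIntegral n (1 / 2) x y τ‖ ≤
      2 * ((n : ℝ) ^ (-(1 / 2) : ℝ) + (n : ℝ) ^ (-a) * Real.exp (τ * (a - 1 / 2) / x)) := by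
  set F : ℂ → ℂ := fun s => (n : ℂ) ^ (-(1 - s)) * zetaWeight τ s with hF
  have hn0 : (n : ℂ) ≠ 0 := by exact_mod_cast hn
  have hnpos : (0 : ℝ) < n := by exact_mod_cast Nat.pos_of_ne_zero hn
  have hrect : rectIntegral F (1 - a) (1 / 2) x y = 0 := by
    refine rectIntegral_eq_zero (by linarith) hxy fun s hs => ?_
    have h1 := differentiableAt_zetaWeight τ (s := s) (hx.trans_le hs.2.1)
    have h2 : DifferentiableAt ℂ (fun s => (n : ℂ) ^ (-(1 - s))) s :=
      DifferentiableAt.const_cpow (by fun_prop) (Or.inl hn0)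
    exact (h2.mul h1).differentiableWithinAt
  have hline : ∀ b : ℝ, lineIntegral n b x y τ = ∫ t in x..y, F ((1 - b : ℝ) + t * I) := by
    intro b
    rw [lineIntegral]
    congr 1
    ext t
    rw [hF]
    congr 2
    push_cast
    ring
  have hhor : ∀ v ∈ Icc x y, ‖∫ u in (1 - a : ℝ)..(1 / 2), F (u + v * I)‖ ≤
      (n : ℝ) ^ (-(1 / 2) : ℝ) + (n : ℝ) ^ (-a) * Real.exp (τ * (a - 1 / 2) / x) := by
    intro v hv
    have hb : ∀ u ∈ Set.uIoc (1 - a : ℝ) (1 / 2), ‖F (u + v * I)‖ ≤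
        (n : ℝ) ^ (-(1 / 2) : ℝ) + (n : ℝ) ^ (-a) * Real.exp (τ * (a - 1 / 2) / x) := by
      intro u hu
      rw [uIoc_of_le (by linarith)] at hu
      have h1 := norm_zetaWeight_le (s := (u : ℂ) + v * I) (b := 1 / 2 - u) (x := x) hτ
        (by linarith [hu.2]) hx (by simpa using hv.1) (by simp)
      have h2 : ‖(n : ℂ) ^ (-(1 - ((u : ℂ) + v * I)))‖ = (n : ℝ) ^ (u - 1) := by
        rw [norm_natCast_cpow_of_pos (Nat.pos_of_ne_zero hn)]
        congr 1
        simp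
      rw [hF]
      simp only
      rw [norm_mul, h2]
      refine (mul_le_mul_of_nonneg_left h1 (by positivity)).trans ?_
      rw [Real.rpow_def_of_pos hnpos, Real.rpow_def_of_pos hnpos, Real.rpow_def_of_pos hnpos,
        ← Real.exp_add, ← Real.exp_add]
      -- The exponent is linear in `u`, so the larger endpoint value, at `u = 1 - a` or at `u =
      -- 1/2`, dominates.
      rcases le_total (Real.log n) (τ / x) with h | h
      · refine le_trans (Real.exp_le_exp.2 ?_) (le_add_of_nonneg_left (Real.exp_nonneg _))
        have e1 : τ * (1 / 2 - u) / x = τ / x * (1 / 2 - u) := by ring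
        have e2 : τ * (a - 1 / 2) / x = τ / x * (a - 1 / 2) := by ring
        rw [e1, e2]
        nlinarith [mul_nonneg (sub_nonneg.2 h) (by linarith [hu.1] : 0 ≤ u - (1 - a))]
      · refine le_trans (Real.exp_le_exp.2 ?_) (le_add_of_nonneg_right (Real.exp_nonneg _))
        have e1 : τ * (1 / 2 - u) / x = τ / x * (1 / 2 - u) := by ring
        rw [e1]
        nlinarith [mul_nonneg (sub_nonneg.2 h) (by linarith [hu.2] : 0 ≤ 1 / 2 - u)]
    have := intervalIntegral.norm_integral_le_of_norm_le_const hb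
    refine this.trans ?_
    rw [abs_of_nonneg (by linarith)]
    exact mul_le_of_le_one_right (by positivity) (by linarith)
  rw [rectIntegral] at hrect
  have key : lineIntegral n a x y τ - lineIntegral n (1 / 2) x y τ =
      -I * ((∫ u in (1 - a : ℝ)..(1 / 2), F (u + x * I)) -
        ∫ u in (1 - a : ℝ)..(1 / 2), F (u + y * I)) := by
    rw [hline, hline, show (1 - 1 / 2 : ℝ) = 1 / 2 by norm_num]
    push_cast at hrect ⊢
    linear_combination (I) * hrect + ((∫ t in x..y, F (1 - a + t * I)) -
      (∫ t in x..y, F (1 / 2 + t * I))) * I_sq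
  rw [key, norm_mul, norm_neg, norm_I, one_mul]
  refine (norm_sub_le _ _).trans ?_
  linarith [hhor x ⟨le_rfl, hxy⟩, hhor y ⟨hxy, le_rfl⟩]

/-- The contribution of the stationary point `t = τ / log n`. -/
noncomputable def stationaryValue (n : ℕ) (τ : ℝ) : ℂ :=
  ((n : ℝ) ^ (-(1 / 2) : ℝ) : ℝ) * ((τ / Real.log n : ℝ) * ((τ / Real.log n : ℝ) : ℂ) ^ (-(I * (τ : ℂ))) *
    exp (I * τ)) * ((Real.sqrt (2 * Real.pi / τ) : ℂ) * exp (I * (Real.pi / 4)))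

/-- Substituting `t = v τ / log n` turns `t log n - τ log t` into `τ(v - log v)` plus a constant.
The phase no longer depends on `n`, which makes stationary phase uniform in `n`. -/
theorem lineIntegral_half_eq {n : ℕ} (hn : 2 ≤ n) {x y τ : ℝ} (hx : 0 < x) (hxy : x ≤ y)
    (hτ : 0 < τ) : lineIntegral n (1 / 2) x y τ =
      ((n : ℝ) ^ (-(1 / 2) : ℝ) : ℝ) * ((τ / Real.log n : ℝ) *
        ((τ / Real.log n : ℝ) : ℂ) ^ (-(I * (τ : ℂ))) * exp (I * τ)) *
        ∫ v in (x * Real.log n / τ)..(y * Real.log n / τ),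
          exp (I * τ * (v - 1 - Real.log v : ℝ)) := by
  have hlog : 0 < Real.log n := Real.log_pos (by exact_mod_cast hn)
  set T := τ / Real.log n with hT
  have hT0 : 0 < T := by positivity
  have e1 : x * Real.log n / τ = x / T := by rw [hT]; field_simp
  have e2 : y * Real.log n / τ = y / T := by rw [hT]; field_simp
  have h := intervalIntegral.integral_comp_div (a := x) (b := y)
    (fun v : ℝ => exp (I * τ * (v - 1 - Real.log v : ℝ))) hT0.ne'
  rw [e1, e2]
  have h2 : (T : ℂ) * ∫ v in (x / T)..(y / T), exp (I * τ * (v - 1 - Real.log v : ℝ)) =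
      ∫ t in x..y, exp (I * τ * (t / T - 1 - Real.log (t / T) : ℝ)) := by
    rw [h, real_smul]
  have e3 : ((n : ℝ) ^ (-(1 / 2) : ℝ) : ℝ) * ((T : ℂ) *
        (T : ℂ) ^ (-(I * (τ : ℂ))) * exp (I * τ)) *
        ∫ v in (x / T)..(y / T), exp (I * τ * (v - 1 - Real.log v : ℝ)) =
      (((n : ℝ) ^ (-(1 / 2) : ℝ) : ℝ) * (T : ℂ) ^ (-(I * (τ : ℂ))) * exp (I * τ)) *
        ∫ t in x..y, exp (I * τ * (t / T - 1 - Real.log (t / T) : ℝ)) := by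
    rw [← h2]; ring
  rw [e3, ← intervalIntegral.integral_const_mul, lineIntegral]
  refine intervalIntegral.integral_congr fun t ht => ?_
  rw [uIcc_of_le hxy] at ht
  have ht0 : 0 < t := hx.trans_le ht.1
  rw [natCast_cpow_line (by omega), zetaWeight_line]
  have hT' : (T : ℂ) ≠ 0 := by exact_mod_cast hT0.ne'
  have ht' : (t : ℂ) ≠ 0 := by exact_mod_cast ht0.ne'
  have e4 : (t : ℂ) + ((1 / 2 - (1 - 1 / 2) : ℝ) : ℂ) * I = t := by norm_num
  rw [e4, cpow_def_of_ne_zero hT', cpow_def_of_ne_zero ht', ← ofReal_log hT0.le,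
    ← ofReal_log ht0.le, Real.log_div ht0.ne' hT0.ne']
  rw [mul_assoc, mul_assoc, mul_assoc, ← exp_add, ← exp_add, mul_assoc, ← exp_add]
  congr 2
  have e5 : (τ : ℂ) / T = Real.log n := by
    rw [hT]
    push_cast
    have : (Real.log n : ℂ) ≠ 0 := by exact_mod_cast hlog.ne'
    have : (τ : ℂ) ≠ 0 := by exact_mod_cast hτ.ne'
    field_simp
  rw [natCast_log] at e5
  push_cast
  linear_combination (-I * t) * e5

set_option maxHeartbeats 1000000 in
-- If the stationary point is well beyond `y`, the first derivative test suffices. Otherwise the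
-- rescaled endpoints `x log n / τ` and `y log n / τ` stay in the fixed interval `[1/(2K), K(1 +
-- 1/c)]`, where `exists_stationary_phase` holds with one constant.
theorem exists_norm_lineIntegral_half_sub_le {c K : ℝ} (hc : 0 < c) (hK : 1 ≤ K) :
    ∃ C : ℝ, 0 < C ∧ ∀ (x y τ : ℝ) (n : ℕ), 2 ≤ x → x < y → y ≤ K * x → c * x * Real.log 2 ≤ τ →
      2 ≤ n → (n : ℝ) ≤ 2 * Real.exp (τ / x) →
      ‖lineIntegral n (1 / 2) x y τ -
        (if τ / y ≤ Real.log n ∧ Real.log n ≤ τ / x then stationaryValue n τ else 0)‖ ≤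
      C * ((n : ℝ) ^ (-(1 / 2) : ℝ) * (1 + τ / x +
        1 / (Real.sqrt τ / x + |Real.log n - τ / x|) +
        1 / (Real.sqrt τ / x + |Real.log n - τ / y|))) := by
  have hl2 : 0 < Real.log 2 := Real.log_pos (by norm_num)
  have hm : 0 < 1 / (2 * K) := by positivity
  have hmM : 1 / (2 * K) ≤ K * (1 + 1 / c) := by
    have h1 : 1 / (2 * K) ≤ 1 := by rw [div_le_one (by positivity)]; linarith
    have h2 : 0 < 1 / c := by positivity
    nlinarith
  obtain ⟨C, hC, hsp⟩ := exists_stationary_phase hm hmM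
  refine ⟨2 / Real.log 2 + K / Real.log 2 ^ 2 + C * (1 / Real.log 2 + 2 * K), by positivity,
    fun x y τ n hx hxy hyK hτ hn hnle => ?_⟩
  have hx0 : 0 < x := by linarith
  have hy0 : 0 < y := by linarith
  have hτ0 : 0 < τ := lt_of_lt_of_le (by positivity) hτ
  have hnpos : (0 : ℝ) < n := by exact_mod_cast (by omega : 0 < n)
  set w := (n : ℝ) ^ (-(1 / 2) : ℝ) with hw
  have hw0 : 0 < w := by positivity
  have hs : 0 < Real.sqrt τ := Real.sqrt_pos.2 hτ0
  have hss : Real.sqrt τ * Real.sqrt τ = τ := Real.mul_self_sqrt hτ0.le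
  set X := 1 / (Real.sqrt τ / x + |Real.log n - τ / x|) with hX
  set Y := 1 / (Real.sqrt τ / x + |Real.log n - τ / y|) with hY
  have hX0 : 0 ≤ X := by positivity
  have hY0 : 0 ≤ Y := by positivity
  have hr0 : 0 < τ / x := by positivity
  have hln2 : Real.log 2 ≤ Real.log n := Real.log_le_log (by norm_num) (by exact_mod_cast hn)
  set lam := Real.log n with hlam
  have hlam0 : 0 < lam := by linarith
  -- In the second case `τ/y < log n + log 2 ≤ 2 log n`, which bounds the rescaled lower endpoint
  -- from below.
  rcases le_or_gt lam (τ / y - Real.log 2) with h | h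
  · have hne : ¬ (τ / y ≤ lam ∧ lam ≤ τ / x) := fun hh => by linarith [hh.1]
    rw [if_neg hne, sub_zero]
    refine (norm_lineIntegral_half_le_of_log_le (by omega) hx0 hxy.le hτ0.le hl2 h).trans ?_
    rw [mul_left_comm]
    refine mul_le_mul_of_nonneg_left ?_ hw0.le
    have h1 : τ * (y - x) / (x ^ 2 * Real.log 2 ^ 2) ≤ K / Real.log 2 ^ 2 * (τ / x) := by
      calc _ ≤ τ * (K * x) / (x ^ 2 * Real.log 2 ^ 2) := by gcongr; linarith
        _ = _ := by field_simp
    have hP : 0 ≤ C * (1 / Real.log 2 + 2 * K) := by positivity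
    have h2 : 0 ≤ 2 / Real.log 2 := by positivity
    have h3 : 0 ≤ K / Real.log 2 ^ 2 := by positivity
    calc _ ≤ 2 / Real.log 2 + K / Real.log 2 ^ 2 * (τ / x) := by linarith
      _ ≤ (2 / Real.log 2 + K / Real.log 2 ^ 2) * (1 + τ / x) := by
          nlinarith [mul_nonneg h2 hr0.le]
      _ ≤ _ := by
          refine mul_le_mul (by linarith) (by linarith) (by positivity) (by positivity)
  · set T := τ / lam with hT
    have hT0 : 0 < T := by positivity
    have hlow : τ / y ≤ 2 * lam := by linarith
    have ha1 : 1 / (2 * K) ≤ x * lam / τ := by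
      rw [div_le_div_iff₀ (by positivity) hτ0, one_mul]
      rw [div_le_iff₀ hy0] at hlow
      nlinarith
    have hab : x * lam / τ ≤ y * lam / τ := by gcongr
    have hlamr : lam ≤ τ / x + Real.log 2 := by
      have := Real.log_le_log hnpos hnle
      rw [Real.log_mul two_ne_zero (Real.exp_ne_zero _), Real.log_exp] at this
      linarith
    have hb1 : y * lam / τ ≤ K * (1 + 1 / c) := by
      have h1 : Real.log 2 ≤ 1 / c * (τ / x) := by
        rw [div_mul_div_comm, one_mul, le_div_iff₀ (by positivity)]
        linarith
      have h2 : lam ≤ (1 + 1 / c) * (τ / x) := by linarith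
      calc y * lam / τ ≤ (K * x) * ((1 + 1 / c) * (τ / x)) / τ := by gcongr
        _ = _ := by field_simp
    have hcond : (τ / y ≤ lam ∧ lam ≤ τ / x) ↔ (x * lam / τ ≤ 1 ∧ 1 ≤ y * lam / τ) := by
      rw [div_le_one hτ0, one_le_div hτ0, div_le_iff₀ hy0, le_div_iff₀ hx0, and_comm,
        mul_comm lam, mul_comm lam]
    have hsp' := hsp τ (x * lam / τ) (y * lam / τ) hτ0 ha1 hab hb1
    rw [lineIntegral_half_eq hn hx0 hxy.le hτ0]
    set P : ℂ := ((w : ℝ) : ℂ) * ((T : ℂ) * (T : ℂ) ^ (-(I * (τ : ℂ))) * exp (I * τ)) with hP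
    have hPn : ‖P‖ = w * T := by
      rw [hP, norm_mul, norm_mul, norm_mul, norm_real, norm_real, Real.norm_of_nonneg hw0.le,
        Real.norm_of_nonneg hT0.le, norm_cpow_eq_rpow_re_of_pos hT0, norm_exp]
      simp
    have hite : (if τ / y ≤ lam ∧ lam ≤ τ / x then stationaryValue n τ else 0) =
        P * (if x * lam / τ ≤ 1 ∧ 1 ≤ y * lam / τ then
          (Real.sqrt (2 * Real.pi / τ) : ℂ) * exp (I * (Real.pi / 4)) else 0) := by
      by_cases hh : τ / y ≤ lam ∧ lam ≤ τ / x
      · rw [if_pos hh, if_pos (hcond.1 hh)]; rfl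
      · rw [if_neg hh, if_neg (fun h' => hh (hcond.2 h')), mul_zero]
    rw [hite, ← mul_sub, norm_mul, hPn]
    refine (mul_le_mul_of_nonneg_left hsp' (by positivity)).trans ?_
    have t1 : T * (1 / τ) ≤ 1 / Real.log 2 := by
      have : T * (1 / τ) = 1 / lam := by rw [hT]; field_simp
      rw [this]
      exact one_div_le_one_div_of_le hl2 hln2
    have hlx : τ ≤ 2 * K * (x * lam) := by
      rw [div_le_div_iff₀ (by positivity) hτ0] at ha1
      linarith
    have hlx' : τ / x ≤ 2 * K * lam := by
      rw [div_le_iff₀ hx0]; linarith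
    -- Translates the endpoint error from the variable `v` back to distances of `log n` from `τ/z`,
    -- used for `z = x` and `z = y`.
    have gen : ∀ z : ℝ, x ≤ z → T * (1 / (Real.sqrt τ + τ * |z * lam / τ - 1|)) ≤
        2 * K * (1 / (Real.sqrt τ / x + |lam - τ / z|)) := by
      intro z hz
      have hz0 : 0 < z := hx0.trans_le hz
      have e1 : T * (1 / (Real.sqrt τ + τ * |z * lam / τ - 1|)) =
          1 / (lam / Real.sqrt τ + z * lam / τ * |lam - τ / z|) := by
        have : z * lam / τ - 1 = z / τ * (lam - τ / z) := by field_simp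
        rw [this, abs_mul, abs_of_pos (by positivity : 0 < z / τ), hT]
        rw [div_mul_div_comm, mul_one, div_eq_div_iff (by positivity) (by positivity)]
        have e2 : τ * (lam / Real.sqrt τ) = Real.sqrt τ * lam := by
          nth_rewrite 1 [← hss]
          field_simp
        have e3 : τ * (z * lam / τ * |lam - τ / z|) = z * lam * |lam - τ / z| := by field_simp
        have e4 : τ * (z / τ * |lam - τ / z|) = z * |lam - τ / z| := by field_simp
        rw [mul_add, e2, e3, e4]
        ring
      rw [e1, ← one_div_one_div (2 * K), div_mul_div_comm, one_mul]
      refine one_div_le_one_div_of_le (by positivity) ?_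
      rw [mul_add]
      refine add_le_add ?_ (mul_le_mul_of_nonneg_right ?_ (abs_nonneg _))
      · rw [div_mul_div_comm, one_mul, div_le_div_iff₀ (by positivity) hs, hss]
        linarith
      · exact ha1.trans (by gcongr)
    have t2 := gen x le_rfl
    have t3 := gen y hxy.le
    have hK2 : 0 ≤ 2 * K := by linarith
    have hl2' : 0 ≤ 1 / Real.log 2 := by positivity
    have hD : 0 ≤ 2 / Real.log 2 + K / Real.log 2 ^ 2 := by positivity
    calc w * T * (C * (1 / τ + 1 / (Real.sqrt τ + τ * |x * lam / τ - 1|) +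
          1 / (Real.sqrt τ + τ * |y * lam / τ - 1|)))
        = w * (C * (T * (1 / τ) + T * (1 / (Real.sqrt τ + τ * |x * lam / τ - 1|)) +
          T * (1 / (Real.sqrt τ + τ * |y * lam / τ - 1|)))) := by ring
      _ ≤ w * (C * (1 / Real.log 2 + 2 * K * X + 2 * K * Y)) := by gcongr
      _ ≤ w * (C * ((1 / Real.log 2 + 2 * K) * (1 + τ / x + X + Y))) := by
          gcongr
          nlinarith [mul_nonneg hl2' hX0, mul_nonneg hl2' hY0, mul_nonneg hl2' hr0.le,
            mul_nonneg hK2 hr0.le]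
      _ = C * (1 / Real.log 2 + 2 * K) * (w * (1 + τ / x + X + Y)) := by ring
      _ ≤ _ := by
          refine mul_le_mul_of_nonneg_right (by linarith) (by positivity)

/-! ### Summation of the errors over `n` -/

theorem sum_one_div_sqrt_le (M : ℕ) : ∑ n ∈ Finset.Icc 1 M, 1 / Real.sqrt n ≤ 2 * Real.sqrt M := by
  induction M with
  | zero => simp
  | succ k ih =>
    rw [Finset.sum_Icc_succ_top (by omega)]
    have h0 : 0 < Real.sqrt (k + 1 : ℕ) := Real.sqrt_pos.2 (by positivity)
    have h1 : Real.sqrt (k + 1 : ℕ) ^ 2 = k + 1 := by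
      rw [Real.sq_sqrt (by positivity)]; push_cast; ring
    have h2 : Real.sqrt k ^ 2 = k := Real.sq_sqrt (by positivity)
    have h3 : 1 / Real.sqrt (k + 1 : ℕ) ≤ 2 * Real.sqrt (k + 1 : ℕ) - 2 * Real.sqrt k := by
      rw [div_le_iff₀ h0]
      nlinarith [sq_nonneg (Real.sqrt (k + 1 : ℕ) - Real.sqrt k)]
    linarith

theorem sum_one_div_Icc_le (M : ℕ) : ∑ k ∈ Finset.Icc 1 M, 1 / (k : ℝ) ≤ 1 + Real.log M := by
  have h := harmonic_le_one_add_log M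
  rw [harmonic_eq_sum_Icc] at h
  push_cast at h
  simpa only [one_div] using h

/-- On either side of `N` the distance `|n - N|` is at least the positive integer `n - ⌈N⌉` or `⌊N⌋
- n`, and distinct `n` on one side give distinct integers; each side is at most a harmonic sum. -/
theorem sum_one_div_abs_sub_le {M : ℕ} {N : ℝ} (hN : 1 ≤ N) (hNM : N ≤ M) :
    ∑ n ∈ Finset.Icc 2 M, (if 1 ≤ |(n : ℝ) - N| then 1 / |(n : ℝ) - N| else 0) ≤
      2 * (1 + Real.log M) := by
  have key : ∀ (S : Finset ℕ) (k : ℕ → ℕ), Set.InjOn k S → (∀ n ∈ S, 1 ≤ k n ∧ k n ≤ M ∧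
      (k n : ℝ) ≤ |(n : ℝ) - N|) → ∑ n ∈ S, 1 / |(n : ℝ) - N| ≤ 1 + Real.log M := by
    intro S k hinj hk
    calc ∑ n ∈ S, 1 / |(n : ℝ) - N| ≤ ∑ n ∈ S, 1 / (k n : ℝ) := by
          refine Finset.sum_le_sum fun n hn => ?_
          obtain ⟨h1, -, h3⟩ := hk n hn
          have : (0 : ℝ) < k n := by exact_mod_cast h1
          exact one_div_le_one_div_of_le this h3
      _ = ∑ j ∈ S.image k, 1 / (j : ℝ) := (Finset.sum_image (f := fun j : ℕ => 1 / (j : ℝ)) hinj).symm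
      _ ≤ ∑ j ∈ Finset.Icc 1 M, 1 / (j : ℝ) := by
          refine Finset.sum_le_sum_of_subset_of_nonneg (fun j hj => ?_) fun _ _ _ => by positivity
          obtain ⟨n, hn, rfl⟩ := Finset.mem_image.1 hj
          exact Finset.mem_Icc.2 ⟨(hk n hn).1, (hk n hn).2.1⟩
      _ ≤ _ := sum_one_div_Icc_le M
  have hN0 : 0 ≤ N := by linarith
  have h1 := key ((Finset.Icc 2 M).filter fun n => N + 1 ≤ (n : ℝ)) (fun n => n - ⌈N⌉₊)
    (fun n hn m hm h => by
      rw [Finset.mem_coe, Finset.mem_filter] at hn hm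
      have a1 : ⌈N⌉₊ ≤ n := Nat.ceil_le.2 (by linarith [hn.2])
      have a2 : ⌈N⌉₊ ≤ m := Nat.ceil_le.2 (by linarith [hm.2])
      simp only at h
      omega)
    (fun n hn => by
      rw [Finset.mem_filter, Finset.mem_Icc] at hn
      have hc : ⌈N⌉₊ + 1 ≤ n := by
        rw [← Nat.ceil_add_one hN0]
        exact Nat.ceil_le.2 hn.2
      refine ⟨by omega, by omega, ?_⟩
      rw [Nat.cast_sub (by omega), abs_of_nonneg (by linarith [hn.2])]
      linarith [Nat.le_ceil N])
  have h2 := key ((Finset.Icc 2 M).filter fun n => (n : ℝ) + 1 ≤ N) (fun n => ⌊N⌋₊ - n)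
    (fun n hn m hm h => by
      rw [Finset.mem_coe, Finset.mem_filter] at hn hm
      have a1 : n ≤ ⌊N⌋₊ := Nat.le_floor (by linarith [hn.2])
      have a2 : m ≤ ⌊N⌋₊ := Nat.le_floor (by linarith [hm.2])
      simp only at h
      omega)
    (fun n hn => by
      rw [Finset.mem_filter, Finset.mem_Icc] at hn
      have hc : n + 1 ≤ ⌊N⌋₊ := Nat.le_floor (by push_cast; exact hn.2)
      have hM : ⌊N⌋₊ ≤ M := by
        have := Nat.floor_le_floor hNM
        rwa [Nat.floor_natCast] at this
      refine ⟨by omega, by omega, ?_⟩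
      rw [Nat.cast_sub (by omega), abs_sub_comm, abs_of_nonneg (by linarith [hn.2])]
      linarith [Nat.floor_le hN0])
  rw [Finset.sum_filter] at h1 h2
  have h3 : ∑ n ∈ Finset.Icc 2 M, (if 1 ≤ |(n : ℝ) - N| then 1 / |(n : ℝ) - N| else 0) ≤
      ∑ n ∈ Finset.Icc 2 M, ((if N + 1 ≤ (n : ℝ) then 1 / |(n : ℝ) - N| else 0) +
        (if (n : ℝ) + 1 ≤ N then 1 / |(n : ℝ) - N| else 0)) := by
    refine Finset.sum_le_sum fun n _ => ?_
    have hp : 0 ≤ 1 / |(n : ℝ) - N| := by positivity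
    split_ifs with a1 a2 a3 a3 <;> try linarith
    exfalso
    rcases abs_cases ((n : ℝ) - N) with h | h <;> linarith [h.1, h.2]
  rw [Finset.sum_add_distrib] at h3
  linarith

theorem one_div_abs_log_sub_le {p q : ℝ} (hp : 0 < p) (hq : 0 < q) (hpq : p ≠ q) :
    1 / |Real.log p - Real.log q| ≤ max p q / |p - q| := by
  wlog h : q < p generalizing p q
  · have := this hq hp hpq.symm (lt_of_le_of_ne (not_lt.1 h) hpq)
    rwa [abs_sub_comm, max_comm, abs_sub_comm q p] at this
  have h1 : 0 < p - q := by linarith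
  have h2 := Real.one_sub_inv_le_log_of_pos (div_pos hp hq)
  rw [Real.log_div hp.ne' hq.ne', inv_div] at h2
  have h3 : 1 - q / p = (p - q) / p := by field_simp
  rw [h3] at h2
  have h4 : 0 < (p - q) / p := by positivity
  rw [max_eq_left h.le, abs_of_pos h1, abs_of_pos (h4.trans_le h2)]
  calc 1 / (Real.log p - Real.log q) ≤ 1 / ((p - q) / p) := one_div_le_one_div_of_le h4 h2
    _ = _ := one_div_div _ _

/-- From `max n N ≤ n + |n - N|`: the loss in passing from `|log n - log N|` to `|n - N|` splits
into a term without singularity and one for the harmonic sum. -/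
theorem max_div_sqrt_mul_le {n N M : ℝ} (hn : 0 < n) (hnM : n ≤ M) (hne : n ≠ N) :
    1 / Real.sqrt n * (max n N / |n - N|) ≤ 1 / Real.sqrt n + Real.sqrt M * (1 / |n - N|) := by
  have hs : 0 < Real.sqrt n := Real.sqrt_pos.2 hn
  have hsn : Real.sqrt n * Real.sqrt n = n := Real.mul_self_sqrt hn.le
  have hsM : Real.sqrt n ≤ Real.sqrt M := Real.sqrt_le_sqrt hnM
  have hd : 0 < |n - N| := abs_pos.2 (sub_ne_zero.2 hne)
  have h1 : max n N ≤ n + |n - N| := by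
    rcases abs_cases (n - N) with h | h <;> rcases max_cases n N with h' | h' <;> linarith [h.1, h.2]
  calc 1 / Real.sqrt n * (max n N / |n - N|) ≤ 1 / Real.sqrt n * ((n + |n - N|) / |n - N|) := by
        gcongr
    _ = 1 / Real.sqrt n + n / Real.sqrt n * (1 / |n - N|) := by field_simp; ring
    _ = 1 / Real.sqrt n + Real.sqrt n * (1 / |n - N|) := by
        rw [show n / Real.sqrt n = Real.sqrt n from Real.div_sqrt]
    _ ≤ _ := by gcongr

/-- For `|n - N| ≥ 1` the parameter `η` is dropped and logarithmic distances become ordinary ones.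
The `n` with `|n - N| < 1` are estimated by `1/η`; only they feel the width of the stationary
region. -/
theorem sum_vonMangoldt_div_le {M : ℕ} {N η : ℝ} (hN : 1 ≤ N) (hNM : N ≤ M) (hη : 0 < η) :
    ∑ n ∈ Finset.Icc 2 M, vonMangoldt n * (1 / Real.sqrt n *
      (1 / (η + |Real.log n - Real.log N|))) ≤
      6 * (1 + Real.log M) ^ 2 * Real.sqrt M + 4 * ((1 + Real.log N) / (Real.sqrt N * η)) := by
  have hN0 : 0 < N := by linarith
  have hlN : 0 ≤ Real.log N := Real.log_nonneg hN
  have hM1 : (1 : ℝ) ≤ M := hN.trans hNM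
  have hlM : 0 ≤ Real.log M := Real.log_nonneg hM1
  have hsN : 0 < Real.sqrt N := Real.sqrt_pos.2 hN0
  have hterm : ∀ n ∈ Finset.Icc 2 M, vonMangoldt n * (1 / Real.sqrt n *
      (1 / (η + |Real.log n - Real.log N|))) ≤
      Real.log M * (1 / Real.sqrt n +
        Real.sqrt M * (if 1 ≤ |(n : ℝ) - N| then 1 / |(n : ℝ) - N| else 0)) +
      (if |(n : ℝ) - N| < 1 then 2 * ((1 + Real.log N) / (Real.sqrt N * η)) else 0) := by
    intro n hn
    rw [Finset.mem_Icc] at hn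
    have hn0 : (0 : ℝ) < n := by exact_mod_cast (by omega : 0 < n)
    have hn1 : (1 : ℝ) ≤ n := by exact_mod_cast (by omega : 1 ≤ n)
    have hnM : (n : ℝ) ≤ M := by exact_mod_cast hn.2
    have hs : 0 < Real.sqrt n := Real.sqrt_pos.2 hn0
    have hL : vonMangoldt n ≤ Real.log n := vonMangoldt_le_log
    have hln : 0 ≤ Real.log n := Real.log_nonneg hn1
    rcases le_or_gt 1 |(n : ℝ) - N| with h | h
    · rw [if_pos h, if_neg (not_lt.2 h), add_zero]
      have hne : (n : ℝ) ≠ N := fun h' => by rw [h', sub_self, abs_zero] at h; linarith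
      have hlog : 0 < |Real.log n - Real.log N| := by
        refine abs_pos.2 (sub_ne_zero.2 fun h' => hne ?_)
        exact Real.log_injOn_pos (Set.mem_Ioi.2 hn0) (Set.mem_Ioi.2 hN0) h'
      refine mul_le_mul (hL.trans (Real.log_le_log hn0 hnM)) ?_ (by positivity) hlM
      refine le_trans ?_ (max_div_sqrt_mul_le hn0 hnM hne)
      refine mul_le_mul_of_nonneg_left ?_ (by positivity)
      refine le_trans ?_ (one_div_abs_log_sub_le hn0 hN0 hne)
      exact one_div_le_one_div_of_le hlog (by linarith)
    · rw [if_neg (not_le.2 h), if_pos h, mul_zero, add_zero]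
      refine le_trans ?_ (le_add_of_nonneg_left (by positivity))
      obtain ⟨h1, h2⟩ := abs_lt.1 h
      have e1 : Real.log n ≤ 1 + Real.log N := by
        have : Real.log n ≤ Real.log (2 * N) := Real.log_le_log hn0 (by linarith)
        rw [Real.log_mul two_ne_zero hN0.ne'] at this
        have := Real.log_two_lt_d9
        linarith
      have e2 : 1 / Real.sqrt n ≤ 2 / Real.sqrt N := by
        rw [div_le_div_iff₀ hs hsN, one_mul]
        have : Real.sqrt N ≤ Real.sqrt (2 ^ 2 * n) := Real.sqrt_le_sqrt (by linarith)
        rwa [Real.sqrt_mul (by norm_num), Real.sqrt_sq (by norm_num)] at this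
      have e3 : 1 / (η + |Real.log n - Real.log N|) ≤ 1 / η :=
        one_div_le_one_div_of_le hη (by linarith [abs_nonneg (Real.log n - Real.log N)])
      calc _ ≤ (1 + Real.log N) * (2 / Real.sqrt N * (1 / η)) := by
            refine mul_le_mul (hL.trans e1) ?_ (by positivity) (by positivity)
            exact mul_le_mul e2 e3 (by positivity) (by positivity)
        _ = _ := by field_simp
  refine (Finset.sum_le_sum hterm).trans ?_
  rw [Finset.sum_add_distrib, ← Finset.mul_sum, Finset.sum_add_distrib, ← Finset.mul_sum]
  have hs1 : ∑ n ∈ Finset.Icc 2 M, 1 / Real.sqrt n ≤ 2 * Real.sqrt M := by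
    refine le_trans ?_ (sum_one_div_sqrt_le M)
    exact Finset.sum_le_sum_of_subset_of_nonneg (Finset.Icc_subset_Icc (by norm_num) le_rfl)
      fun _ _ _ => by positivity
  have hs2 := sum_one_div_abs_sub_le hN hNM
  have hs3 : ∑ n ∈ Finset.Icc 2 M,
      (if |(n : ℝ) - N| < 1 then 2 * ((1 + Real.log N) / (Real.sqrt N * η)) else 0) ≤
      4 * ((1 + Real.log N) / (Real.sqrt N * η)) := by
    rw [← Finset.sum_filter, Finset.sum_const, nsmul_eq_mul]
    -- Only `⌊N⌋` and `⌊N⌋ + 1` can be at distance less than one from `N`.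
    have hcard : ((Finset.Icc 2 M).filter fun n : ℕ => |(n : ℝ) - N| < 1).card ≤ 2 := by
      refine (Finset.card_le_card (t := {⌊N⌋₊, ⌊N⌋₊ + 1}) fun n hn => ?_).trans
        (Finset.card_le_two)
      rw [Finset.mem_filter] at hn
      obtain ⟨h1, h2⟩ := abs_lt.1 hn.2
      rw [Finset.mem_insert, Finset.mem_singleton]
      have a1 : ⌊N⌋₊ < n + 1 := (Nat.floor_lt hN0.le).2 (by push_cast; linarith)
      have a2 : n < ⌊N⌋₊ + 2 := by
        have := Nat.lt_floor_add_one N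
        have h3 : (n : ℝ) < ((⌊N⌋₊ + 2 : ℕ) : ℝ) := by push_cast; linarith
        exact_mod_cast h3
      omega
    have hcard' : (((Finset.Icc 2 M).filter fun n : ℕ => |(n : ℝ) - N| < 1).card : ℝ) ≤ 2 := by
      exact_mod_cast hcard
    have : 0 ≤ (1 + Real.log N) / (Real.sqrt N * η) := by positivity
    nlinarith
  have hsM : 0 ≤ Real.sqrt M := Real.sqrt_nonneg _
  have h1 : Real.log M * (∑ n ∈ Finset.Icc 2 M, 1 / Real.sqrt n + Real.sqrt M *
      ∑ n ∈ Finset.Icc 2 M, (if 1 ≤ |(n : ℝ) - N| then 1 / |(n : ℝ) - N| else 0)) ≤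
      Real.log M * (2 * Real.sqrt M + Real.sqrt M * (2 * (1 + Real.log M))) := by
    gcongr
  have h2 : Real.log M * (2 * Real.sqrt M + Real.sqrt M * (2 * (1 + Real.log M))) ≤
      6 * (1 + Real.log M) ^ 2 * Real.sqrt M := by
    nlinarith [mul_nonneg hlM hsM, mul_nonneg (mul_nonneg hlM hlM) hsM]
  linarith

theorem sum_vonMangoldt_div_sqrt_le (M : ℕ) :
    ∑ n ∈ Finset.Icc 2 M, vonMangoldt n * (1 / Real.sqrt n) ≤ 2 * Real.log M * Real.sqrt M := by
  calc _ ≤ ∑ n ∈ Finset.Icc 2 M, Real.log M * (1 / Real.sqrt n) := by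
        refine Finset.sum_le_sum fun n hn => ?_
        rw [Finset.mem_Icc] at hn
        have hn0 : (0 : ℝ) < n := by exact_mod_cast (by omega : 0 < n)
        have hnM : (n : ℝ) ≤ M := by exact_mod_cast hn.2
        refine mul_le_mul_of_nonneg_right ?_ (by positivity)
        exact vonMangoldt_le_log.trans (Real.log_le_log hn0 hnM)
    _ = Real.log M * ∑ n ∈ Finset.Icc 2 M, 1 / Real.sqrt n := by rw [Finset.mul_sum]
    _ ≤ Real.log M * (2 * Real.sqrt M) := by
        refine mul_le_mul_of_nonneg_left ?_ (Real.log_natCast_nonneg M)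
        refine le_trans ?_ (sum_one_div_sqrt_le M)
        exact Finset.sum_le_sum_of_subset_of_nonneg (Finset.Icc_subset_Icc (by norm_num) le_rfl)
          fun _ _ _ => by positivity
    _ = _ := by ring

/-! ### The two ranges of `τ` -/

/-- The main integral is small when `τ` is large. -/
theorem norm_mainIntegral_le {x y τ : ℝ} (hx : 1 ≤ x) (hxy : x ≤ y) (hτ : 0 < τ) :
    ‖mainIntegral x y τ‖ ≤ 3 * (y * (Real.log y + 2)) / τ := by
  set r : ℂ := -(I * (τ : ℂ)) with hr
  have hr1 : r ≠ -1 := fun h => by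
    have := congrArg re h
    simp [hr] at this
  have hr1' : r + 1 ≠ 0 := fun h => hr1 (eq_neg_of_add_eq_zero_left h)
  -- The denominator `r + 1` arises on integrating `t^{-iτ}` by parts against the logarithm, and is
  -- the source of the saving `1/τ`.
  have hrn : τ ≤ ‖r + 1‖ := by
    have := abs_im_le_norm (r + 1)
    simp [hr] at this
    exact (le_abs_self τ).trans this
  have hpi : (Real.pi : ℂ) ≠ 0 := by exact_mod_cast Real.pi_ne_zero
  have hpos : ∀ t ∈ uIcc x y, 0 < t := fun t ht => by
    rw [uIcc_of_le hxy] at ht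
    linarith [ht.1]
  have hder : ∀ t ∈ uIcc x y, HasDerivAt
      (fun t : ℝ => (t : ℂ) ^ (r + 1) / (r + 1) / (2 * Real.pi) *
        (Real.log (t / (2 * Real.pi)) : ℂ))
      ((t : ℂ) ^ r / (2 * Real.pi) * (Real.log (t / (2 * Real.pi)) : ℂ) +
        (t : ℂ) ^ r / (r + 1) / (2 * Real.pi)) t := by
    intro t ht
    have ht0 := hpos t ht
    have h1 := (hasDerivAt_ofReal_cpow_const' ht0.ne' hr1).div_const (2 * (Real.pi : ℂ))
    have h2 : HasDerivAt (fun t : ℝ => Real.log (t / (2 * Real.pi))) (1 / t) t := by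
      have hp := Real.pi_pos
      refine (((hasDerivAt_id t).div_const (2 * Real.pi)).log (by
        simp only [id]; positivity)).congr_deriv ?_
      simp only [id]
      field_simp
    refine (h1.mul h2.ofReal_comp).congr_deriv ?_
    have ht' : (t : ℂ) ≠ 0 := by exact_mod_cast ht0.ne'
    rw [cpow_add _ _ ht', cpow_one]
    push_cast
    field_simp
  have hcpow : ContinuousOn (fun t : ℝ => (t : ℂ) ^ r) (uIcc x y) := fun t ht =>
    (ContinuousAt.cpow (by fun_prop) (by fun_prop)
      (Or.inl (by simpa using hpos t ht))).continuousWithinAt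
  have hclog : ContinuousOn (fun t : ℝ => (Real.log (t / (2 * Real.pi)) : ℂ)) (uIcc x y) :=
    fun t ht => by
      have h2 : ContinuousAt (fun t : ℝ => Real.log (t / (2 * Real.pi))) t :=
        ContinuousAt.log (by fun_prop) (by have := Real.pi_pos; have := hpos t ht; positivity)
      exact (continuous_ofReal.continuousAt.comp h2).continuousWithinAt
  have hc1 : ContinuousOn (fun t : ℝ => (t : ℂ) ^ r / (2 * Real.pi) *
      (Real.log (t / (2 * Real.pi)) : ℂ)) (uIcc x y) := (hcpow.div_const _).mul hclog
  have hc2 : ContinuousOn (fun t : ℝ => (t : ℂ) ^ r / (r + 1) / (2 * Real.pi)) (uIcc x y) :=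
    (hcpow.div_const _).div_const _
  have hint := intervalIntegral.integral_eq_sub_of_hasDerivAt hder (hc1.add hc2).intervalIntegrable
  rw [intervalIntegral.integral_add hc1.intervalIntegrable hc2.intervalIntegrable,
    ← eq_sub_iff_add_eq] at hint
  rw [mainIntegral, hint]
  have hly : 0 ≤ Real.log y := Real.log_nonneg (hx.trans hxy)
  have hend : ∀ t ∈ Icc x y, ‖(t : ℂ) ^ (r + 1) / (r + 1) / (2 * Real.pi) *
      (Real.log (t / (2 * Real.pi)) : ℂ)‖ ≤ y * (Real.log y + 2) / τ := by
    intro t ht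
    have ht0 : 0 < t := by linarith [ht.1]
    have ht' : (t : ℂ) ≠ 0 := by exact_mod_cast ht0.ne'
    have h1 := norm_mainIntegrand_le (τ := τ) (hx.trans ht.1)
    have e : (t : ℂ) ^ (r + 1) / (r + 1) / (2 * Real.pi) * (Real.log (t / (2 * Real.pi)) : ℂ) =
        t / (r + 1) * ((t : ℂ) ^ r / (2 * Real.pi) * (Real.log (t / (2 * Real.pi)) : ℂ)) := by
      rw [cpow_add _ _ ht', cpow_one]
      field_simp
    rw [e, norm_mul, norm_div, norm_real, Real.norm_of_nonneg ht0.le]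
    have h2 : Real.log t ≤ Real.log y := Real.log_le_log ht0 ht.2
    have h3 : 0 ≤ Real.log t := Real.log_nonneg (hx.trans ht.1)
    have hy0 : 0 ≤ y := by linarith
    calc _ ≤ y / τ * (Real.log y + 2) := by
          refine mul_le_mul ?_ (h1.trans (by linarith)) (norm_nonneg _) (by positivity)
          have := ht.2
          gcongr
      _ = _ := by ring
  have hrem : ‖∫ t in x..y, (t : ℂ) ^ r / (r + 1) / (2 * Real.pi)‖ ≤ 1 / τ * |y - x| := by
    refine intervalIntegral.norm_integral_le_of_norm_le_const fun t ht => ?_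
    have ht0 := hpos t (uIoc_subset_uIcc ht)
    rw [norm_div, norm_div, norm_cpow_eq_rpow_re_of_pos ht0]
    have e1 : r.re = 0 := by simp [hr]
    have e2 : ‖(2 * Real.pi : ℂ)‖ = 2 * Real.pi := by
      rw [norm_mul, norm_ofNat, norm_real, Real.norm_of_nonneg Real.pi_pos.le]
    rw [e1, e2, Real.rpow_zero]
    have h1 : 1 / ‖r + 1‖ ≤ 1 / τ := one_div_le_one_div_of_le hτ hrn
    refine le_trans (div_le_self (by positivity) ?_) h1
    linarith [Real.pi_gt_three]
  rw [abs_of_nonneg (by linarith)] at hrem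
  have t1 := norm_sub_le ((y : ℂ) ^ (r + 1) / (r + 1) / (2 * Real.pi) *
      (Real.log (y / (2 * Real.pi)) : ℂ) - (x : ℂ) ^ (r + 1) / (r + 1) / (2 * Real.pi) *
      (Real.log (x / (2 * Real.pi)) : ℂ)) (∫ t in x..y, (t : ℂ) ^ r / (r + 1) / (2 * Real.pi))
  have t2 := norm_sub_le ((y : ℂ) ^ (r + 1) / (r + 1) / (2 * Real.pi) *
      (Real.log (y / (2 * Real.pi)) : ℂ)) ((x : ℂ) ^ (r + 1) / (r + 1) / (2 * Real.pi) *
      (Real.log (x / (2 * Real.pi)) : ℂ))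
  have t3 := hend y ⟨hxy, le_rfl⟩
  have t4 := hend x ⟨le_rfl, hxy⟩
  have t5 : 1 / τ * (y - x) ≤ y * (Real.log y + 2) / τ := by
    rw [one_div_mul_eq_div]
    gcongr
    nlinarith [mul_nonneg (by linarith : 0 ≤ y) hly]
  have e : 3 * (y * (Real.log y + 2)) / τ = y * (Real.log y + 2) / τ + y * (Real.log y + 2) / τ +
    y * (Real.log y + 2) / τ := by ring
  rw [e]
  linarith

/-- The finite set `S` holds the `n` that may have a stationary point, with main terms `m` and extra
errors `b`; the remaining error `n^{-a} G` is summed over all `n`. -/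
theorem norm_tsum_lineIntegral_sub_le {a x y τ G : ℝ} (ha : 1 < a) (hx : 0 < x) (hxy : x ≤ y)
    (S : Finset ℕ) (m : ℕ → ℂ) (b : ℕ → ℝ)
    (h : ∀ n, 2 ≤ n → ‖lineIntegral n a x y τ - (if n ∈ S then m n else 0)‖ ≤
      (n : ℝ) ^ (-a) * G + (if n ∈ S then b n else 0)) :
    ‖(∑' n : ℕ, (vonMangoldt n : ℂ) * lineIntegral n a x y τ) -
      ∑ n ∈ S, (vonMangoldt n : ℂ) * m n‖ ≤
      vonMangoldtSeries a * G + ∑ n ∈ S, vonMangoldt n * b n := by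
  have h1 : Summable fun n : ℕ => (vonMangoldt n : ℂ) * lineIntegral n a x y τ :=
    (hasSum_integral_vonMangoldt (e := -1) ha
      (continuousOn_zetaWeight_line τ (1 - a) hx hxy)).summable
  have h2 : HasSum (fun n : ℕ => if n ∈ S then (vonMangoldt n : ℂ) * m n else 0)
      (∑ n ∈ S, (vonMangoldt n : ℂ) * m n) := by
    have : HasSum (fun n : ℕ => if n ∈ S then (vonMangoldt n : ℂ) * m n else 0)
        (∑ n ∈ S, if n ∈ S then (vonMangoldt n : ℂ) * m n else 0) :=
      hasSum_sum_of_ne_finset_zero fun n hn => if_neg hn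
    rwa [Finset.sum_congr rfl fun n hn => if_pos hn] at this
  have h3 : HasSum (fun n : ℕ => if n ∈ S then vonMangoldt n * b n else 0)
      (∑ n ∈ S, vonMangoldt n * b n) := by
    have : HasSum (fun n : ℕ => if n ∈ S then vonMangoldt n * b n else 0)
        (∑ n ∈ S, if n ∈ S then vonMangoldt n * b n else 0) :=
      hasSum_sum_of_ne_finset_zero fun n hn => if_neg hn
    rwa [Finset.sum_congr rfl fun n hn => if_pos hn] at this
  rw [← (h1.hasSum.sub h2).tsum_eq]
  refine tsum_of_norm_bounded
    ((((summable_vonMangoldt_rpow ha).hasSum).mul_right G).add h3) fun n => ?_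
  rcases lt_or_ge n 2 with hn | hn
  · simp [vonMangoldt_eq_zero_of_lt_two hn]
  have e1 : (vonMangoldt n : ℂ) * lineIntegral n a x y τ -
      (if n ∈ S then (vonMangoldt n : ℂ) * m n else 0) =
      vonMangoldt n * (lineIntegral n a x y τ - (if n ∈ S then m n else 0)) := by
    split_ifs <;> ring
  have e2 : vonMangoldt n * (n : ℝ) ^ (-a) * G + (if n ∈ S then vonMangoldt n * b n else 0) =
      vonMangoldt n * ((n : ℝ) ^ (-a) * G + (if n ∈ S then b n else 0)) := by
    split_ifs <;> ring
  rw [e1, e2, norm_mul, norm_real, Real.norm_of_nonneg vonMangoldt_nonneg]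
  exact mul_le_mul_of_nonneg_left (h n hn) vonMangoldt_nonneg

/-- Here `τ/x ≤ c log 2` while `log n ≥ log 2`, so no integral has a stationary point and `S = ∅`.
As `τ ≤ x`, all exponential factors are bounded. -/
theorem exists_norm_zeroSum_sub_mainIntegral_le {c K : ℝ} (hc1 : c < 1) :
    ∃ B : ℝ, ∀ x y τ : ℝ, 2 ≤ x → x < y → y ≤ K * x → 0 ≤ τ → τ ≤ c * x * Real.log 2 →
      ‖zeroSum x y τ - mainIntegral x y τ‖ ≤ B * Real.log x ^ 2 := by
  by_cases hK : 1 ≤ K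
  swap
  · refine ⟨1, fun x y τ hx hxy hyK => ?_⟩
    push Not at hK
    nlinarith
  obtain ⟨C, hC, hform⟩ := exists_zeroSum_formula K 1
  obtain ⟨C1, hC1, hvm⟩ := exists_vonMangoldtSeries_abscissa_le
  have hl2 : 0 < Real.log 2 := Real.log_pos (by norm_num)
  have hl21 : Real.log 2 < 1 := by linarith [Real.log_two_lt_d9]
  -- The lower bound for `log n - τ/x` over all `n ≥ 2`; it is positive because `c < 1`.
  set l := (1 - c) * Real.log 2 with hl
  have hl0 : 0 < l := mul_pos (by linarith) hl2
  refine ⟨C * Real.exp 1 + 2 * (C1 * (Real.exp 1 * (2 / l + K / l ^ 2))),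
    fun x y τ hx hxy hyK hτ hτc => ?_⟩
  have hx0 : 0 < x := by linarith
  have hlx := half_le_log hx
  set a := 1 + 1 / (4 * Real.log x) with ha
  obtain ⟨ha1, ha2⟩ := abscissa_mem_Ioc hx ha
  have hτx : τ ≤ c * Real.log 2 * x := by linarith
  have hτ1 : τ ≤ 1 * x := by
    refine hτx.trans (mul_le_mul_of_nonneg_right ?_ hx0.le)
    nlinarith
  have hτl : τ ≤ 1 * x * Real.log x := by
    have h1 : Real.log 2 ≤ Real.log x := Real.log_le_log (by norm_num) hx
    have h2 : c * Real.log 2 ≤ Real.log x := by nlinarith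
    calc τ ≤ c * Real.log 2 * x := hτx
      _ ≤ Real.log x * x := mul_le_mul_of_nonneg_right h2 hx0.le
      _ = _ := by ring
  have hE : ∀ u : ℝ, u ≤ 1 → Real.exp (τ * u / x) ≤ Real.exp 1 := fun u hu => by
    apply Real.exp_le_exp.2
    rw [div_le_iff₀ hx0]
    nlinarith
  have h1 := hform x y τ a hx hxy hyK hτ hτl ha
  have h2 := norm_tsum_lineIntegral_sub_le (τ := τ) (G := Real.exp 1 * (2 / l + K / l ^ 2)) ha1
    hx0 hxy.le ∅ 0 0 fun n hn => by
      have hln : Real.log 2 ≤ Real.log n := Real.log_le_log (by norm_num) (by exact_mod_cast hn)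
      have h3 := norm_lineIntegral_le_of_log_ge (n := n) (by omega) (a := a) (l := l) hx0 hxy.le
        hτ hl0 (by linarith) (by
          have : τ / x ≤ c * Real.log 2 := by rwa [div_le_iff₀ hx0]
          rw [hl]; linarith)
      simp only [Finset.notMem_empty, if_false, sub_zero, add_zero]
      refine h3.trans (mul_le_mul_of_nonneg_left ?_ (by positivity))
      have h4 : τ * (y - x) / (x ^ 2 * l ^ 2) ≤ K / l ^ 2 := by
        calc _ ≤ (1 * x) * (K * x) / (x ^ 2 * l ^ 2) := by
              gcongr
              linarith
          _ = _ := by field_simp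
      have h5 : 0 ≤ τ * (y - x) / (x ^ 2 * l ^ 2) := by
        have : 0 ≤ y - x := by linarith
        positivity
      exact mul_le_mul (hE _ (by linarith)) (by linarith) (by positivity) (Real.exp_nonneg _)
  rw [Finset.sum_empty, Finset.sum_empty, sub_zero, add_zero] at h2
  have h6 : ‖2 * Real.pi * (zeroSum x y τ - mainIntegral x y τ)‖ ≤
      C * Real.exp (τ / (2 * x)) * Real.log x ^ 2 +
        vonMangoldtSeries a * (Real.exp 1 * (2 / l + K / l ^ 2)) := by
    have e : 2 * Real.pi * (zeroSum x y τ - mainIntegral x y τ) =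
        (2 * Real.pi * zeroSum x y τ - 2 * Real.pi * mainIntegral x y τ +
          ∑' n : ℕ, (vonMangoldt n : ℂ) * lineIntegral n a x y τ) -
        ∑' n : ℕ, (vonMangoldt n : ℂ) * lineIntegral n a x y τ := by ring
    rw [e]
    exact (norm_sub_le _ _).trans (add_le_add h1 h2)
  rw [norm_mul, norm_mul, norm_ofNat, norm_real, Real.norm_of_nonneg Real.pi_pos.le] at h6
  have h7 : ‖zeroSum x y τ - mainIntegral x y τ‖ ≤
      2 * Real.pi * ‖zeroSum x y τ - mainIntegral x y τ‖ :=
    le_mul_of_one_le_left (norm_nonneg _) (by linarith [Real.pi_gt_three])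
  refine h7.trans (h6.trans ?_)
  have h8 : Real.exp (τ / (2 * x)) ≤ Real.exp 1 := by
    have := hE (1 / 2) (by norm_num)
    rwa [show τ * (1 / 2) / x = τ / (2 * x) by field_simp] at this
  have h9 : 0 ≤ Real.exp 1 * (2 / l + K / l ^ 2) := by positivity
  have h10 : Real.log x ≤ 2 * Real.log x ^ 2 := by nlinarith only [hlx]
  rw [add_mul]
  refine add_le_add (by gcongr) ?_
  calc _ ≤ C1 * Real.log x * (Real.exp 1 * (2 / l + K / l ^ 2)) :=
        mul_le_mul_of_nonneg_right (hvm x a hx ha) h9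
    _ ≤ C1 * (2 * Real.log x ^ 2) * (Real.exp 1 * (2 / l + K / l ^ 2)) := by gcongr
    _ = _ := by ring

theorem rpow_neg_half_eq (n : ℕ) : (n : ℝ) ^ (-(1 / 2) : ℝ) = 1 / Real.sqrt n := by
  rw [Real.rpow_neg (Nat.cast_nonneg n), Real.sqrt_eq_rpow, one_div ((n : ℝ) ^ _)]

/-- Since `τ √(2π/τ) = 2π √τ / √(2π)`, the factor `2π` of the explicit formula splits off. -/
theorem stationaryValue_eq {n : ℕ} (hn : 2 ≤ n) {τ : ℝ} (hτ : 0 < τ) :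
    stationaryValue n τ = 2 * Real.pi * (exp (I * ((τ : ℂ) + (Real.pi : ℂ) / 4)) *
      (τ : ℂ) ^ (1 / 2 - I * (τ : ℂ)) / (Real.sqrt (2 * Real.pi) : ℂ)) *
      ((Real.log n : ℂ) ^ (I * (τ : ℂ)) / ((Real.sqrt n : ℂ) * (Real.log n : ℂ))) := by
  have hlog : 0 < Real.log n := Real.log_pos (by exact_mod_cast hn)
  have hpi := Real.pi_pos
  have hn0 : (0 : ℝ) < n := by exact_mod_cast (by omega : 0 < n)
  have hL' : (Real.log n : ℂ) ≠ 0 := by exact_mod_cast hlog.ne'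
  have hτ' : (τ : ℂ) ≠ 0 := by exact_mod_cast hτ.ne'
  have hsn : (Real.sqrt n : ℂ) ≠ 0 := by exact_mod_cast (Real.sqrt_pos.2 hn0).ne'
  have hsτ : (Real.sqrt τ : ℂ) ≠ 0 := by exact_mod_cast (Real.sqrt_pos.2 hτ).ne'
  have hs2 : (Real.sqrt (2 * Real.pi) : ℂ) ≠ 0 := by
    exact_mod_cast (Real.sqrt_pos.2 (by positivity : 0 < 2 * Real.pi)).ne'
  have e1 : ((τ / Real.log n : ℝ) : ℂ) ^ (-(I * (τ : ℂ))) =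
      (τ : ℂ) ^ (-(I * (τ : ℂ))) * (Real.log n : ℂ) ^ (I * (τ : ℂ)) := by
    have h0 : ((τ / Real.log n : ℝ) : ℂ) ≠ 0 := by exact_mod_cast (div_pos hτ hlog).ne'
    rw [cpow_def_of_ne_zero h0, cpow_def_of_ne_zero hτ', cpow_def_of_ne_zero hL', ← exp_add,
      ← ofReal_log (div_pos hτ hlog).le, ← ofReal_log hτ.le, ← ofReal_log hlog.le,
      Real.log_div hτ.ne' hlog.ne']
    congr 1
    push_cast
    ring
  have e2 : (τ : ℂ) ^ (1 / 2 - I * (τ : ℂ)) = (Real.sqrt τ : ℂ) * (τ : ℂ) ^ (-(I * (τ : ℂ))) := by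
    rw [sub_eq_add_neg, cpow_add _ _ hτ', Real.sqrt_eq_rpow, ofReal_cpow hτ.le]
    push_cast
    rfl
  have e3 : exp (I * ((τ : ℂ) + (Real.pi : ℂ) / 4)) = exp (I * τ) * exp (I * (Real.pi / 4)) := by
    rw [← exp_add]; congr 1; ring
  have e4 : (τ : ℂ) = (Real.sqrt τ : ℂ) ^ 2 := by
    rw [← ofReal_pow, Real.sq_sqrt hτ.le]
  have e5 : (2 * Real.pi : ℂ) = (Real.sqrt (2 * Real.pi) : ℂ) ^ 2 := by
    rw [← ofReal_pow, Real.sq_sqrt (by positivity)]; push_cast; ring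
  rw [stationaryValue, rpow_neg_half_eq, e1, e2, e3, Real.sqrt_div (by positivity), e5]
  have e6 : ((τ / Real.log n : ℝ) : ℂ) = (Real.sqrt τ : ℂ) ^ 2 / Real.log n := by
    rw [← e4, ofReal_div]
  rw [e6]
  generalize (τ : ℂ) ^ (-(I * (τ : ℂ))) = P
  generalize (Real.log n : ℂ) ^ (I * (τ : ℂ)) = Q
  generalize exp (I * τ) = R
  generalize exp (I * (Real.pi / 4)) = R'
  rw [ofReal_div, ofReal_div, ofReal_one]
  field_simp

/-- Nothing is lost by the range of `n`: `e^{τ/y} > 1` forces `n ≥ 2`, and `e^{τ/x}` lies below the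
cutoff `2 e^{τ/x}`. -/
theorem sum_stationaryValue_eq {x y τ : ℝ} (hy : 0 < y) (hτ : 0 < τ) :
    ∑ n ∈ Finset.Icc 2 ⌊2 * Real.exp (τ / x)⌋₊, (vonMangoldt n : ℂ) *
      (if τ / y ≤ Real.log n ∧ Real.log n ≤ τ / x then stationaryValue n τ else 0) =
      2 * Real.pi * stationaryTerm x y τ := by
  have hS : (Finset.Icc 2 ⌊2 * Real.exp (τ / x)⌋₊).filter
      (fun n : ℕ => τ / y ≤ Real.log n ∧ Real.log n ≤ τ / x) =
      Finset.Icc ⌈Real.exp (τ / y)⌉₊ ⌊Real.exp (τ / x)⌋₊ := by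
    ext n
    rw [Finset.mem_filter, Finset.mem_Icc, Finset.mem_Icc, Nat.ceil_le,
      Nat.le_floor_iff (Real.exp_nonneg _), Nat.le_floor_iff (by positivity)]
    constructor
    · rintro ⟨⟨h1, h2⟩, h3, h4⟩
      have hn0 : (0 : ℝ) < n := by exact_mod_cast (by omega : 0 < n)
      exact ⟨(Real.le_log_iff_exp_le hn0).1 h3, (Real.log_le_iff_le_exp hn0).1 h4⟩
    · rintro ⟨h1, h2⟩
      have h3 : 1 < Real.exp (τ / y) := Real.one_lt_exp_iff.2 (by positivity)
      have hn1 : (1 : ℝ) < n := h3.trans_le h1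
      have hn0 : (0 : ℝ) < n := by linarith
      refine ⟨⟨by exact_mod_cast hn1, by linarith [Real.exp_nonneg (τ / x)]⟩,
        (Real.le_log_iff_exp_le hn0).2 h1, (Real.log_le_iff_le_exp hn0).2 h2⟩
  have h1 : ∀ n ∈ Finset.Icc 2 ⌊2 * Real.exp (τ / x)⌋₊, (vonMangoldt n : ℂ) *
      (if τ / y ≤ Real.log n ∧ Real.log n ≤ τ / x then stationaryValue n τ else 0) =
      if τ / y ≤ Real.log n ∧ Real.log n ≤ τ / x then
        2 * Real.pi * (exp (I * ((τ : ℂ) + (Real.pi : ℂ) / 4)) *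
          (τ : ℂ) ^ (1 / 2 - I * (τ : ℂ)) / (Real.sqrt (2 * Real.pi) : ℂ)) *
          ((vonMangoldt n : ℂ) * (Real.log n : ℂ) ^ (I * (τ : ℂ)) /
            ((Real.sqrt n : ℂ) * (Real.log n : ℂ))) else 0 := by
    intro n hn
    split_ifs
    · rw [stationaryValue_eq (Finset.mem_Icc.1 hn).1 hτ]
      ring
    · rw [mul_zero]
  rw [Finset.sum_congr rfl h1, ← Finset.sum_filter, hS, ← Finset.mul_sum, stationaryTerm, mul_assoc]

/-- The total of the errors of the stationary phase approximations. -/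
theorem exists_sum_error_le {r0 : ℝ} (hr0 : 0 < r0) : ∃ C : ℝ, 0 < C ∧ ∀ x y τ : ℝ, 2 ≤ x → x < y →
    r0 ≤ τ / x →
    ∑ n ∈ Finset.Icc 2 ⌊2 * Real.exp (τ / x)⌋₊, vonMangoldt n * (1 / Real.sqrt n * (1 + τ / x +
        1 / (Real.sqrt τ / x + |Real.log n - τ / x|) +
        1 / (Real.sqrt τ / x + |Real.log n - τ / y|))) ≤ C * errorBound x y τ := by
  refine ⟨112 * 32 + 8 * (1 / r0 + 1 / r0 ^ 2), by positivity, fun x y τ hx hxy hr => ?_⟩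
  have hx0 : 0 < x := by linarith
  have hy0 : 0 < y := by linarith
  have hlx := half_le_log hx
  set r := τ / x with hrdef
  have hrpos : 0 < r := hr0.trans_le hr
  have hτx : τ = r * x := by rw [hrdef]; field_simp
  have hτ0 : 0 < τ := by rw [hτx]; positivity
  set M := ⌊2 * Real.exp r⌋₊ with hM
  set N' := τ / y with hN'
  have hN'0 : 0 < N' := by positivity
  have hN'r : N' ≤ r := by rw [hN', hrdef]; gcongr
  set η := Real.sqrt τ / x with hη
  have hsτ : 0 < Real.sqrt τ := Real.sqrt_pos.2 hτ0
  have hss : Real.sqrt τ * Real.sqrt τ = τ := Real.mul_self_sqrt hτ0.le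
  have hη0 : 0 < η := by positivity
  have hexp1 : 1 ≤ Real.exp r := Real.one_le_exp hrpos.le
  have hMle : (M : ℝ) ≤ 2 * Real.exp r := Nat.floor_le (by positivity)
  have hMge : Real.exp r ≤ M := by
    have := Nat.lt_floor_add_one (2 * Real.exp r)
    have : 2 * Real.exp r < M + 1 := this
    linarith
  have hM0 : (0 : ℝ) < M := by linarith
  have hlogM : Real.log M ≤ 1 + r := by
    have := Real.log_le_log hM0 hMle
    rw [Real.log_mul two_ne_zero (Real.exp_ne_zero _), Real.log_exp] at this
    linarith [Real.log_two_lt_d9]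
  have hlogM0 : 0 ≤ Real.log M := Real.log_nonneg (by linarith)
  set E0 := Real.exp (τ / (2 * x)) with hE0
  have hE0r : E0 = Real.exp (r / 2) := by rw [hE0, hrdef]; congr 1; field_simp
  have hsM : Real.sqrt M ≤ 2 * E0 := by
    rw [hE0r, Real.exp_half]
    calc Real.sqrt M ≤ Real.sqrt (2 ^ 2 * Real.exp r) := Real.sqrt_le_sqrt (by linarith)
      _ = 2 * Real.sqrt (Real.exp r) := by
        rw [Real.sqrt_mul (by norm_num), Real.sqrt_sq (by norm_num)]
  have hsM0 : 0 ≤ Real.sqrt M := Real.sqrt_nonneg _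
  have s0 := sum_vonMangoldt_div_sqrt_le M
  have s1 := sum_vonMangoldt_div_le (N := Real.exp r) hexp1 hMge hη0
  have s2 := sum_vonMangoldt_div_le (N := Real.exp N') (Real.one_le_exp hN'0.le)
    ((Real.exp_le_exp.2 hN'r).trans hMge) hη0
  rw [Real.log_exp] at s1 s2
  have hsplit : ∑ n ∈ Finset.Icc 2 M, vonMangoldt n * (1 / Real.sqrt n * (1 + r +
        1 / (η + |Real.log n - r|) + 1 / (η + |Real.log n - N'|))) =
      (1 + r) * ∑ n ∈ Finset.Icc 2 M, vonMangoldt n * (1 / Real.sqrt n) +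
      ∑ n ∈ Finset.Icc 2 M, vonMangoldt n * (1 / Real.sqrt n * (1 / (η + |Real.log n - r|))) +
      ∑ n ∈ Finset.Icc 2 M, vonMangoldt n * (1 / Real.sqrt n * (1 / (η + |Real.log n - N'|))) := by
    rw [Finset.mul_sum, ← Finset.sum_add_distrib, ← Finset.sum_add_distrib]
    refine Finset.sum_congr rfl fun n _ => ?_
    ring
  rw [hsplit]
  set W := Real.exp (τ / (2 * x) - τ / y) with hW
  have hWpos : 0 < W := Real.exp_pos _
  -- The contribution of the `n` next to `e^u`, for `u = τ/x` and `u = τ/y`: `e^{-u/2} ≤ e^{τ/(2x) -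
  -- τ/y}` because `τ/y` is the smaller of the two, and `1/η = √τ / r`.
  have hnear : ∀ u, 0 < u → N' ≤ u → u ≤ r → (1 + u) / (Real.sqrt (Real.exp u) * η) ≤
      (1 / r0 + 1 / r0 ^ 2) * (Real.sqrt τ * W * r) := by
    intro u hu0 hu1 hu2
    have h1 : 1 / Real.sqrt (Real.exp u) ≤ W := by
      rw [← Real.exp_half, one_div, ← Real.exp_neg, hW]
      apply Real.exp_le_exp.2
      have : τ / (2 * x) = r / 2 := by rw [hrdef]; field_simp
      rw [this, ← hN']
      linarith
    have h2 : 1 / η = Real.sqrt τ / r := by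
      rw [hη, hrdef, one_div_div, div_div_eq_mul_div, div_eq_div_iff hsτ.ne' hτ0.ne']
      nth_rewrite 1 [← hss]
      ring
    -- The lower bound `r ≥ r0` is what allows negative powers of `r` to be absorbed.
    have h3 : (1 + r) / r ≤ (1 / r0 + 1 / r0 ^ 2) * r := by
      rw [div_le_iff₀ hrpos]
      have a1 : 1 ≤ 1 / r0 * r := by rwa [one_div_mul_eq_div, one_le_div hr0]
      have a2 : 1 ≤ 1 / r0 ^ 2 * r ^ 2 := by
        rw [one_div_mul_eq_div, one_le_div (by positivity)]; gcongr
      nlinarith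
    calc (1 + u) / (Real.sqrt (Real.exp u) * η) =
          (1 + u) * (1 / Real.sqrt (Real.exp u)) * (1 / η) := by
          field_simp
      _ ≤ (1 + r) * W * (Real.sqrt τ / r) := by
          rw [h2]
          gcongr
      _ = (1 + r) / r * (Real.sqrt τ * W) := by ring
      _ ≤ (1 / r0 + 1 / r0 ^ 2) * r * (Real.sqrt τ * W) := by gcongr
      _ = _ := by ring
  have n1 := hnear r hrpos hN'r le_rfl
  have n2 := hnear N' hN'0 le_rfl hN'r
  have hq : (2 + r) ^ 2 ≤ 32 * (Real.log x ^ 2 + r ^ 2 * Real.log x) := by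
    have a1 : 1 / 4 ≤ Real.log x ^ 2 := by nlinarith only [hlx]
    have a2 : r ^ 2 * (1 / 2) ≤ r ^ 2 * Real.log x := by gcongr
    nlinarith only [a1, a2, sq_nonneg (r - 2)]
  have hbig : 6 * (1 + Real.log M) ^ 2 * Real.sqrt M ≤ 12 * (2 + r) ^ 2 * E0 := by
    calc _ ≤ 6 * (2 + r) ^ 2 * (2 * E0) := mul_le_mul (mul_le_mul_of_nonneg_left
          (pow_le_pow_left₀ (by positivity) (by linarith) 2) (by norm_num)) hsM hsM0 (by positivity)
      _ = _ := by ring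
  have hsmall : (1 + r) * ∑ n ∈ Finset.Icc 2 M, vonMangoldt n * (1 / Real.sqrt n) ≤
      4 * (2 + r) ^ 2 * E0 := by
    calc _ ≤ (1 + r) * (2 * (1 + r) * (2 * E0)) := by
          refine mul_le_mul_of_nonneg_left (s0.trans ?_) (by positivity)
          gcongr
      _ = 4 * (1 + r) ^ 2 * E0 := by ring
      _ ≤ _ := by gcongr; norm_num
  have hE0pos : 0 < E0 := Real.exp_pos _
  have hfin : 28 * (2 + r) ^ 2 * E0 ≤ 112 * 32 * (E0 * (Real.log x ^ 2 + r ^ 2 * Real.log x)) := by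
    have a1 := mul_le_mul_of_nonneg_right hq hE0pos.le
    have a2 : 0 ≤ E0 * (Real.log x ^ 2 + r ^ 2 * Real.log x) := by
      have : 0 ≤ Real.log x := by linarith
      positivity
    linarith
  rw [errorBound, ← hE0, ← hrdef, ← hW]
  have p1 : 0 ≤ E0 * (Real.log x ^ 2 + r ^ 2 * Real.log x) := by
    have : 0 ≤ Real.log x := by linarith
    positivity
  have p2 : 0 ≤ Real.sqrt τ * W * r := by positivity
  have p3 : 0 ≤ 1 / r0 + 1 / r0 ^ 2 := by positivity
  linarith [mul_nonneg p3 p1]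

/-- The cutoff `2 e^{τ/x}` leaves a gap of `log 2` between `log n` and `τ/x` for all larger `n`,
which therefore stay on `Re s = 1 - a`, where their sum converges. Only the finitely many smaller
`n` are moved to the critical line, where the series would not converge. -/
theorem exists_norm_zeroSum_add_stationaryTerm_le {c : ℝ} (hc0 : 0 < c) (K A : ℝ) :
    ∃ B : ℝ, ∀ x y τ : ℝ, 2 ≤ x → x < y → y ≤ K * x →
      c * x * Real.log 2 ≤ τ → τ ≤ A * x * Real.log x →
        ‖zeroSum x y τ - (-stationaryTerm x y τ)‖ ≤ B * errorBound x y τ := by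
  by_cases hK : 1 ≤ K
  swap
  · refine ⟨1, fun x y τ hx hxy hyK => ?_⟩
    push Not at hK
    nlinarith
  have hl2 : 0 < Real.log 2 := Real.log_pos (by norm_num)
  obtain ⟨C, hC, hform⟩ := exists_zeroSum_formula K A
  obtain ⟨C1, hC1, hvm⟩ := exists_vonMangoldtSeries_abscissa_le
  obtain ⟨C2, hC2, hcrit⟩ := exists_norm_lineIntegral_half_sub_le hc0 hK
  obtain ⟨C3, hC3, hsum⟩ := exists_sum_error_le (r0 := c * Real.log 2) (by positivity)
  set κ := 1 + Real.log K / Real.log 2 with hκ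
  have hκ0 : 0 < κ := by
    have := Real.log_nonneg hK
    positivity
  set C4 := 2 + 2 / Real.log 2 + K / Real.log 2 ^ 2 with hC4
  have hC40 : 0 < C4 := by positivity
  refine ⟨C + C1 * (4 * (Real.exp (A / 4) * C4)) + (C2 + 2) * C3 +
    2 * (21 * (K * (κ + 4)) / (c * Real.log 2)), fun x y τ hx hxy hyK hτ hτA => ?_⟩
  have hx0 : 0 < x := by linarith
  have hy0 : 0 < y := by linarith
  have hlx := half_le_log hx
  have hτ0 : 0 < τ := lt_of_lt_of_le (by positivity) hτ
  set a := 1 + 1 / (4 * Real.log x) with ha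
  obtain ⟨ha1, ha2⟩ := abscissa_mem_Ioc hx ha
  set l := Real.log x with hl
  set r := τ / x with hr
  have hr0 : 0 < r := by positivity
  have hrc : c * Real.log 2 ≤ r := by
    rw [hr, le_div_iff₀ hx0]; linarith
  set E0 := Real.exp (τ / (2 * x)) with hE0
  have hE0pos : 0 < E0 := Real.exp_pos _
  have hE01 : 1 ≤ E0 := Real.one_le_exp (by positivity)
  have hED := exp_abscissa_le hx hτA ha
  set E := Real.exp (τ * (a - 1 / 2) / x) with hE
  have hEpos : 0 < E := Real.exp_pos _
  have hQ : E0 * (l ^ 2 + r ^ 2 * l) ≤ errorBound x y τ := by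
    rw [errorBound]
    exact le_add_of_nonneg_right (by positivity)
  have hl0 : 0 < l := by linarith
  have h1 := hform x y τ a hx hxy hyK hτ0.le hτA ha
  -- Moving the line for `n` below the cutoff costs `2 n^{-a} E`; this makes it fit under the
  -- majorant used for all `n`.
  have hGE : 2 * E ≤ E * (C4 * (1 + r)) := by
    have : 2 ≤ C4 * (1 + r) := by
      have : 2 ≤ C4 := by
        have a1 : 0 ≤ 2 / Real.log 2 := by positivity
        have a2 : 0 ≤ K / Real.log 2 ^ 2 := by positivity
        linarith
      nlinarith
    nlinarith
  have h2 := norm_tsum_lineIntegral_sub_le (τ := τ) (G := E * (C4 * (1 + r))) ha1 hx0 hxy.le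
    (Finset.Icc 2 ⌊2 * Real.exp r⌋₊)
    (fun n => if τ / y ≤ Real.log n ∧ Real.log n ≤ τ / x then stationaryValue n τ else 0)
    (fun n => (C2 + 2) * (1 / Real.sqrt n * (1 + τ / x +
        1 / (Real.sqrt τ / x + |Real.log n - τ / x|) +
        1 / (Real.sqrt τ / x + |Real.log n - τ / y|)))) fun n hn => by
      have hn0 : (0 : ℝ) < n := by exact_mod_cast (by omega : 0 < n)
      by_cases hS : n ∈ Finset.Icc 2 ⌊2 * Real.exp r⌋₊
      · rw [if_pos hS, if_pos hS]
        rw [Finset.mem_Icc, Nat.le_floor_iff (by positivity)] at hS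
        have b1 := norm_lineIntegral_sub_half_le (n := n) (by omega) hx0 hxy.le hτ0.le
          (by linarith : 1 / 2 ≤ a) ha2
        have b2 := hcrit x y τ n hx hxy hyK hτ hn hS.2
        rw [rpow_neg_half_eq] at b1 b2
        have b3 := norm_add_le (lineIntegral n a x y τ - lineIntegral n (1 / 2) x y τ)
          (lineIntegral n (1 / 2) x y τ -
            (if τ / y ≤ Real.log n ∧ Real.log n ≤ τ / x then stationaryValue n τ else 0))
        rw [sub_add_sub_cancel] at b3
        refine b3.trans ((add_le_add b1 b2).trans ?_)
        have b4 : 1 / Real.sqrt n ≤ 1 / Real.sqrt n * (1 + τ / x +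
            1 / (Real.sqrt τ / x + |Real.log n - τ / x|) +
            1 / (Real.sqrt τ / x + |Real.log n - τ / y|)) := by
          refine le_mul_of_one_le_right (by positivity) ?_
          have p1 : 0 ≤ 1 / (Real.sqrt τ / x + |Real.log n - τ / x|) := by positivity
          have p2 : 0 ≤ 1 / (Real.sqrt τ / x + |Real.log n - τ / y|) := by positivity
          linarith
        have b5 := mul_le_mul_of_nonneg_left hGE (by positivity : 0 ≤ (n : ℝ) ^ (-a))
        linarith
      · rw [if_neg hS, if_neg hS, sub_zero, add_zero]
        have hbig : 2 * Real.exp r ≤ n := by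
          rw [Finset.mem_Icc, Nat.le_floor_iff (by positivity), not_and] at hS
          exact (not_le.1 (hS hn)).le
        have hlog : r + Real.log 2 ≤ Real.log n := by
          have := Real.log_le_log (by positivity) hbig
          rw [Real.log_mul two_ne_zero (Real.exp_ne_zero _), Real.log_exp] at this
          linarith
        have b1 := norm_lineIntegral_le_of_log_ge (n := n) (by omega) hx0 hxy.le hτ0.le hl2
          (by linarith : 1 / 2 ≤ a) hlog
        refine b1.trans ?_
        have b2 : τ * (y - x) / (x ^ 2 * Real.log 2 ^ 2) ≤ K / Real.log 2 ^ 2 * r := by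
          calc _ ≤ τ * (K * x) / (x ^ 2 * Real.log 2 ^ 2) := by gcongr; linarith
            _ = _ := by rw [hr]; field_simp
        have b3 : 2 / Real.log 2 + τ * (y - x) / (x ^ 2 * Real.log 2 ^ 2) ≤ C4 * (1 + r) := by
          have a1 : 0 ≤ 2 / Real.log 2 := by positivity
          have a2 : 0 ≤ K / Real.log 2 ^ 2 := by positivity
          rw [hC4]
          linarith [mul_nonneg a1 hr0.le]
        gcongr
  rw [sum_stationaryValue_eq hy0 hτ0] at h2
  have hT : ∑ n ∈ Finset.Icc 2 ⌊2 * Real.exp r⌋₊, vonMangoldt n *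
      ((C2 + 2) * (1 / Real.sqrt n * (1 + τ / x +
        1 / (Real.sqrt τ / x + |Real.log n - τ / x|) +
        1 / (Real.sqrt τ / x + |Real.log n - τ / y|)))) ≤
      (C2 + 2) * C3 * errorBound x y τ := by
    have := mul_le_mul_of_nonneg_left (hsum x y τ hx hxy hrc) (by linarith : 0 ≤ C2 + 2)
    rw [Finset.mul_sum] at this
    refine le_trans (le_of_eq (Finset.sum_congr rfl fun n _ => ?_)) (this.trans (le_of_eq ?_))
    · ring
    · ring
  have hV : vonMangoldtSeries a * (E * (C4 * (1 + r))) ≤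
      C1 * (4 * (Real.exp (A / 4) * C4)) * errorBound x y τ := by
    have b1 : (1 + r) * l ≤ 4 * (l ^ 2 + r ^ 2 * l) := by
      have a1 : 1 + r ≤ 4 * (l + r ^ 2) := by nlinarith only [hlx, sq_nonneg (r - 1 / 2)]
      calc (1 + r) * l ≤ 4 * (l + r ^ 2) * l := by gcongr
        _ = _ := by ring
    calc _ ≤ C1 * l * (Real.exp (A / 4) * E0 * (C4 * (1 + r))) := by
          gcongr
          exact hvm x a hx ha
      _ = C1 * (Real.exp (A / 4) * C4) * (E0 * ((1 + r) * l)) := by ring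
      _ ≤ C1 * (Real.exp (A / 4) * C4) * (E0 * (4 * (l ^ 2 + r ^ 2 * l))) := by gcongr
      _ = C1 * (4 * (Real.exp (A / 4) * C4)) * (E0 * (l ^ 2 + r ^ 2 * l)) := by ring
      _ ≤ _ := by gcongr
  have hEl : E0 * l ^ 2 ≤ errorBound x y τ := by
    refine le_trans ?_ hQ
    have : 0 ≤ r ^ 2 * l := by positivity
    gcongr
    linarith
  -- In this range `τ` is at least a constant times `x`, so the main integral is `O(log x)` and
  -- joins the error.
  have hm : ‖2 * Real.pi * mainIntegral x y τ‖ ≤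
      2 * (21 * (K * (κ + 4)) / (c * Real.log 2)) * errorBound x y τ := by
    rw [norm_mul, norm_mul, norm_ofNat, norm_real, Real.norm_of_nonneg Real.pi_pos.le]
    have b1 := norm_mainIntegral_le (by linarith : 1 ≤ x) hxy.le hτ0
    have b2 : Real.log y + 2 ≤ (κ + 4) * l := by
      have := log_le_mul_log hK hx hy0 hyK
      linarith
    have b0 : 0 ≤ Real.log y := Real.log_nonneg (by linarith)
    have b3 : 3 * (y * (Real.log y + 2)) / τ ≤ 3 * ((K * x) * ((κ + 4) * l)) /
        (c * x * Real.log 2) := by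
      gcongr
    have b4 : l ≤ 2 * errorBound x y τ := by
      have : l ≤ 2 * l ^ 2 := by nlinarith only [hlx]
      have : l ^ 2 ≤ E0 * l ^ 2 := le_mul_of_one_le_left (by positivity) hE01
      linarith
    calc _ ≤ 7 * (3 * ((K * x) * ((κ + 4) * l)) / (c * x * Real.log 2)) := by
          refine mul_le_mul ?_ (b1.trans b3) (norm_nonneg _) (by norm_num)
          linarith [Real.pi_lt_d2]
      _ = 21 * (K * (κ + 4)) / (c * Real.log 2) * l := by field_simp; ring
      _ ≤ 21 * (K * (κ + 4)) / (c * Real.log 2) * (2 * errorBound x y τ) := by gcongr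
      _ = _ := by ring
  have h6 : ‖2 * Real.pi * (zeroSum x y τ - (-stationaryTerm x y τ))‖ ≤
      C * E0 * l ^ 2 + (vonMangoldtSeries a * (E * (C4 * (1 + r))) +
        ∑ n ∈ Finset.Icc 2 ⌊2 * Real.exp r⌋₊, vonMangoldt n *
        ((C2 + 2) * (1 / Real.sqrt n * (1 + τ / x +
        1 / (Real.sqrt τ / x + |Real.log n - τ / x|) +
        1 / (Real.sqrt τ / x + |Real.log n - τ / y|))))) +
      2 * (21 * (K * (κ + 4)) / (c * Real.log 2)) * errorBound x y τ := by
    have e : 2 * Real.pi * (zeroSum x y τ - (-stationaryTerm x y τ)) =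
        (2 * Real.pi * zeroSum x y τ - 2 * Real.pi * mainIntegral x y τ +
          ∑' n : ℕ, (vonMangoldt n : ℂ) * lineIntegral n a x y τ) -
        ((∑' n : ℕ, (vonMangoldt n : ℂ) * lineIntegral n a x y τ) -
          2 * Real.pi * stationaryTerm x y τ) + 2 * Real.pi * mainIntegral x y τ := by ring
    rw [e]
    exact (norm_add_le _ _).trans (add_le_add ((norm_sub_le _ _).trans (add_le_add h1 h2)) hm)
  rw [norm_mul, norm_mul, norm_ofNat, norm_real, Real.norm_of_nonneg Real.pi_pos.le] at h6
  have h7 : ‖zeroSum x y τ - (-stationaryTerm x y τ)‖ ≤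
      2 * Real.pi * ‖zeroSum x y τ - (-stationaryTerm x y τ)‖ :=
    le_mul_of_one_le_left (norm_nonneg _) (by linarith [Real.pi_gt_three])
  refine h7.trans (h6.trans ?_)
  have h8 : C * E0 * l ^ 2 ≤ C * errorBound x y τ := by
    rw [mul_assoc]; gcongr
  linarith

theorem theorem2 (c : ℝ) (hc0 : 0 < c) (hc1 : c < 1) (K : ℝ) :
    (∃ B : ℝ, ∀ x y τ : ℝ, 2 ≤ x → x < y → y ≤ K * x →
      0 ≤ τ → τ ≤ c * x * Real.log 2 →
        ‖zeroSum x y τ - mainIntegral x y τ‖ ≤ B * Real.log x ^ 2) ∧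
    (∀ A : ℝ, ∃ B : ℝ, ∀ x y τ : ℝ, 2 ≤ x → x < y → y ≤ K * x →
      c * x * Real.log 2 ≤ τ → τ ≤ A * x * Real.log x →
        ‖zeroSum x y τ - (-stationaryTerm x y τ)‖ ≤ B * errorBound x y τ) :=
  ⟨exists_norm_zeroSum_sub_mainIntegral_le hc1,
    exists_norm_zeroSum_add_stationaryTerm_le hc0 K⟩
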